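/- Let $k\ge 2$, let $\mathbb{Z}_k$ act on $\mathbb{C}^2$ by $(z_1,z_2)\mapsto(\omega z_1,\omega^{-1}z_2)$ with $\omega=e^{2\pi i/k}$, and let $\mathbb{T}^2=(\mathbb{C}^\times)^2$ act by $(z_1,z_2)\mapsto(t_1z_1,t_2z_2)$, with equivariant parameters $\epsilon_1,\epsilon_2$ (linearly independent over $\mathbb{Z}$ in a field of characteristic $0$). For a smooth $\mathbb{T}^2$-variety $M$ with finitely many fixed points, $\int_M 1:=\sum_{p\in M^{\mathbb{T}^2}}1/\mathrm{Eu}(T_pM)$ denotes the equivariant integral, where $\mathrm{Eu}(T_pM)$ is the product of the tangent weights $w_1\epsilon_1+w_2\epsilon_2$. For $v=(v_0,\dots,v_{k-1})\in\mathbb{Z}_{\ge0}^k$ put $|v|=\sum_i v_i$ and let $\mathrm{Hilb}^{|v|}(\mathbb{C}^2)^{\mathbb{Z}_k,v}$ be the space of $\mathbb{Z}_k$-invariant ideals $I\subset\mathbb{C}[z_1,z_2]$ with $\mathbb{C}[z_1,z_2]/I\cong\bigoplus_i v_i\rho_i$, where $z_1^az_2^b$ has $\mathbb{Z}_k$-weight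 $a-b$. In formal variables $\tilde q,q_0,\dots,q_{k-1}$ define $$Z_{[\mathbb{C}^2/\mathbb{Z}_k]}=\sum_{v\in\mathbb{Z}_{\ge0}^k}\tilde q^{|v|}\prod_{i=0}^{k-1}q_i^{v_i}\int_{\mathrm{Hilb}^{|v|}(\mathbb{C}^2)^{\mathbb{Z}_k,v}}1 .$$ Let $C$ be the (positive definite) Cartan matrix of type $A_{k-1}$ and let $\mathcal{U}=C\,\mathbb{Z}^{k-1}\subset\mathbb{Z}^{k-1}$ be the set of $u$ such that $\sum_iu_i\omega_i$ ($\omega_i$ the fundamental weights) lies in the root lattice. Let $X_k\to\mathbb{C}^2/\mathbb{Z}_k$ be the minimal resolution and let $$Z_{X_k}(q,\xi)=\sum_{u\in\mathcal{U}}\xi^u\sum_{n\ge0}q^{\,n+\frac12u\cdot C^{-1}u}\int_{\mathrm{Hilb}^n(X_k)}1 ,$$ where $\xi=(\xi_1,\dots,\xi_{k-1})$ and $\xi^u=\prod_i\xi_i^{u_i}$; this is the $U(1)$ instanton partition function of $X_k$ with trivial holonomy at infinity. Put $\hat\eta(q)=\prod_{n\ge1}(1-q^n)$ and let $\chi(q,\xi)=\hat\eta(q)^{-(k-1)}\sum_{u\in\mathcal{U}}q^{\frac12u\cdot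 C^{-1}u}\xi^u$ be the level-one $\widehat{\mathfrak{sl}}_k$ character of highest weight $\hat\omega_0$. For a Young diagram $Y$ let $\nu_i(Y)$ be the number of nodes $(a,b)\in Y$ with $a-b\equiv i$ mod $k$, and for a node $s$ let $A(s)$, $L(s)$ be the numbers of nodes beyond $s$ with the same first, respectively second, coordinate, and $h(s)=A(s)+L(s)+1$. Then: 1. The torus fixed points of $\mathrm{Hilb}^{|v|}(\mathbb{C}^2)^{\mathbb{Z}_k,v}$ are the monomial ideals of the finitely many Young diagrams $Y$ with $\nu(Y)=v$, and $$\int_{\mathrm{Hilb}^{|v|}(\mathbb{C}^2)^{\mathbb{Z}_k,v}}1=S_v:=\sum_{\nu(Y)=v}\ \prod_{s\in Y,\ k\mid h(s)}\frac1{\big((L(s)+1)\epsilon_1-A(s)\epsilon_2\big)\big(-L(s)\epsilon_1+(A(s)+1)\epsilon_2\big)} .$$ 2. $Z_{[\mathbb{C}^2/\mathbb{Z}_k]}=Z^{\rm core}\,Z^{\rm quot}$, where $Z^{\rm core}=\sum_Y\tilde q^{|Y|}\prod_iq_i^{\nu_i(Y)}$ is the sum over the Young diagrams without $k$-hooks (the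 $k$-cores) and $Z^{\rm quot}=\sum_{v_0=\dots=v_{k-1}}\tilde q^{|v|}\prod_iq_i^{v_i}\,S_v$. 3. With $q=\tilde q^k\prod_{i=0}^{k-1}q_i$ and $\xi_i=\prod_{j=1}^{k-1}(\tilde q\,q_j)^{(C^{-1})^{ij}}$, one has $Z^{\rm core}=\hat\eta(q)^{k-1}\chi(q,\xi)$, $Z^{\rm quot}=\exp\big(\tfrac{q}{k\epsilon_1\epsilon_2}\big)$ and $$Z_{[\mathbb{C}^2/\mathbb{Z}_k]}=Z_{X_k}(q,\xi)=\hat\eta(q)^{k-1}\,\chi(q,\xi)\,\exp\Big(\frac{q}{k\,\epsilon_1\epsilon_2}\Big).$$ All of these are identities of formal series in $\tilde q,q_0,\dots,q_{k-1}$ (all the sums involved being formally summable). -/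

import Mathlib

open scoped BigOperators

namespace ALE

noncomputable section

/-! ## Torus actions on the affine plane, and fixed points of Hilbert schemes -/

/-- The coordinate ring `ℂ[x, y]` of the affine plane. -/
abbrev PlaneRing : Type := MvPolynomial (Fin 2) ℂ

/-- The torus `𝕋² = ℂˣ × ℂˣ`. -/
abbrev Torus : Type := ℂˣ × ℂˣ

/-- The character `(t₁, t₂) ↦ t₁ ^ w₁ * t₂ ^ w₂` of the torus of weight `w = (w₁, w₂)`. -/
def torusChar (w : ℤ × ℤ) (t : Torus) : ℂˣ := t.1 ^ w.1 * t.2 ^ w.2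

/-- If the torus acts on the plane by `t ▹ (x, y) = (t ^ α * x, t ^ β * y)`, this is the
substitution `f (x, y) ↦ f (t ^ α * x, t ^ β * y)` on functions. -/
def torusSubst (α β : ℤ × ℤ) (t : Torus) : PlaneRing →ₐ[ℂ] PlaneRing :=
  MvPolynomial.aeval
    ![MvPolynomial.C ((torusChar α t : ℂˣ) : ℂ) * MvPolynomial.X 0,
      MvPolynomial.C ((torusChar β t : ℂˣ) : ℂ) * MvPolynomial.X 1]

/-- The ideals of finite codimension of `ℂ[x, y]` which are fixed by the torus acting on the
coordinates `x`, `y` with weights `α`, `β`, i.e. the torus fixed points of the Hilbert scheme of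
points of the plane. -/
structure FixedIdeal (α β : ℤ × ℤ) where
  ideal : Ideal PlaneRing
  finite : Module.Finite ℂ (PlaneRing ⧸ ideal)
  fixed : ∀ t : Torus, ∀ f ∈ ideal, torusSubst α β t f ∈ ideal

namespace FixedIdeal

variable {α β : ℤ × ℤ}

/-- The number of points `dim ℂ[x, y] / I`. -/
def colength (I : FixedIdeal α β) : ℕ := Module.finrank ℂ (PlaneRing ⧸ I.ideal)

/-- The map induced on `ℂ[x, y] / I` by the substitution of a torus element. -/
def quotSubst (I : FixedIdeal α β) (t : Torus) :
    (PlaneRing ⧸ I.ideal) →ₐ[ℂ] (PlaneRing ⧸ I.ideal) :=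
  Ideal.quotientMapₐ I.ideal (torusSubst α β t) (fun f hf => I.fixed t f hf)

/-- The tangent space `Hom (I, ℂ[x, y] / I)` of the Hilbert scheme at `I`. -/
abbrev Tangent (I : FixedIdeal α β) : Type :=
  I.ideal →ₗ[PlaneRing] (PlaneRing ⧸ I.ideal)

/-- The subspace of the tangent space on which the torus element `t` acts as the scalar `c`.
A torus element acts on functions by `(t • f) (p) = f (t⁻¹ ▹ p)` and on tangent vectors by
`(t • φ) (f) = t • φ (t⁻¹ • f)`, whence the condition below. -/
def tangentEigen (I : FixedIdeal α β) (t : Torus) (c : ℂ) : Submodule ℂ I.Tangent where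
  carrier := {φ | ∀ f : I.ideal,
    φ ⟨torusSubst α β t f, I.fixed t f f.2⟩ = c • I.quotSubst t (φ f)}
  add_mem' := by
    intro φ ψ hφ hψ f
    simp only [LinearMap.add_apply, map_add, smul_add]
    rw [hφ f, hψ f]
  zero_mem' := by
    intro f
    simp
  smul_mem' := by
    intro a φ hφ f
    simp only [LinearMap.smul_apply, map_smul]
    rw [hφ f, smul_comm]

/-- The weight space of weight `w` of the torus in the tangent space. -/
def tangentWeight (I : FixedIdeal α β) (w : ℤ × ℤ) : Submodule ℂ I.Tangent :=
  ⨅ t : Torus, I.tangentEigen t ((torusChar w t : ℂˣ) : ℂ)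

/-- The equivariant Euler class of a torus invariant subspace `V` of the tangent space at `I`: the
product of the weights `w₁ ε₁ + w₂ ε₂` of `V`, with multiplicities. -/
def euler {K : Type*} [Field K] (ε₁ ε₂ : K) (I : FixedIdeal α β) (V : Submodule ℂ I.Tangent) : K :=
  ∏ᶠ w : ℤ × ℤ, ((w.1 : K) * ε₁ + (w.2 : K) * ε₂) ^
    Module.finrank ℂ (I.tangentWeight w ⊓ V : Submodule ℂ I.Tangent)

end FixedIdeal

/-! ## Invariant Hilbert schemes of the plane -/

/-- A torus fixed ideal for the standard action `t ▹ (z₁, z₂) = (t₁ z₁, t₂ z₂)`. -/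
abbrev StdFixedIdeal : Type := FixedIdeal (1, 0) (0, 1)

/-- The primitive root of unity `ω = exp (2 π i / k)`. -/
def rootOfUnity (k : ℕ) : ℂˣ :=
  Units.mk0 (Complex.exp (2 * Real.pi * Complex.I / k)) (Complex.exp_ne_zero _)

/-- The generator `ζ ▹ (z₁, z₂) = (ω z₁, ω⁻¹ z₂)` of `ℤ_k`, as an element of the torus. -/
def cyclicGen (k : ℕ) : Torus := (rootOfUnity k, (rootOfUnity k)⁻¹)

/-- The multiplicity of the irreducible representation `ρ_i` of `ℤ_k` in `ℂ[z₁, z₂] / I`: the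
dimension of the subspace on which the generator acts by `ω ^ i`. -/
def repMult (k : ℕ) (I : StdFixedIdeal) (i : Fin k) : ℕ :=
  Module.finrank ℂ (LinearMap.ker ((I.quotSubst (cyclicGen k)).toLinearMap -
    (((rootOfUnity k : ℂˣ) : ℂ) ^ (i : ℕ)) •
      (LinearMap.id : (PlaneRing ⧸ I.ideal) →ₗ[ℂ] (PlaneRing ⧸ I.ideal))))

/-- The torus fixed points of the moduli space `Hilb^{|v|}(ℂ²)^{ℤ_k, v}` of `ℤ_k`-invariant ideals
`I` of finite codimension with `ℂ[z₁, z₂] / I ≅ ⨁ v_i ρ_i`. The group `ℤ_k` lies in the torus, so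
a torus fixed ideal is `ℤ_k`-invariant. -/
def invHilbFixed (k : ℕ) (v : Fin k → ℕ) : Set StdFixedIdeal :=
  {I | ∀ i, repMult k I i = v i}

/-- The tangent space of the invariant Hilbert scheme: the `ℤ_k`-invariant tangent vectors. -/
def invTangent (k : ℕ) (I : StdFixedIdeal) : Submodule ℂ I.Tangent :=
  I.tangentEigen (cyclicGen k) 1

/-- The equivariant integral of `1` over `Hilb^{|v|}(ℂ²)^{ℤ_k, v}`. This space is not compact, and
the pushforward to a point in (localized) equivariant cohomology is the sum, over the torus fixed
points, of the inverse equivariant Euler classes of the tangent spaces. -/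
def invHilbIntegral {K : Type*} [Field K] (k : ℕ) (ε₁ ε₂ : K) (v : Fin k → ℕ) : K :=
  ∑ᶠ I ∈ invHilbFixed k v, (I.euler ε₁ ε₂ (invTangent k I))⁻¹

/-! ## Hilbert schemes of points of the minimal resolution -/

/-- The weight of the torus on the first coordinate of the `i`-th affine chart of the minimal
resolution `X_k` of `ℂ²/ℤ_k` (`i = 0, …, k-1`). The two coordinates of this chart are the
invariant Laurent monomials `z₁ ^ (k-i) * z₂ ^ (-i)` and `z₁ ^ (-(k-i-1)) * z₂ ^ (i+1)`. -/
def chartWeight₁ (k : ℕ) (i : Fin k) : ℤ × ℤ := ((k : ℤ) - (i : ℕ), -((i : ℕ) : ℤ))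

/-- The weight of the torus on the second coordinate of the `i`-th chart of `X_k`. -/
def chartWeight₂ (k : ℕ) (i : Fin k) : ℤ × ℤ :=
  (-((k : ℤ) - (i : ℕ) - 1), ((i : ℕ) : ℤ) + 1)

/-- A torus fixed finite subscheme of `X_k`, given by its ideals in the affine charts. In each
chart it is supported at the origin, which lies in no other chart; so there are no gluing
conditions, and the lengths and the tangent spaces add up over the charts. -/
abbrev XkFixed (k : ℕ) : Type := (i : Fin k) → FixedIdeal (chartWeight₁ k i) (chartWeight₂ k i)

/-- The equivariant integral of `1` over the Hilbert scheme `Hilb^n(X_k)`, in the same sense. -/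
def xkHilbIntegral {K : Type*} [Field K] (k : ℕ) (ε₁ ε₂ : K) (n : ℕ) : K :=
  ∑ᶠ Z ∈ {Z : XkFixed k | ∑ i, (Z i).colength = n}, ∏ i, ((Z i).euler ε₁ ε₂ ⊤)⁻¹

/-! ## Coloured Young diagrams -/

/-- The arm length of a node: the number of nodes beyond it with the same first coordinate. -/
def arm (Y : YoungDiagram) (s : ℕ × ℕ) : ℕ := Y.rowLen s.1 - s.2 - 1

/-- The leg length of a node: the number of nodes beyond it with the same second coordinate. -/
def leg (Y : YoungDiagram) (s : ℕ × ℕ) : ℕ := Y.colLen s.2 - s.1 - 1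

/-- The hook length of a node. -/
def hook (Y : YoungDiagram) (s : ℕ × ℕ) : ℕ := arm Y s + leg Y s + 1

/-- `ν_i(Y)`: the number of nodes `(a, b)` whose content `a - b` is congruent to `i` mod `k`. -/
def colourCount (k : ℕ) (Y : YoungDiagram) (i : Fin k) : ℕ :=
  (Y.cells.filter fun s => ((s.1 : ℤ) - (s.2 : ℤ)) ≡ ((i : ℕ) : ℤ) [ZMOD (k : ℤ)]).card

/-- A `k`-core: a Young diagram without hooks of length `k`. -/
def IsCore (k : ℕ) (Y : YoungDiagram) : Prop := ∀ s ∈ Y.cells, hook Y s ≠ k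

/-- The product, over the nodes whose hook length is divisible by `k`, of
`1 / (((L+1) ε₁ - A ε₂) (-L ε₁ + (A+1) ε₂))`. -/
def hookWeight {K : Type*} [Field K] (k : ℕ) (ε₁ ε₂ : K) (Y : YoungDiagram) : K :=
  ∏ s ∈ Y.cells.filter (fun s => k ∣ hook Y s),
    ((((leg Y s : K) + 1) * ε₁ - (arm Y s : K) * ε₂) *
      (-(leg Y s : K) * ε₁ + ((arm Y s : K) + 1) * ε₂))⁻¹

/-- The sum of the hook products over the `k`-coloured Young diagrams with colour vector `v`. -/
def youngSum {K : Type*} [Field K] (k : ℕ) (ε₁ ε₂ : K) (v : Fin k → ℕ) : K :=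
  ∑ᶠ Y ∈ {Y : YoungDiagram | colourCount k Y = v}, hookWeight k ε₁ ε₂ Y

/-- The ideal spanned by the monomials `z₁ ^ a * z₂ ^ b` with `(a, b) ∉ Y`. -/
def youngIdeal (Y : YoungDiagram) : Ideal PlaneRing :=
  Ideal.span {f | ∃ a b : ℕ, (a, b) ∉ Y.cells ∧
    f = MvPolynomial.X 0 ^ a * MvPolynomial.X 1 ^ b}

/-! ## Formal series in `q̃, q_0, …, q_{k-1}` with rational exponents -/

/-- Exponents of the variables `q̃` (index `none`) and `q_i` (index `some i`). -/
abbrev Expo (k : ℕ) : Type := Option (Fin k) → ℚ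

/-- The ring of formal series in `q̃, q_0, …, q_{k-1}` with rational exponents whose support is
partially well-ordered; it contains the power series ring. -/
abbrev FormalSeries (k : ℕ) (K : Type*) [Field K] : Type _ := HahnSeries (Expo k) K

/-- The constant series. -/
def const {k : ℕ} {K : Type*} [Field K] (c : K) : FormalSeries k K := HahnSeries.single 0 c

/-- The monomial with exponent vector `e`; its `r`-th power is `mono (r • e)` for rational `r`. -/
def mono {k : ℕ} (K : Type*) [Field K] (e : Expo k) : FormalSeries k K := HahnSeries.single e 1

/-- A family can be summed formally: the union of the supports is a legitimate support, and each
coefficient receives finitely many contributions. -/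
def FormallySummable {k : ℕ} {K : Type*} [Field K] {ι : Type*} (f : ι → FormalSeries k K) : Prop :=
  (⋃ a, (f a).support).IsPWO ∧ ∀ g : Expo k, {a | (f a).coeff g ≠ 0}.Finite

open Classical in
/-- The coefficientwise sum of a formally summable family (and `0` otherwise). -/
def formalSum {k : ℕ} {K : Type*} [Field K] {ι : Type*} (f : ι → FormalSeries k K) :
    FormalSeries k K :=
  if h : FormallySummable f then
    HahnSeries.SummableFamily.hsum
      { toFun := f, isPWO_iUnion_support' := h.1, finite_co_support' := h.2 }
  else 0

/-- The value `∑ f_n q^n` of a power series at the monomial `q` with exponent vector `a`. -/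
def evalSeries {k : ℕ} {K : Type*} [Field K] (f : PowerSeries K) (a : Expo k) : FormalSeries k K :=
  formalSum fun n : ℕ => const (PowerSeries.coeff n f) * mono K a ^ n

/-- Exponent vector of `q̃`. -/
def qtExp (k : ℕ) : Expo k := Pi.single none 1

/-- Exponent vector of `q_i`. -/
def qiExp (k : ℕ) (i : Fin k) : Expo k := Pi.single (some i) 1

/-- Exponent vector of `q = q̃ ^ k * ∏ q_i`. -/
def qExp (k : ℕ) : Expo k := (k : ℚ) • qtExp k + ∑ i, qiExp k i

/-- The Cartan matrix of type `A_{k-1}`, over the rationals. -/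
def cartan (k : ℕ) : Matrix (Fin (k - 1)) (Fin (k - 1)) ℚ :=
  (CartanMatrix.A (k - 1)).map (Int.cast : ℤ → ℚ)

/-- The index `j + 1` in `{1, …, k-1}` attached to `j : Fin (k - 1)`. -/
def nodeIndex {k : ℕ} (j : Fin (k - 1)) : Fin k := ⟨(j : ℕ) + 1, by omega⟩

/-- Exponent vector of `ξ_i = ∏_j (q̃ q_j) ^ (C⁻¹)^{ij}`. -/
def xiExp (k : ℕ) (i : Fin (k - 1)) : Expo k :=
  ∑ j : Fin (k - 1), ((cartan k)⁻¹ i j) • (qtExp k + qiExp k (nodeIndex j))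

/-- The monomial `q̃ ^ n * ∏ q_i ^ (v_i)`. -/
def stackMono {k : ℕ} (K : Type*) [Field K] (n : ℕ) (v : Fin k → ℕ) : FormalSeries k K :=
  mono K (qtExp k) ^ n * ∏ i, mono K (qiExp k i) ^ v i

/-! ## The partition functions -/

section PartitionFunctions

variable {K : Type*} [Field K]

/-- The terms of `Z^inst_{[ℂ²/ℤ_k]}(ε₁, ε₂; q̃, q⃗)`. -/
def stackTerm (k : ℕ) (ε₁ ε₂ : K) (v : Fin k → ℕ) : FormalSeries k K :=
  const (invHilbIntegral k ε₁ ε₂ v) * stackMono K (∑ i, v i) v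

/-- The instanton partition function of the quotient stack `[ℂ²/ℤ_k]`. -/
def stackZ (k : ℕ) (ε₁ ε₂ : K) : FormalSeries k K := formalSum (stackTerm k ε₁ ε₂)

/-- The terms of the core part. -/
def coreTerm (K : Type*) [Field K] (k : ℕ) (Y : {Y : YoungDiagram // IsCore k Y}) :
    FormalSeries k K :=
  stackMono K Y.1.card (colourCount k Y.1)

/-- The contribution of the `k`-cores. -/
def stackCore (K : Type*) [Field K] (k : ℕ) : FormalSeries k K := formalSum (coreTerm K k)

/-- The terms of the quotient part: `v_0 = v_1 = ⋯ = v_{k-1}`. -/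
def quotTerm (k : ℕ) (ε₁ ε₂ : K) (v : {v : Fin k → ℕ // ∀ i j, v i = v j}) : FormalSeries k K :=
  const (youngSum k ε₁ ε₂ v.1) * stackMono K (∑ i, v.1 i) v.1

/-- The contribution of the `k`-quotients. -/
def stackQuot (k : ℕ) (ε₁ ε₂ : K) : FormalSeries k K := formalSum (quotTerm k ε₁ ε₂)

/-- The first Chern numbers `u ∈ ℤ^{k-1}` allowed by the trivial holonomy at infinity: those for
which `∑ u_i ω_i` (with `ω_i` the fundamental weights) lies in the root lattice of type
`A_{k-1}`. -/
def chernSet (k : ℕ) : Set (Fin (k - 1) → ℤ) :=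
  {u | ∃ m : Fin (k - 1) → ℤ, u = (CartanMatrix.A (k - 1)).mulVec m}

/-- The number `u · C⁻¹ u / 2`. -/
def halfNorm (k : ℕ) (u : Fin (k - 1) → ℤ) : ℚ :=
  (1 / 2) * ((fun i => (u i : ℚ)) ⬝ᵥ ((cartan k)⁻¹).mulVec (fun i => (u i : ℚ)))

/-- The monomial `q ^ r * ∏ ξ_i ^ (u_i)`, where `q` and `ξ_i` are the monomials with exponent
vectors `a` and `b i`. -/
def xkMono (K : Type*) [Field K] {k : ℕ} (a : Expo k) (b : Fin (k - 1) → Expo k) (r : ℚ)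
    (u : Fin (k - 1) → ℤ) : FormalSeries k K :=
  mono K (r • a + ∑ i, (u i : ℚ) • b i)

/-- The terms of `Z^inst_{X_k}(ε₁, ε₂; q, ξ)` for gauge group `U(1)` and trivial holonomy: all the
moduli spaces with first Chern number `u` and discriminant `n` are `Hilb^n(X_k)`. -/
def xkTerm (k : ℕ) (ε₁ ε₂ : K) (a : Expo k) (b : Fin (k - 1) → Expo k)
    (p : chernSet k × ℕ) : FormalSeries k K :=
  const (xkHilbIntegral k ε₁ ε₂ p.2) * xkMono K a b ((p.2 : ℚ) + halfNorm k p.1) p.1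

/-- The instanton partition function of `X_k`, at the monomials `q` and `ξ_i` with exponent
vectors `a` and `b i`. -/
def xkZ (k : ℕ) (ε₁ ε₂ : K) (a : Expo k) (b : Fin (k - 1) → Expo k) : FormalSeries k K :=
  formalSum (xkTerm k ε₁ ε₂ a b)

/-- The terms of the theta series `∑_u q ^ (u · C⁻¹ u / 2) * ∏ ξ_i ^ (u_i)`. -/
def thetaTerm (K : Type*) [Field K] (k : ℕ) (a : Expo k) (b : Fin (k - 1) → Expo k)
    (u : chernSet k) : FormalSeries k K :=
  xkMono K a b (halfNorm k u) u

/-- The Euler function `∏_{n ≥ 1} (1 - q ^ n)` as a power series (its `n`-th coefficient only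
involves the first `n` factors). -/
def eulerFunction (K : Type*) [Field K] : PowerSeries K :=
  PowerSeries.mk fun n => PowerSeries.coeff n
    (∏ m ∈ Finset.range n, (1 - (PowerSeries.X : PowerSeries K) ^ (m + 1)))

/-- The level one character `η̂(q) ^ (-(k-1)) * ∑_u q ^ (u · C⁻¹ u / 2) * ∏ ξ_i ^ (u_i)` of the
basic representation (highest weight the zeroth fundamental weight) of affine `sl_k`. -/
def levelOneChar (K : Type*) [Field K] (k : ℕ) (a : Expo k) (b : Fin (k - 1) → Expo k) :
    FormalSeries k K :=
  evalSeries ((eulerFunction K)⁻¹) a ^ (k - 1) * formalSum (thetaTerm K k a b)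

/-- The power series `exp (c q)`. -/
def expSeries (c : K) : PowerSeries K := PowerSeries.mk fun n => c ^ n / (n.factorial : K)

end PartitionFunctions

end

end ALE

/-!
The sums `S_v` of hook products are computed in closed form, and every assertion about the partition
functions is read off from the result.

*Geometry.* A torus fixed ideal is monomial, because a generic torus element separates the monomials
(`youngFixed_bijective`). A tangent vector of weight `w` at the monomial ideal of `Y` shifts
monomials by `-w`, and is determined by its values at the ends of the rows; counting these shows
that the tangent character is `∑ t₁ ^ (L+1) t₂ ^ (-A) + t₁ ^ (-L) t₂ ^ (A+1)`
(`finrank_tangentWeight`). The `ℤ_k`-invariant weights are those with `k ∣ A + L + 1`, so the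
equivariant integral over the invariant Hilbert scheme is `S_v` (`invHilbIntegral_eq_youngSum`).

*The closed form.* Let `n(v) = v₀ - ½ ∑ (v_i - v_{i+1})²` be the energy of a colour vector, with
indices in `ℤ/k`. Then `S_v = (1 / (k ε₁ ε₂)) ^ n / n!` if `n = n(v) ≥ 0`, and `S_v = 0` otherwise
(`hookSum_eq`). The hook product is a rational function of the contents of the addable and removable
nodes (`hookWeight_union`, from the identity `hookChar_eq` for the tangent character), so that
adding nodes of one colour to a diagram changes it by a factor to which Lagrange interpolation
applies. Adding as many nodes as the difference between the numbers of addable and of removable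
nodes of that colour gives a reflection symmetry of `S` (`hookSum_reflect`); these reflections
generate the affine Weyl group and preserve the energy. They reduce the claim to
`v = (n, …, n)`, where integrating the squares of power sums of the addable and removable nodes
gives the recursion `k n ε₁ ε₂ S_n = S_{n-1}` (`hookSum_const`).

*Consequences.* For `k = 1` the closed form describes the Hilbert schemes of the charts of `X_k`,
and the exponential formula, together with `∑ 1 / (a_i b_i) = 1 / (k ε₁ ε₂)` for the chart weights,
gives the integrals over `Hilb^n(X_k)` (`xkHilbIntegral_eq`). The number of nodes with hook length
divisible by `k` is the energy of the colour vector (`two_mul_card_hook`), so the `k`-cores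
are the diagrams of energy zero (`isCore_iff`), and there is exactly one for each colour vector of
energy zero since `S_v = 1`. Finally, `v ↦ (C (v_j - v₀)_j, n(v))` is a bijection from the colour
vectors of nonnegative energy to the pairs of a first Chern number and an instanton number
(`exists_parametrization`), under which the change of variables matches the monomials (`xkExp_eq`).
-/

namespace ALE

/-! ### Sums over the nodes of Lagrange interpolation -/

section Lagrange

variable {K : Type*} [Field K] {ι κ : Type*} [DecidableEq ι]

/-- The sum is the coefficient of degree `|A| - 1` of the polynomial interpolating `P`, that is,
of `P` itself. -/
theorem lagrange_sum_monic {A : Finset ι} {v : ι → K} (hv : Set.InjOn v A)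
    {P : Polynomial K} (hP : P.Monic) (hdeg : P.natDegree + 1 = A.card) :
    ∑ a ∈ A, P.eval (v a) / ∏ b ∈ A.erase a, (v a - v b) = 1 := by
  have hd : P.degree < A.card := by
    rw [Polynomial.degree_eq_natDegree hP.ne_zero]; exact_mod_cast (by omega)
  have := Lagrange.coeff_eq_sum hv hd
  rw [← this, show A.card - 1 = P.natDegree by omega]
  exact hP

/-- The coefficient of degree `|A| - 1` of a polynomial of smaller degree vanishes. -/
theorem lagrange_sum_small {A : Finset ι} {v : ι → K} (hv : Set.InjOn v A)
    {P : Polynomial K} (hdeg : P.natDegree + 1 < A.card) :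
    ∑ a ∈ A, P.eval (v a) / ∏ b ∈ A.erase a, (v a - v b) = 0 := by
  have hd : P.degree < A.card :=
    lt_of_le_of_lt Polynomial.degree_le_natDegree (by exact_mod_cast (by omega))
  have := Lagrange.coeff_eq_sum hv hd
  rw [← this]
  exact Polynomial.coeff_eq_zero_of_natDegree_lt (by omega)

/-- The case of one node more than there are factors in the numerator. -/
theorem lagrange_sum_zero_order {A : Finset ι} {v : ι → K} (hv : Set.InjOn v A)
    {B : Finset κ} (n : κ → K) (h : B.card + 1 = A.card) :
    ∑ a ∈ A, (∏ b ∈ B, (v a - n b)) / ∏ b ∈ A.erase a, (v a - v b) = 1 := by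
  have := lagrange_sum_monic hv (P := ∏ b ∈ B, (Polynomial.X - Polynomial.C (n b)))
    (Polynomial.monic_prod_X_sub_C _ _) (by simpa using h)
  simpa [Polynomial.eval_prod] using this

/-- The case of two nodes more than there are factors in the numerator. -/
theorem lagrange_sum_vanish {A : Finset ι} {v : ι → K} (hv : Set.InjOn v A)
    {B : Finset κ} (n : κ → K) (h : B.card + 1 < A.card) :
    ∑ a ∈ A, (∏ b ∈ B, (v a - n b)) / ∏ b ∈ A.erase a, (v a - v b) = 0 := by
  have := lagrange_sum_small hv (P := ∏ b ∈ B, (Polynomial.X - Polynomial.C (n b)))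
    (by simpa using h)
  simpa [Polynomial.eval_prod] using this

theorem lagrange_sum_insert {A : Finset ι} {v : ι → K} (hv : Set.InjOn v A)
    {B : Finset κ} (n : κ → K) (t : K) (h : B.card + 2 = A.card) :
    ∑ a ∈ A, (v a + t) * ((∏ b ∈ B, (v a - n b)) / ∏ b ∈ A.erase a, (v a - v b)) = 1 := by
  have := lagrange_sum_monic hv
    (P := (Polynomial.X + Polynomial.C t) * ∏ b ∈ B, (Polynomial.X - Polynomial.C (n b)))
    ((Polynomial.monic_X_add_C t).mul (Polynomial.monic_prod_X_sub_C _ _))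
    (by
      rw [(Polynomial.monic_X_add_C t).natDegree_mul (Polynomial.monic_prod_X_sub_C _ _)]
      simp; omega)
  simpa [Polynomial.eval_prod, mul_div_assoc] using this

/-- Splitting off one node and one factor of the numerator. -/
theorem lagrange_sum_split {R : Finset ι} {v : ι → K} {r₀ : ι} (hr : r₀ ∉ R)
    (hv : Set.InjOn v (insert r₀ R : Finset ι)) (f : ι → K) (x : K) :
    ∑ r ∈ insert r₀ R, ((v r - x) * f r) / ∏ r' ∈ (insert r₀ R).erase r, (v r - v r') =
      ∑ r ∈ R, f r / ∏ r' ∈ R.erase r, (v r - v r') +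
        (v r₀ - x) * ∑ r ∈ insert r₀ R, f r / ∏ r' ∈ (insert r₀ R).erase r, (v r - v r') := by
  rw [Finset.sum_insert hr, Finset.sum_insert hr, mul_add, Finset.mul_sum, ← add_assoc,
    add_comm (∑ r ∈ R, _), add_assoc, ← Finset.sum_add_distrib]
  congr 1
  · ring
  refine Finset.sum_congr rfl fun r hrR => ?_
  have hne : r₀ ≠ r := fun h => hr (h ▸ hrR)
  have hsub : v r - v r₀ ≠ 0 := sub_ne_zero.mpr fun h =>
    hne (hv (by simp) (by simp [hrR]) h.symm)
  rw [Finset.erase_insert_of_ne hne, Finset.prod_insert (by simp [hr])]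
  have : (∏ r' ∈ R.erase r, (v r - v r')) ≠ 0 := by
    rw [Finset.prod_ne_zero_iff]
    intro a ha
    rw [Finset.mem_erase] at ha
    exact sub_ne_zero.mpr fun h => ha.1 (hv (by simp [ha.2]) (by simp [hrR]) h.symm)
  field_simp
  ring

/-- The case of as many nodes as factors in the numerator. -/
theorem lagrange_sum_first_order [DecidableEq κ] {R : Finset ι} {v : ι → K} (hv : Set.InjOn v R)
    {A : Finset κ} (n : κ → K) (h : A.card = R.card) :
    ∑ r ∈ R, (∏ a ∈ A, (v r - n a)) / ∏ r' ∈ R.erase r, (v r - v r') =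
      ∑ r ∈ R, v r - ∑ a ∈ A, n a := by
  induction R using Finset.induction_on generalizing A with
  | empty => rw [Finset.card_empty, Finset.card_eq_zero] at h; simp [h]
  | insert r₀ R hr ih =>
    rw [Finset.card_insert_of_notMem hr] at h
    obtain ⟨a₀, A₁, ha, rfl, hA⟩ := Finset.card_eq_succ.mp h
    simp only [Finset.prod_insert ha]
    rw [lagrange_sum_split hr hv, ih (hv.mono (by simp)) hA,
      lagrange_sum_zero_order hv n (by rw [Finset.card_insert_of_notMem hr, hA]),
      Finset.sum_insert hr, Finset.sum_insert ha]
    ring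

/-- The case of one node less than there are factors in the numerator. -/
theorem lagrange_sum_second_order [DecidableEq κ] {R : Finset ι} {v : ι → K}
    (hv : Set.InjOn v R) {A : Finset κ} (n : κ → K) (h : A.card = R.card + 1) :
    2 * ∑ r ∈ R, (∏ a ∈ A, (v r - n a)) / ∏ r' ∈ R.erase r, (v r - v r') =
      (∑ a ∈ A, n a - ∑ r ∈ R, v r) ^ 2 - (∑ a ∈ A, n a ^ 2 - ∑ r ∈ R, v r ^ 2) := by
  induction R using Finset.induction_on generalizing A with
  | empty =>
    rw [Finset.card_empty, zero_add] at h
    obtain ⟨a, rfl⟩ := Finset.card_eq_one.mp h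
    simp
  | insert r₀ R hr ih =>
    have h' := h
    rw [Finset.card_insert_of_notMem hr] at h
    obtain ⟨a₀, A₁, ha, rfl, hA⟩ := Finset.card_eq_succ.mp h
    simp only [Finset.prod_insert ha]
    rw [lagrange_sum_split hr hv, mul_add, ih (hv.mono (by simp)) hA,
      lagrange_sum_first_order hv n (by rw [Finset.card_insert_of_notMem hr, hA]),
      Finset.sum_insert hr, Finset.sum_insert ha, Finset.sum_insert hr, Finset.sum_insert ha]
    ring

/-- Interpolation over the subsets of the set of nodes with a given number of elements. As a
polynomial in one of the roots `n b` of the numerator, the left hand side has degree at most `c`;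
when that root is a node, the terms with this node in `X` vanish, and the node can be removed. So
the polynomial takes the value `1` at more than `c` points. -/
theorem lagrange_sum_powersetCard [DecidableEq κ] {A : Finset ι} {v : ι → K} (hv : Set.InjOn v A)
    {B : Finset κ} (n : κ → K) {c : ℕ} (h : B.card + c = A.card) :
    ∑ X ∈ A.powersetCard c,
      ∏ x ∈ X, ((∏ b ∈ B, (v x - n b)) / ∏ a ∈ A \ X, (v x - v a)) = 1 := by
  induction B using Finset.induction_on generalizing A with
  | empty =>
    rw [Finset.card_empty, zero_add] at h
    subst h
    simp
  | insert b₀ B hb ih =>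
    rw [Finset.card_insert_of_notMem hb] at h
    set P : Polynomial K := ∑ X ∈ A.powersetCard c, Polynomial.C (∏ x ∈ X,
        ((∏ b ∈ B, (v x - n b)) / ∏ a ∈ A \ X, (v x - v a))) *
        ∏ x ∈ X, (Polynomial.C (v x) - Polynomial.X) with hPdef
    have hPeval : ∀ t : K, P.eval t = ∑ X ∈ A.powersetCard c, (∏ x ∈ X,
        ((∏ b ∈ B, (v x - n b)) / ∏ a ∈ A \ X, (v x - v a))) * ∏ x ∈ X, (v x - t) := by
      intro t
      simp [hPdef, Polynomial.eval_finsetSum, Polynomial.eval_prod]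
    have hPdeg : P.natDegree ≤ c := by
      refine Polynomial.natDegree_sum_le_of_forall_le _ _ fun X hX => ?_
      refine (Polynomial.natDegree_C_mul_le _ _).trans ?_
      refine (Polynomial.natDegree_prod_le _ _).trans ?_
      refine (Finset.sum_le_card_nsmul _ _ 1 fun x _ => ?_).trans ?_
      · refine (Polynomial.natDegree_sub_le _ _).trans (by simp)
      · simp [(Finset.mem_powersetCard.mp hX).2]
    have hPone : ∀ a₀ ∈ A, P.eval (v a₀) = 1 := by
      intro a₀ ha₀
      have ih' := ih (A := A.erase a₀) (hv.mono (by simp))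
        (by rw [Finset.card_erase_of_mem ha₀]; omega)
      rw [hPeval, ← ih']
      have hsub : (A.erase a₀).powersetCard c ⊆ A.powersetCard c :=
        Finset.powersetCard_mono (Finset.erase_subset _ _)
      rw [← Finset.sum_subset hsub]
      · refine Finset.sum_congr rfl fun X hX => ?_
        have hXs := (Finset.mem_powersetCard.mp hX).1
        have haX : a₀ ∉ X := fun h => by simpa using hXs h
        rw [← Finset.prod_mul_distrib]
        refine Finset.prod_congr rfl fun x hx => ?_
        have hxA := Finset.mem_erase.mp (hXs hx)
        have hne : v x - v a₀ ≠ 0 := sub_ne_zero.mpr fun h => hxA.1 (hv hxA.2 ha₀ h)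
        have hsd : A \ X = insert a₀ (A.erase a₀ \ X) := by
          ext y
          simp only [Finset.mem_sdiff, Finset.mem_insert, Finset.mem_erase]
          constructor
          · rintro ⟨h1, h2⟩
            by_cases hy : y = a₀
            · exact Or.inl hy
            · exact Or.inr ⟨⟨hy, h1⟩, h2⟩
          · rintro (rfl | ⟨⟨_, h1⟩, h2⟩)
            · exact ⟨ha₀, haX⟩
            · exact ⟨h1, h2⟩
        rw [hsd, Finset.prod_insert (by simp)]
        rw [div_mul_eq_mul_div, mul_comm (v x - v a₀), mul_div_mul_right _ _ hne]
      · intro X hX hX'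
        have haX : a₀ ∈ X := by
          by_contra hcon
          refine hX' (Finset.mem_powersetCard.mpr ⟨fun y hy => ?_,
            (Finset.mem_powersetCard.mp hX).2⟩)
          exact Finset.mem_erase.mpr
            ⟨fun h => hcon (h ▸ hy), (Finset.mem_powersetCard.mp hX).1 hy⟩
        exact mul_eq_zero_of_right _ (Finset.prod_eq_zero haX (sub_self _))
    have hP1 : P = 1 := by
      have hc : c < A.card := by omega
      refine Polynomial.eq_of_degrees_lt_of_eval_index_eq A hv ?_ ?_ ?_
      · exact lt_of_le_of_lt (Polynomial.degree_le_of_natDegree_le hPdeg) (by exact_mod_cast hc)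
      · exact lt_of_le_of_lt Polynomial.degree_one_le (by exact_mod_cast (by omega))
      · intro a ha; rw [hPone a ha, Polynomial.eval_one]
    have := hPeval (n b₀)
    rw [hP1, Polynomial.eval_one] at this
    rw [this]
    refine Finset.sum_congr rfl fun X _ => ?_
    rw [← Finset.prod_mul_distrib]
    refine Finset.prod_congr rfl fun x _ => ?_
    rw [Finset.prod_insert hb]
    ring

end Lagrange

end ALE

namespace ALE

noncomputable section

/-! ### Corners of a Young diagram and the character of the tangent space -/

section Young

theorem fst_lt_card {Y : YoungDiagram} {x : ℕ × ℕ} (hx : x ∈ Y.cells) : x.1 < Y.card := by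
  have h1 : x.1 < Y.colLen x.2 := YoungDiagram.mem_iff_lt_colLen.mp hx
  refine h1.trans_le ?_
  rw [YoungDiagram.colLen_eq_card]
  exact Finset.card_le_card (Finset.filter_subset _ _)

theorem snd_lt_card {Y : YoungDiagram} {x : ℕ × ℕ} (hx : x ∈ Y.cells) : x.2 < Y.card := by
  have h1 : x.2 < Y.rowLen x.1 := YoungDiagram.mem_iff_lt_rowLen.mp hx
  refine h1.trans_le ?_
  rw [YoungDiagram.rowLen_eq_card]
  exact Finset.card_le_card (Finset.filter_subset _ _)

/-- The nodes that can be added to a Young diagram. -/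
def addable (Y : YoungDiagram) : Finset (ℕ × ℕ) :=
  (Finset.range (Y.card + 1) ×ˢ Finset.range (Y.card + 1)).filter fun x =>
    x ∉ Y.cells ∧ (x.1 = 0 ∨ (x.1 - 1, x.2) ∈ Y.cells) ∧ (x.2 = 0 ∨ (x.1, x.2 - 1) ∈ Y.cells)

/-- The nodes that can be removed from a Young diagram. -/
def removable (Y : YoungDiagram) : Finset (ℕ × ℕ) :=
  Y.cells.filter fun x => (x.1 + 1, x.2) ∉ Y.cells ∧ (x.1, x.2 + 1) ∉ Y.cells

theorem mem_addable {Y : YoungDiagram} {x : ℕ × ℕ} : x ∈ addable Y ↔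
    x ∉ Y.cells ∧ (x.1 = 0 ∨ (x.1 - 1, x.2) ∈ Y.cells) ∧
      (x.2 = 0 ∨ (x.1, x.2 - 1) ∈ Y.cells) := by
  simp only [addable, Finset.mem_filter, Finset.mem_product, Finset.mem_range,
    and_iff_right_iff_imp]
  rintro ⟨_, h1, h2⟩
  constructor
  · rcases h1 with h1 | h1
    · omega
    · have := fst_lt_card h1
      simp only at this; omega
  · rcases h2 with h2 | h2
    · omega
    · have := snd_lt_card h2
      simp only at this; omega

theorem mem_removable {Y : YoungDiagram} {x : ℕ × ℕ} : x ∈ removable Y ↔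
    x ∈ Y.cells ∧ (x.1 + 1, x.2) ∉ Y.cells ∧ (x.1, x.2 + 1) ∉ Y.cells := by
  simp [removable]

theorem cells_left {Y : YoungDiagram} {i j : ℕ} (h : (i + 1, j) ∈ Y.cells) : (i, j) ∈ Y.cells :=
  Y.up_left_mem (Nat.le_succ i) le_rfl h

theorem cells_down {Y : YoungDiagram} {i j : ℕ} (h : (i, j + 1) ∈ Y.cells) : (i, j) ∈ Y.cells :=
  Y.up_left_mem le_rfl (Nat.le_succ j) h

/-- The identity `∑_A t^a - t₁ t₂ ∑_R t^r = 1 - (1 - t₁) (1 - t₂) ∑_Y t^b` for the addable nodes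
`A` and the removable nodes `R`, tested against an arbitrary function on the monomials. -/
theorem sum_corners {M : Type*} [AddCommGroup M] (Y : YoungDiagram) (F : ℕ × ℕ → M) :
    ∑ a ∈ addable Y, F a + ∑ b ∈ Y.cells, (F b + F (b.1 + 1, b.2 + 1)) =
      F (0, 0) + ∑ r ∈ removable Y, F (r.1 + 1, r.2 + 1) +
        ∑ b ∈ Y.cells, (F (b.1 + 1, b.2) + F (b.1, b.2 + 1)) := by
  classical
  set N := Y.card + 1
  set B := Finset.range N ×ˢ Finset.range N with hB
  have key : ∀ (S : Finset (ℕ × ℕ)) (g : ℕ × ℕ → ℕ × ℕ) (P : ℕ × ℕ → Prop)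
      (_ : ∀ a ∈ S, ∀ b ∈ S, g a = g b → a = b) (_ : ∀ x, x ∈ S.image g ↔ P x)
      (_ : ∀ x, P x → x ∈ B), ∑ b ∈ S, F (g b) = ∑ x ∈ B, if P x then F x else 0 := by
    intro S g P hg hP hPB
    rw [← Finset.sum_filter, ← Finset.sum_image hg]
    refine Finset.sum_congr ?_ fun _ _ => rfl
    ext x
    rw [hP, Finset.mem_filter]
    exact ⟨fun h => ⟨hPB x h, h⟩, fun h => h.2⟩
  have hlt : ∀ x ∈ Y.cells, x.1 < Y.card ∧ x.2 < Y.card :=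
    fun x hx => ⟨fst_lt_card hx, snd_lt_card hx⟩
  rw [Finset.sum_add_distrib, Finset.sum_add_distrib]
  rw [key (addable Y) (fun a => a) (fun x => x ∈ addable Y) (by simp) (by simp)
      (fun x hx => (Finset.mem_filter.mp hx).1),
    key Y.cells (fun b => b) (fun x => x ∈ Y.cells) (by simp) (by simp)
      (fun x hx => by have := hlt x hx; simp [hB, N]; omega),
    key Y.cells (fun b => (b.1 + 1, b.2 + 1))
      (fun x => x.1 ≠ 0 ∧ x.2 ≠ 0 ∧ (x.1 - 1, x.2 - 1) ∈ Y.cells)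
      (by rintro ⟨a, b⟩ _ ⟨c, d⟩ _ h; simpa using h)
      (by
        rintro ⟨a, b⟩
        simp only [Finset.mem_image, Prod.exists, Prod.mk.injEq]
        constructor
        · rintro ⟨c, d, h, rfl, rfl⟩; simpa using h
        · rintro ⟨h1, h2, h⟩; exact ⟨a - 1, b - 1, h, by omega, by omega⟩)
      (by rintro ⟨a, b⟩ ⟨h1, h2, h⟩; have := hlt _ h; simp [hB, N] at this ⊢; omega),
    key (removable Y) (fun b => (b.1 + 1, b.2 + 1))
      (fun x => x.1 ≠ 0 ∧ x.2 ≠ 0 ∧ (x.1 - 1, x.2 - 1) ∈ removable Y)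
      (by rintro ⟨a, b⟩ _ ⟨c, d⟩ _ h; simpa using h)
      (by
        rintro ⟨a, b⟩
        simp only [Finset.mem_image, Prod.exists, Prod.mk.injEq]
        constructor
        · rintro ⟨c, d, h, rfl, rfl⟩; simpa using h
        · rintro ⟨h1, h2, h⟩; exact ⟨a - 1, b - 1, h, by omega, by omega⟩)
      (by
        rintro ⟨a, b⟩ ⟨h1, h2, h⟩
        have := hlt _ (mem_removable.mp h).1; simp [hB, N] at this ⊢; omega),
    key Y.cells (fun b => (b.1 + 1, b.2)) (fun x => x.1 ≠ 0 ∧ (x.1 - 1, x.2) ∈ Y.cells)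
      (by rintro ⟨a, b⟩ _ ⟨c, d⟩ _ h; simpa using h)
      (by
        rintro ⟨a, b⟩
        simp only [Finset.mem_image, Prod.exists, Prod.mk.injEq]
        constructor
        · rintro ⟨c, d, h, rfl, rfl⟩; simpa using h
        · rintro ⟨h1, h⟩; exact ⟨a - 1, b, h, by omega, rfl⟩)
      (by rintro ⟨a, b⟩ ⟨h1, h⟩; have := hlt _ h; simp [hB, N] at this ⊢; omega),
    key Y.cells (fun b => (b.1, b.2 + 1)) (fun x => x.2 ≠ 0 ∧ (x.1, x.2 - 1) ∈ Y.cells)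
      (by rintro ⟨a, b⟩ _ ⟨c, d⟩ _ h; simpa using h)
      (by
        rintro ⟨a, b⟩
        simp only [Finset.mem_image, Prod.exists, Prod.mk.injEq]
        constructor
        · rintro ⟨c, d, h, rfl, rfl⟩; simpa using h
        · rintro ⟨h1, h⟩; exact ⟨a, b - 1, h, rfl, by omega⟩)
      (by rintro ⟨a, b⟩ ⟨h1, h⟩; have := hlt _ h; simp [hB, N] at this ⊢; omega)]
  have hF0 : F (0, 0) = ∑ x ∈ B, if x = (0, 0) then F x else 0 := by
    rw [Finset.sum_ite_eq' B ((0, 0) : ℕ × ℕ), if_pos (by simp [hB, N])]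
  rw [hF0]
  simp only [← Finset.sum_add_distrib]
  refine Finset.sum_congr rfl fun x _ => ?_
  clear key hF0
  obtain ⟨i, j⟩ := x
  simp only [mem_addable, mem_removable]
  rcases i with _ | i <;> rcases j with _ | j
  · by_cases h : (0, 0) ∈ Y.cells <;> simp [h]
  · have h1 := @cells_down Y 0 j
    by_cases h : (0, j) ∈ Y.cells <;> by_cases h' : (0, j + 1) ∈ Y.cells <;> simp_all
  · have h1 := @cells_left Y i 0
    by_cases h : (i, 0) ∈ Y.cells <;> by_cases h' : (i + 1, 0) ∈ Y.cells <;> simp_all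
  · have h1 := @cells_left Y i j
    have h2 := @cells_left Y i (j + 1)
    have h3 := @cells_down Y i j
    have h4 := @cells_down Y (i + 1) j
    by_cases g1 : (i, j) ∈ Y.cells <;> by_cases g2 : (i + 1, j) ∈ Y.cells <;>
      by_cases g3 : (i, j + 1) ∈ Y.cells <;> by_cases g4 : (i + 1, j + 1) ∈ Y.cells <;>
      first
      | exact absurd (h1 g2) g1
      | exact absurd (h2 g4) g3
      | exact absurd (h3 g3) g1
      | exact absurd (h4 g4) g2
      | simp [-YoungDiagram.mem_cells, g1, g2, g3, g4]

theorem shift_injective : Function.Injective (fun p : ℕ × ℕ => (p.1 + 1, p.2)) := by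
  rintro ⟨a, b⟩ ⟨c, d⟩ h
  simpa using h

/-- The Young diagram obtained by deleting the row of index `0`. -/
def tailDiagram (Y : YoungDiagram) : YoungDiagram where
  cells := Y.cells.preimage (fun p => (p.1 + 1, p.2)) shift_injective.injOn
  isLowerSet := by
    rintro ⟨a, b⟩ ⟨c, d⟩ h hab
    rw [Finset.mem_coe, Finset.mem_preimage] at hab ⊢
    exact Y.up_left_mem (Nat.succ_le_succ h.1) h.2 hab

theorem mem_tailDiagram {Y : YoungDiagram} {i j : ℕ} :
    (i, j) ∈ (tailDiagram Y).cells ↔ (i + 1, j) ∈ Y.cells := by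
  simp only [tailDiagram, Finset.mem_preimage]

theorem rowLen_tailDiagram (Y : YoungDiagram) (i : ℕ) :
    (tailDiagram Y).rowLen i = Y.rowLen (i + 1) := by
  refine eq_of_forall_lt_iff fun j => ?_
  rw [← YoungDiagram.mem_iff_lt_rowLen, ← YoungDiagram.mem_iff_lt_rowLen]
  exact mem_tailDiagram

theorem colLen_tailDiagram (Y : YoungDiagram) (j : ℕ) :
    (tailDiagram Y).colLen j = Y.colLen j - 1 := by
  refine eq_of_forall_lt_iff fun i => ?_
  rw [Nat.lt_sub_iff_add_lt, ← YoungDiagram.mem_iff_lt_colLen, ← YoungDiagram.mem_iff_lt_colLen]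
  exact mem_tailDiagram

theorem sum_cells_tail {M : Type*} [AddCommMonoid M] (Y : YoungDiagram) (f : ℕ × ℕ → M) :
    ∑ b ∈ Y.cells, f b = ∑ j ∈ Finset.range (Y.rowLen 0), f (0, j) +
      ∑ b ∈ (tailDiagram Y).cells, f (b.1 + 1, b.2) := by
  classical
  have h1 : Y.cells = (Finset.range (Y.rowLen 0)).image (fun j => ((0, j) : ℕ × ℕ)) ∪
      (tailDiagram Y).cells.image (fun b => (b.1 + 1, b.2)) := by
    ext ⟨i, j⟩
    simp only [Finset.mem_union, Finset.mem_image, Finset.mem_range, Prod.mk.injEq, Prod.exists]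
    rcases i with _ | i
    · simp [YoungDiagram.mem_iff_lt_rowLen]
    · simp [-YoungDiagram.mem_cells, mem_tailDiagram]
  rw [h1, Finset.sum_union, Finset.sum_image, Finset.sum_image]
  · rintro ⟨a, b⟩ _ ⟨c, d⟩ _ h; simpa using h
  · rintro a _ b _ h; simpa using h
  · rw [Finset.disjoint_left]
    rintro ⟨i, j⟩ h1 h2
    simp only [Finset.mem_image, Prod.mk.injEq, Prod.exists] at h1 h2
    omega

theorem sum_cells_col {M : Type*} [AddCommMonoid M] (Y : YoungDiagram) {r : ℕ}
    (hr : Y.rowLen 0 ≤ r) (f : ℕ × ℕ → M) :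
    ∑ b ∈ Y.cells, f b = ∑ j ∈ Finset.range r, ∑ i ∈ Finset.range (Y.colLen j), f (i, j) := by
  rw [Finset.sum_sigma']
  refine Finset.sum_bij' (fun b _ => ⟨b.2, b.1⟩) (fun p _ => (p.2, p.1)) ?_ ?_ ?_ ?_ ?_
  · rintro ⟨i, j⟩ h
    have h0 : (0, j) ∈ Y := Y.up_left_mem (Nat.zero_le i) le_rfl h
    simp only [Finset.mem_sigma, Finset.mem_range]
    exact ⟨(YoungDiagram.mem_iff_lt_rowLen.mp h0).trans_le hr, YoungDiagram.mem_iff_lt_colLen.mp h⟩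
  · rintro ⟨j, i⟩ h
    simp only [Finset.mem_sigma, Finset.mem_range] at h
    exact YoungDiagram.mem_iff_lt_colLen.mpr h.2
  · intros; rfl
  · intros; rfl
  · intros; rfl

/-- The ring of Laurent polynomials in `t₁`, `t₂`, containing the characters of the torus. -/
abbrev CharRing : Type := AddMonoidAlgebra ℤ (ℤ × ℤ)

/-- The Laurent monomial of exponent `w`. -/
def lmon (w : ℤ × ℤ) : CharRing := AddMonoidAlgebra.single w 1

theorem lmon_add (w w' : ℤ × ℤ) : lmon (w + w') = lmon w * lmon w' := by
  simp [lmon, AddMonoidAlgebra.single_mul_single]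

theorem lmon_zero : lmon 0 = 1 := rfl

/-- The exponent of the Laurent monomial attached to a node. -/
def wt (x : ℕ × ℕ) : ℤ × ℤ := (x.1, x.2)

/-- The character `∑ t^b` of a set of nodes. -/
def vchar (S : Finset (ℕ × ℕ)) : CharRing := ∑ b ∈ S, lmon (wt b)

/-- The dual character `∑ t^(-b)` of a set of nodes. -/
def vdual (S : Finset (ℕ × ℕ)) : CharRing := ∑ b ∈ S, lmon (-wt b)

/-- The sum of the two torus weights attached to each node through its arm and leg. -/
def hookChar (Y : YoungDiagram) : CharRing :=
  ∑ b ∈ Y.cells,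
    (lmon ((leg Y b : ℤ) + 1, -(arm Y b : ℤ)) + lmon (-(leg Y b : ℤ), (arm Y b : ℤ) + 1))

theorem lmon_pair_add (a b c d : ℤ) : lmon (a + c, b + d) = lmon (a, b) * lmon (c, d) := by
  rw [← lmon_add]; rfl

theorem geom_row (r : ℕ) :
    (1 - lmon (0, 1)) * ∑ j ∈ Finset.range r, lmon (0, (j : ℤ)) = 1 - lmon (0, (r : ℤ)) := by
  induction r with
  | zero =>
    rw [Finset.range_zero, Finset.sum_empty, mul_zero]
    exact (sub_eq_zero.mpr lmon_zero.symm).symm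
  | succ n ih =>
    rw [Finset.sum_range_succ, mul_add, ih]
    push_cast
    rw [show lmon (0, (n : ℤ) + 1) = lmon (0, (n : ℤ)) * lmon (0, 1) by
      rw [← lmon_pair_add]; simp]
    ring

theorem geom_col (σ : ℤ) (L : ℕ) (c : ℤ) :
    (1 - lmon (σ, 0)) * ∑ i ∈ Finset.range L, lmon (σ * i, c) =
      lmon (0, c) - lmon (σ * L, c) := by
  induction L with
  | zero => simp
  | succ n ih =>
    rw [Finset.sum_range_succ, mul_add, ih]
    push_cast
    rw [show lmon (σ * ((n : ℤ) + 1), c) = lmon (σ, 0) * lmon (σ * n, c) by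
      rw [← lmon_pair_add]; congr 2 <;> ring]
    ring

/-- The hook character in terms of the character `V` of the diagram:
`T = V* + t₁ t₂ V - (1 - t₁) (1 - t₂) V V*`. -/
theorem hookChar_eq (Y : YoungDiagram) :
    hookChar Y = vdual Y.cells + lmon (1, 1) * vchar Y.cells -
      (1 - lmon (1, 0)) * (1 - lmon (0, 1)) * vchar Y.cells * vdual Y.cells := by
  induction hn : Y.card using Nat.strong_induction_on generalizing Y with
  | _ n ih =>
  by_cases hY : Y.rowLen 0 = 0
  · have : Y.cells = ∅ := by
      rw [Finset.eq_empty_iff_forall_notMem]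
      rintro ⟨i, j⟩ h
      have h0 : (0, j) ∈ Y := Y.up_left_mem (Nat.zero_le i) le_rfl h
      have := YoungDiagram.mem_iff_lt_rowLen.mp h0
      omega
    simp [hookChar, vdual, vchar, this]
  set r := Y.rowLen 0 with hr
  set Z := tailDiagram Y with hZ
  have hcard : Z.card < n := by
    have := sum_cells_tail Y (fun _ => 1)
    simp only [Finset.sum_const, smul_eq_mul, mul_one, Finset.card_range] at this
    change Y.card = _ + Z.card at this
    omega
  have ihZ := ih _ hcard Z rfl
  have hrow : Z.rowLen 0 ≤ r := by
    rw [hZ, rowLen_tailDiagram]; exact Y.rowLen_anti _ _ (by omega)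
  set V := vchar Z.cells with hV
  set W := vdual Z.cells with hW
  set R : CharRing := ∑ j ∈ Finset.range r, lmon (0, (j : ℤ)) with hR
  set S : CharRing := ∑ j ∈ Finset.range r, lmon (0, -(j : ℤ)) with hS
  set t1 := lmon (1, 0) with ht1
  set t2 := lmon (0, 1) with ht2
  set u1 := lmon (-1, 0) with hu1
  set ρ := lmon (0, (r : ℤ)) with hρ
  set σ := lmon (0, -(r : ℤ)) with hσ
  have h12 : lmon (1, 1) = t1 * t2 := by rw [← lmon_pair_add]; simp
  have h1 : t1 * u1 = 1 := by rw [← lmon_pair_add]; simp; rfl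
  have hρσ : ρ * σ = 1 := by rw [← lmon_pair_add]; simp; rfl
  have ha : (1 - t2) * R = 1 - ρ := geom_row r
  have hρS : ρ * S = t2 * R := by
    rw [hS, hR, Finset.mul_sum, Finset.mul_sum, ← Finset.sum_range_reflect]
    refine Finset.sum_congr rfl fun j hj => ?_
    rw [Finset.mem_range] at hj
    rw [← lmon_pair_add, ← lmon_pair_add]
    congr 2
    have : ((r - 1 - j : ℕ) : ℤ) = r - 1 - j := by omega
    rw [this]; ring
  have hs : S = t2 * σ * R := by linear_combination σ * hρS - S * hρσ
  have haS : (1 - t2) * S = t2 * σ - t2 := by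
    linear_combination (1 - t2) * hs + t2 * σ * ha - t2 * hρσ
  have hVY : vchar Y.cells = R + t1 * V := by
    rw [vchar, sum_cells_tail, hV, vchar, Finset.mul_sum]
    congr 1
    refine Finset.sum_congr rfl fun b _ => ?_
    rw [← lmon_add]; congr 1; simp [wt, add_comm]
  have hWY : vdual Y.cells = S + u1 * W := by
    rw [vdual, sum_cells_tail, hW, vdual, Finset.mul_sum]
    congr 1
    refine Finset.sum_congr rfl fun b _ => ?_
    rw [← lmon_add]; simp only [wt, Prod.neg_mk, Prod.mk_add_mk]
    congr 2 <;> push_cast <;> ring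
  have hVc : (1 - t1) * V = R - ∑ j ∈ Finset.range r, lmon ((Z.colLen j : ℤ), (j : ℤ)) := by
    rw [hV, vchar, sum_cells_col Z hrow, Finset.mul_sum, hR, ← Finset.sum_sub_distrib]
    refine Finset.sum_congr rfl fun j _ => ?_
    have := geom_col 1 (Z.colLen j) j
    simpa [wt] using this
  have hWc : (1 - u1) * W = S - ∑ j ∈ Finset.range r, lmon (-(Z.colLen j : ℤ), -(j : ℤ)) := by
    rw [hW, vdual, sum_cells_col Z hrow, Finset.mul_sum, hS, ← Finset.sum_sub_distrib]
    refine Finset.sum_congr rfl fun j _ => ?_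
    have := geom_col (-1) (Z.colLen j) (-j)
    simpa [wt] using this
  have hrowj : ∀ j ∈ Finset.range r, (arm Y (0, j) : ℤ) = r - 1 - j ∧
      (leg Y (0, j) : ℤ) = Z.colLen j := by
    intro j hj
    rw [Finset.mem_range] at hj
    constructor
    · simp only [arm]; omega
    · simp only [leg, hZ, colLen_tailDiagram]; simp
  have hT : hookChar Y = hookChar Z + t1 * t2 * σ * (R - (1 - t1) * V) +
      ρ * (S - (1 - u1) * W) := by
    rw [hVc, hWc, sub_sub_cancel, sub_sub_cancel, hookChar, sum_cells_tail,
      Finset.sum_add_distrib, Finset.mul_sum, Finset.mul_sum, add_comm, add_assoc]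
    congr 1
    · rw [hookChar]
      refine Finset.sum_congr rfl fun b _ => ?_
      have e1 : arm Y (b.1 + 1, b.2) = arm Z b := by
        simp only [arm, hZ, rowLen_tailDiagram]
      have e2 : leg Y (b.1 + 1, b.2) = leg Z b := by
        simp only [leg, hZ, colLen_tailDiagram]; omega
      rw [e1, e2]
    · congr 1
      · refine Finset.sum_congr rfl fun j hj => ?_
        rw [(hrowj j hj).1, (hrowj j hj).2, ← lmon_pair_add, ← lmon_pair_add, ← lmon_pair_add]
        congr 2 <;> ring
      · refine Finset.sum_congr rfl fun j hj => ?_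
        rw [(hrowj j hj).1, (hrowj j hj).2, ← lmon_pair_add]
        congr 2 <;> ring
  rw [hT, ihZ, hVY, hWY, h12]
  linear_combination (1 - t1) * (S + u1 * W) * ha + (1 - t1) * t1 * V * haS +
    (1 - t1) * (1 - t2) * V * W * h1 - (1 - ρ) * W * h1 - t1 * hs + t1 * hρS

end Young

end

end ALE

namespace ALE

noncomputable section

/-! ### Equivariant Euler classes of characters -/

section Euler

variable {K : Type*} [Field K]

/-- The linear form `w₁ ε₁ + w₂ ε₂` attached to a weight. -/
def wval (ε₁ ε₂ : K) (w : ℤ × ℤ) : K := (w.1 : K) * ε₁ + (w.2 : K) * ε₂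

/-- The value `a ε₁ + b ε₂` of a node `(a, b)`. -/
def ct (ε₁ ε₂ : K) (x : ℕ × ℕ) : K := (x.1 : K) * ε₁ + (x.2 : K) * ε₂

/-- The colour `a - b` of a node `(a, b)`. -/
def colour (k : ℕ) (x : ℕ × ℕ) : ZMod k := (x.1 : ZMod k) - (x.2 : ZMod k)

theorem wval_add (ε₁ ε₂ : K) (w w' : ℤ × ℤ) :
    wval ε₁ ε₂ (w + w') = wval ε₁ ε₂ w + wval ε₁ ε₂ w' := by
  simp [wval]; ring

theorem wval_sub (ε₁ ε₂ : K) (w w' : ℤ × ℤ) :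
    wval ε₁ ε₂ (w - w') = wval ε₁ ε₂ w - wval ε₁ ε₂ w' := by
  simp [wval]; ring

theorem wval_wt (ε₁ ε₂ : K) (x : ℕ × ℕ) : wval ε₁ ε₂ (wt x) = ct ε₁ ε₂ x := by
  simp [wval, wt, ct]

theorem wval_one_one (ε₁ ε₂ : K) : wval ε₁ ε₂ (1, 1) = ε₁ + ε₂ := by
  simp [wval]

theorem wval_eq_zero {ε₁ ε₂ : K} (hε : LinearIndependent ℤ ![ε₁, ε₂]) {w : ℤ × ℤ} :
    wval ε₁ ε₂ w = 0 ↔ w = 0 := by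
  constructor
  · intro h
    have := LinearIndependent.pair_iff.mp hε w.1 w.2 (by simpa [wval, zsmul_eq_mul] using h)
    exact Prod.ext this.1 this.2
  · rintro rfl; simp [wval]

theorem wt_injective : Function.Injective wt := by
  rintro ⟨a, b⟩ ⟨c, d⟩ h
  simpa [wt] using h

theorem ct_injective {ε₁ ε₂ : K} (hε : LinearIndependent ℤ ![ε₁, ε₂]) :
    Function.Injective (ct ε₁ ε₂) := by
  intro x y h
  rw [← wval_wt, ← wval_wt, ← sub_eq_zero, ← wval_sub, wval_eq_zero hε, sub_eq_zero] at h
  exact wt_injective h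

theorem colour_eq_iff (k : ℕ) (x y : ℕ × ℕ) :
    colour k x = colour k y ↔ (k : ℤ) ∣ (wt x - wt y).1 - (wt x - wt y).2 := by
  rw [← ZMod.intCast_zmod_eq_zero_iff_dvd, ← sub_eq_zero]
  simp only [colour, wt, Prod.fst_sub, Prod.snd_sub]
  push_cast
  rw [sub_sub_sub_comm]

/-- The contribution of a weight to the Euler class of the `ℤ_k`-invariant part of a
representation. The zero weight contributes `1`. -/
def euUnit (k : ℕ) (ε₁ ε₂ : K) (w : ℤ × ℤ) : Kˣ :=
  open Classical in
  if h : (k : ℤ) ∣ w.1 - w.2 ∧ wval ε₁ ε₂ w ≠ 0 then Units.mk0 _ h.2 else 1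

/-- The equivariant Euler class of the `ℤ_k`-invariant part of a virtual representation, as a
homomorphism. -/
def euHom (k : ℕ) (ε₁ ε₂ : K) : CharRing →+ Additive Kˣ :=
  (Finsupp.liftAddHom fun w => zmultiplesHom _ (Additive.ofMul (euUnit k ε₁ ε₂ w))).comp
    AddMonoidAlgebra.coeffAddEquiv.toAddMonoidHom

/-- The value of `euHom` in the field. -/
def eu (k : ℕ) (ε₁ ε₂ : K) (f : CharRing) : K := ((euHom k ε₁ ε₂ f).toMul : Kˣ)

variable (k : ℕ) (ε₁ ε₂ : K)

theorem eu_add (f g : CharRing) : eu k ε₁ ε₂ (f + g) = eu k ε₁ ε₂ f * eu k ε₁ ε₂ g := by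
  simp [eu]

theorem eu_ne_zero (f : CharRing) : eu k ε₁ ε₂ f ≠ 0 := Units.ne_zero _

theorem eu_sum {ι : Type*} (s : Finset ι) (f : ι → CharRing) :
    eu k ε₁ ε₂ (∑ i ∈ s, f i) = ∏ i ∈ s, eu k ε₁ ε₂ (f i) := by
  classical
  induction s using Finset.induction_on with
  | empty => simp [eu]
  | insert a s ha ih => rw [Finset.sum_insert ha, Finset.prod_insert ha, eu_add, ih]

theorem eu_lmon (w : ℤ × ℤ) : eu k ε₁ ε₂ (lmon w) = (euUnit k ε₁ ε₂ w : Kˣ) := by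
  have : AddMonoidAlgebra.coeffAddEquiv (lmon w) = Finsupp.single w (1 : ℤ) := rfl
  simp [eu, euHom, this]

theorem eu_lmon_of_dvd {w : ℤ × ℤ} (h : (k : ℤ) ∣ w.1 - w.2) (h0 : wval ε₁ ε₂ w ≠ 0) :
    eu k ε₁ ε₂ (lmon w) = wval ε₁ ε₂ w := by
  rw [eu_lmon, euUnit, dif_pos ⟨h, h0⟩, Units.val_mk0]

theorem eu_lmon_of_not_dvd {w : ℤ × ℤ} (h : ¬ (k : ℤ) ∣ w.1 - w.2) :
    eu k ε₁ ε₂ (lmon w) = 1 := by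
  rw [eu_lmon, euUnit, dif_neg (fun h' => h h'.1), Units.val_one]

theorem eu_lmon_zero : eu k ε₁ ε₂ (lmon 0) = 1 := by
  rw [eu_lmon, euUnit, dif_neg (fun h' => h'.2 (by simp [wval])), Units.val_one]

variable {ε₁ ε₂}

theorem hookWeight_eq_eu (hε : LinearIndependent ℤ ![ε₁, ε₂]) (Y : YoungDiagram) :
    hookWeight k ε₁ ε₂ Y = (eu k ε₁ ε₂ (hookChar Y))⁻¹ := by
  rw [hookWeight, hookChar, eu_sum, ← Finset.prod_inv_distrib, Finset.prod_filter]
  refine Finset.prod_congr rfl fun s _ => ?_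
  rw [eu_add]
  have h1 : ((leg Y s : ℤ) + 1, -(arm Y s : ℤ)).1 - ((leg Y s : ℤ) + 1, -(arm Y s : ℤ)).2 =
      (hook Y s : ℤ) := by simp [hook]; ring
  have h2 : (-(leg Y s : ℤ), (arm Y s : ℤ) + 1).1 - (-(leg Y s : ℤ), (arm Y s : ℤ) + 1).2 =
      -(hook Y s : ℤ) := by simp [hook]; ring
  split_ifs with h
  · rw [eu_lmon_of_dvd _ _ _ (by rw [h1]; exact_mod_cast h),
      eu_lmon_of_dvd _ _ _ (by rw [h2]; exact (dvd_neg.mpr (by exact_mod_cast h)))]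
    · simp [wval, sub_eq_add_neg]
    · rw [Ne, wval_eq_zero hε]
      intro h0; have := congrArg Prod.snd h0; simp at this; omega
    · rw [Ne, wval_eq_zero hε]
      intro h0; have := congrArg Prod.fst h0; simp at this; omega
  · rw [eu_lmon_of_not_dvd _ _ _ (by rw [h1]; exact_mod_cast h),
      eu_lmon_of_not_dvd _ _ _ (by rw [h2, dvd_neg]; exact_mod_cast h)]
    simp

/-- The addable nodes of a given colour. -/
def addableOf (Y : YoungDiagram) (i : ZMod k) : Finset (ℕ × ℕ) :=
  (addable Y).filter fun x => colour k x = i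

/-- The removable nodes of a given colour. -/
def removableOf (Y : YoungDiagram) (i : ZMod k) : Finset (ℕ × ℕ) :=
  (removable Y).filter fun x => colour k x = i

variable {k}

theorem mem_addableOf {Y : YoungDiagram} {i : ZMod k} {x : ℕ × ℕ} :
    x ∈ addableOf k Y i ↔ x ∈ addable Y ∧ colour k x = i := by simp [addableOf]

theorem mem_removableOf {Y : YoungDiagram} {i : ZMod k} {x : ℕ × ℕ} :
    x ∈ removableOf k Y i ↔ x ∈ removable Y ∧ colour k x = i := by simp [removableOf]

theorem lmon_mul_corners (Y : YoungDiagram) (w : ℤ × ℤ) :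
    lmon w * (1 - (1 - lmon (1, 0)) * (1 - lmon (0, 1)) * vchar Y.cells) =
      ∑ a ∈ addable Y, lmon (wt a + w) - ∑ r ∈ removable Y, lmon (wt r + (1, 1) + w) := by
  have h := sum_corners Y (fun b => lmon (wt b))
  have e1 : ∀ b : ℕ × ℕ, lmon (wt (b.1 + 1, b.2)) = lmon (1, 0) * lmon (wt b) := fun b => by
    rw [← lmon_add]; congr 1; simp [wt, add_comm]
  have e2 : ∀ b : ℕ × ℕ, lmon (wt (b.1, b.2 + 1)) = lmon (0, 1) * lmon (wt b) := fun b => by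
    rw [← lmon_add]; congr 1; simp [wt, add_comm]
  have e3 : ∀ b : ℕ × ℕ, lmon (wt (b.1 + 1, b.2 + 1)) =
      lmon (1, 0) * lmon (0, 1) * lmon (wt b) := fun b => by
    rw [← lmon_add, ← lmon_add]; congr 1; simp [wt, add_comm]
  have e4 : lmon (1, 1) = lmon (1, 0) * lmon (0, 1) := by rw [← lmon_add]; simp
  have e0 : lmon (wt (0, 0)) = 1 := rfl
  simp only [e1, e2, e3, e0, Finset.sum_add_distrib, ← Finset.mul_sum] at h
  simp only [lmon_add, ← Finset.sum_mul, e4]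
  have hV : vchar Y.cells = ∑ b ∈ Y.cells, lmon (wt b) := rfl
  rw [hV]
  linear_combination -lmon w * h

theorem lmon_mul_corners_dual (Y : YoungDiagram) (w : ℤ × ℤ) :
    lmon w * (1 - (1 - lmon (-1, 0)) * (1 - lmon (0, -1)) * vdual Y.cells) =
      ∑ a ∈ addable Y, lmon (w - wt a) - ∑ r ∈ removable Y, lmon (w - (1, 1) - wt r) := by
  have h := sum_corners Y (fun b => lmon (-wt b))
  have e1 : ∀ b : ℕ × ℕ, lmon (-wt (b.1 + 1, b.2)) = lmon (-1, 0) * lmon (-wt b) := fun b => by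
    rw [← lmon_add]; congr 1; simp [wt]
  have e2 : ∀ b : ℕ × ℕ, lmon (-wt (b.1, b.2 + 1)) = lmon (0, -1) * lmon (-wt b) := fun b => by
    rw [← lmon_add]; congr 1; simp [wt]
  have e3 : ∀ b : ℕ × ℕ, lmon (-wt (b.1 + 1, b.2 + 1)) =
      lmon (-1, 0) * lmon (0, -1) * lmon (-wt b) := fun b => by
    rw [← lmon_add, ← lmon_add]; congr 1; simp [wt]
  have e4 : lmon (-(1, 1)) = lmon (-1, 0) * lmon (0, -1) := by rw [← lmon_add]; simp
  have e0 : lmon (-wt (0, 0)) = 1 := rfl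
  simp only [e1, e2, e3, e0, Finset.sum_add_distrib, ← Finset.mul_sum] at h
  simp only [sub_eq_add_neg w, sub_eq_add_neg (w + -(1, 1)), lmon_add, ← Finset.mul_sum, e4]
  have hV : vdual Y.cells = ∑ b ∈ Y.cells, lmon (-wt b) := rfl
  rw [hV]
  linear_combination -lmon w * h

theorem vchar_union {S X : Finset (ℕ × ℕ)} [DecidableEq (ℕ × ℕ)] (h : Disjoint S X) :
    vchar (S ∪ X) = vchar S + vchar X := Finset.sum_union h

theorem vdual_union {S X : Finset (ℕ × ℕ)} [DecidableEq (ℕ × ℕ)] (h : Disjoint S X) :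
    vdual (S ∪ X) = vdual S + vdual X := Finset.sum_union h

/-- The change of the hook character when a set of addable nodes is added. -/
theorem hookChar_union {Y Y' : YoungDiagram} {X : Finset (ℕ × ℕ)} (hX : X ⊆ addable Y)
    (hY' : Y'.cells = Y.cells ∪ X) :
    hookChar Y' + ∑ x ∈ X, ∑ r ∈ removable Y', lmon (wt x - wt r) +
      ∑ x ∈ X, ∑ r ∈ removable Y, lmon (wt r + (1, 1) - wt x) =
    hookChar Y + ∑ x ∈ X, ∑ a ∈ addable Y', lmon (wt x + (1, 1) - wt a) +
      ∑ x ∈ X, ∑ a ∈ addable Y, lmon (wt a - wt x) := by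
  have hdisj : Disjoint Y.cells X := by
    rw [Finset.disjoint_right]
    exact fun x hx => (mem_addable.mp (hX hx)).1
  have h1 : ∀ x, ∑ a ∈ addable Y', lmon (wt x + (1, 1) - wt a) -
      ∑ r ∈ removable Y', lmon (wt x - wt r) = lmon (1, 1) * lmon (wt x) *
        (1 - (1 - lmon (-1, 0)) * (1 - lmon (0, -1)) * vdual Y'.cells) := by
    intro x
    rw [← lmon_add, lmon_mul_corners_dual]
    simp only [add_sub_cancel_left, add_comm (wt x)]
  have h2 : ∀ x, ∑ a ∈ addable Y, lmon (wt a - wt x) -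
      ∑ r ∈ removable Y, lmon (wt r + (1, 1) - wt x) = lmon (-wt x) *
        (1 - (1 - lmon (1, 0)) * (1 - lmon (0, 1)) * vchar Y.cells) := by
    intro x
    rw [lmon_mul_corners]
    simp only [sub_eq_add_neg]
  have h1' := Finset.sum_congr (rfl : X = X) fun x _ => h1 x
  have h2' := Finset.sum_congr (rfl : X = X) fun x _ => h2 x
  rw [Finset.sum_sub_distrib, ← Finset.sum_mul, ← Finset.mul_sum] at h1'
  rw [Finset.sum_sub_distrib, ← Finset.sum_mul] at h2'
  have e1 : ∑ x ∈ X, lmon (wt x) = vchar X := rfl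
  have e2 : ∑ x ∈ X, lmon (-wt x) = vdual X := rfl
  rw [e1] at h1'
  rw [e2] at h2'
  rw [hookChar_eq Y, hookChar_eq Y']
  rw [hY', vchar_union hdisj, vdual_union hdisj]
  rw [hY', vdual_union hdisj] at h1'
  have e3 : lmon (1, 1) = lmon (1, 0) * lmon (0, 1) := by rw [← lmon_add]; simp
  have e4 : lmon (1, 0) * lmon (-1, 0) = 1 := by rw [← lmon_add]; rfl
  have e5 : lmon (0, 1) * lmon (0, -1) = 1 := by rw [← lmon_add]; rfl
  rw [e3] at h1' ⊢
  have e6 : lmon (1, 0) * lmon (0, 1) * ((1 - lmon (-1, 0)) * (1 - lmon (0, -1))) =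
      (1 - lmon (1, 0)) * (1 - lmon (0, 1)) := by
    linear_combination (lmon (0, 1) * lmon (0, -1) - lmon (0, 1)) * e4 + (1 - lmon (1, 0)) * e5
  linear_combination -h1' - h2' + vchar X * (vdual Y.cells + vdual X) * e6

/-- Adding a set `X` of addable nodes of colour `i`, the ratio of the hook products is a product
over the addable and removable nodes of this colour only. -/
theorem hookWeight_union (hε : LinearIndependent ℤ ![ε₁, ε₂]) {Y Y' : YoungDiagram}
    {i : ZMod k} {X : Finset (ℕ × ℕ)} (hX : X ⊆ addableOf k Y i) (hY' : Y'.cells = Y.cells ∪ X) :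
    hookWeight k ε₁ ε₂ Y' * ∏ x ∈ X, ((∏ a ∈ addableOf k Y' i,
        (ct ε₁ ε₂ x + (ε₁ + ε₂) - ct ε₁ ε₂ a)) /
        ∏ r ∈ (removableOf k Y' i).erase x, (ct ε₁ ε₂ x - ct ε₁ ε₂ r)) =
      hookWeight k ε₁ ε₂ Y * ∏ x ∈ X, ((∏ r ∈ removableOf k Y i,
        (ct ε₁ ε₂ r + (ε₁ + ε₂) - ct ε₁ ε₂ x)) /
        ∏ a ∈ (addableOf k Y i).erase x, (ct ε₁ ε₂ a - ct ε₁ ε₂ x)) := by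
  have hXA : X ⊆ addable Y := fun x hx => (mem_addableOf.mp (hX hx)).1
  have hcol : ∀ x ∈ X, colour k x = i := fun x hx => (mem_addableOf.mp (hX hx)).2
  have h := congrArg (eu k ε₁ ε₂) (hookChar_union hXA hY')
  simp only [eu_add, eu_sum] at h
  have hdvd : ∀ w : ℤ × ℤ, ((w + (1, 1)).1 - (w + (1, 1)).2) = w.1 - w.2 := by
    intro w; simp
  -- the four products of Euler classes are the four products in the claim
  have p1 : ∀ x ∈ X, ∏ r ∈ removable Y', eu k ε₁ ε₂ (lmon (wt x - wt r)) =
      ∏ r ∈ (removableOf k Y' i).erase x, (ct ε₁ ε₂ x - ct ε₁ ε₂ r) := by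
    intro x hx
    have hsub : (removableOf k Y' i).erase x ⊆ removable Y' :=
      (Finset.erase_subset _ _).trans (Finset.filter_subset _ _)
    rw [← Finset.prod_subset hsub]
    · refine Finset.prod_congr rfl fun r hr => ?_
      rw [Finset.mem_erase, mem_removableOf] at hr
      rw [eu_lmon_of_dvd, wval_sub, wval_wt, wval_wt]
      · rw [← colour_eq_iff, hcol x hx, hr.2.2]
      · rw [Ne, wval_eq_zero hε, sub_eq_zero]
        exact fun h => hr.1 (wt_injective h).symm
    · intro r hr hr'
      by_cases hrx : r = x
      · subst hrx; rw [sub_self]; exact eu_lmon_zero _ _ _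
      · refine eu_lmon_of_not_dvd _ _ _ fun hd => hr' ?_
        rw [← colour_eq_iff, hcol x hx] at hd
        exact Finset.mem_erase.mpr ⟨hrx, mem_removableOf.mpr ⟨hr, hd.symm⟩⟩
  have p2 : ∀ x ∈ X, ∏ r ∈ removable Y, eu k ε₁ ε₂ (lmon (wt r + (1, 1) - wt x)) =
      ∏ r ∈ removableOf k Y i, (ct ε₁ ε₂ r + (ε₁ + ε₂) - ct ε₁ ε₂ x) := by
    intro x hx
    rw [removableOf, Finset.prod_filter]
    refine Finset.prod_congr rfl fun r hr => ?_
    have hw : wt r + (1, 1) - wt x = wt r - wt x + (1, 1) := by abel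
    split_ifs with hc
    · rw [eu_lmon_of_dvd, wval_sub, wval_add, wval_wt, wval_wt, wval_one_one]
      · rw [hw, hdvd, ← colour_eq_iff, hcol x hx, hc]
      · rw [Ne, wval_eq_zero hε, sub_eq_zero]
        intro h
        have hx1 := mem_addable.mp (hXA hx)
        have hr1 := mem_removable.mp hr
        have hxr : x = (r.1 + 1, r.2 + 1) := wt_injective (by rw [← h]; simp [wt])
        rw [hxr] at hx1
        rcases hx1.2.1 with h1 | h1
        · simp at h1
        · exact hr1.2.2 (by simpa using h1)
    · rw [eu_lmon_of_not_dvd]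
      rw [hw, hdvd, ← colour_eq_iff, hcol x hx]; exact hc
  have p3 : ∀ x ∈ X, ∏ a ∈ addable Y', eu k ε₁ ε₂ (lmon (wt x + (1, 1) - wt a)) =
      ∏ a ∈ addableOf k Y' i, (ct ε₁ ε₂ x + (ε₁ + ε₂) - ct ε₁ ε₂ a) := by
    intro x hx
    rw [addableOf, Finset.prod_filter]
    refine Finset.prod_congr rfl fun a ha => ?_
    have hw : wt x + (1, 1) - wt a = wt x - wt a + (1, 1) := by abel
    split_ifs with hc
    · rw [eu_lmon_of_dvd, wval_sub, wval_add, wval_wt, wval_wt, wval_one_one]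
      · rw [hw, hdvd, ← colour_eq_iff, hcol x hx, hc]
      · rw [Ne, wval_eq_zero hε, sub_eq_zero]
        intro h
        have hx1 := mem_addable.mp (hXA hx)
        have ha1 := mem_addable.mp ha
        have hax : a = (x.1 + 1, x.2 + 1) := wt_injective (by rw [← h]; simp [wt])
        rw [hax] at ha1
        rcases ha1.2.1 with h1 | h1
        · simp at h1
        · simp only [Nat.add_sub_cancel, hY', Finset.mem_union] at h1
          rcases h1 with h1 | h1
          · exact hx1.1 (cells_down h1)
          · rcases (mem_addable.mp (hXA h1)).2.2 with h2 | h2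
            · simp at h2
            · exact hx1.1 (by simpa using h2)
    · rw [eu_lmon_of_not_dvd]
      rw [hw, hdvd, ← colour_eq_iff, hcol x hx]; exact fun h => hc h.symm
  have p4 : ∀ x ∈ X, ∏ a ∈ addable Y, eu k ε₁ ε₂ (lmon (wt a - wt x)) =
      ∏ a ∈ (addableOf k Y i).erase x, (ct ε₁ ε₂ a - ct ε₁ ε₂ x) := by
    intro x hx
    have hsub : (addableOf k Y i).erase x ⊆ addable Y :=
      (Finset.erase_subset _ _).trans (Finset.filter_subset _ _)
    rw [← Finset.prod_subset hsub]
    · refine Finset.prod_congr rfl fun r hr => ?_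
      rw [Finset.mem_erase, mem_addableOf] at hr
      rw [eu_lmon_of_dvd, wval_sub, wval_wt, wval_wt]
      · rw [← colour_eq_iff, hcol x hx, hr.2.2]
      · rw [Ne, wval_eq_zero hε, sub_eq_zero]
        exact fun h => hr.1 (wt_injective h)
    · intro r hr hr'
      by_cases hrx : r = x
      · subst hrx; rw [sub_self]; exact eu_lmon_zero _ _ _
      · refine eu_lmon_of_not_dvd _ _ _ fun hd => hr' ?_
        rw [← colour_eq_iff, hcol x hx] at hd
        exact Finset.mem_erase.mpr ⟨hrx, mem_addableOf.mpr ⟨hr, hd⟩⟩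
  have q1 := Finset.prod_congr (rfl : X = X) p1
  have q2 := Finset.prod_congr (rfl : X = X) p2
  have q3 := Finset.prod_congr (rfl : X = X) p3
  have q4 := Finset.prod_congr (rfl : X = X) p4
  have n1 : ∏ x ∈ X, ∏ r ∈ removable Y', eu k ε₁ ε₂ (lmon (wt x - wt r)) ≠ 0 :=
    Finset.prod_ne_zero_iff.mpr fun _ _ => Finset.prod_ne_zero_iff.mpr fun _ _ => eu_ne_zero _ _ _ _
  have n4 : ∏ x ∈ X, ∏ a ∈ addable Y, eu k ε₁ ε₂ (lmon (wt a - wt x)) ≠ 0 :=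
    Finset.prod_ne_zero_iff.mpr fun _ _ => Finset.prod_ne_zero_iff.mpr fun _ _ => eu_ne_zero _ _ _ _
  have n0 := eu_ne_zero k ε₁ ε₂ (hookChar Y)
  have n0' := eu_ne_zero k ε₁ ε₂ (hookChar Y')
  rw [q1] at n1
  rw [q4] at n4
  rw [q1, q2, q3, q4] at h
  rw [hookWeight_eq_eu k hε, hookWeight_eq_eu k hε, Finset.prod_div_distrib,
    Finset.prod_div_distrib]
  rw [inv_mul_eq_div, inv_mul_eq_div, div_div, div_div, div_eq_div_iff (mul_ne_zero n1 n0')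
    (mul_ne_zero n4 n0)]
  linear_combination -h

end Euler

end

end ALE

namespace ALE

noncomputable section

/-! ### Sums over the diagrams with a given colour vector -/

section Diagrams

theorem finite_card_eq (n : ℕ) : {Y : YoungDiagram | Y.card = n}.Finite := by
  refine Set.Finite.of_finite_image (f := YoungDiagram.cells)
    (((Finset.range n ×ˢ Finset.range n).powerset.finite_toSet).subset ?_) ?_
  · rintro _ ⟨Y, hY, rfl⟩
    rw [Finset.mem_coe, Finset.mem_powerset]
    intro x hx
    have h1 := fst_lt_card hx
    have h2 := snd_lt_card hx
    rw [Set.mem_ofPred_eq] at hY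
    simp only [Finset.mem_product, Finset.mem_range]
    omega
  · intro Y _ Z _ h
    exact YoungDiagram.ext h

variable (k : ℕ)

/-- The number of nodes of a given colour. -/
def colCount (Y : YoungDiagram) (i : ZMod k) : ℕ := (Y.cells.filter fun x => colour k x = i).card

theorem sum_colCount [NeZero k] (Y : YoungDiagram) : ∑ i, colCount k Y i = Y.card := by
  rw [YoungDiagram.card, Finset.card_eq_sum_card_fiberwise (f := colour k) (t := Finset.univ)
    (fun _ _ => Finset.mem_coe.mpr (Finset.mem_univ _))]
  rfl

theorem finite_colCount_eq [NeZero k] (v : ZMod k → ℤ) :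
    {Y : YoungDiagram | ∀ i, (colCount k Y i : ℤ) = v i}.Finite := by
  refine (finite_card_eq (∑ i, v i).toNat).subset fun Y hY => ?_
  rw [Set.mem_ofPred_eq] at hY ⊢
  rw [← Finset.sum_congr rfl fun i _ => hY i, ← Nat.cast_sum, sum_colCount]
  simp

/-- The finite set of Young diagrams with a given colour vector. The colour vector is allowed to
be negative, and then there is no such diagram. -/
def diagrams [NeZero k] (v : ZMod k → ℤ) : Finset YoungDiagram := (finite_colCount_eq k v).toFinset

variable {k}

theorem mem_diagrams [NeZero k] {v : ZMod k → ℤ} {Y : YoungDiagram} :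
    Y ∈ diagrams k v ↔ ∀ i, (colCount k Y i : ℤ) = v i := by simp [diagrams]

theorem diagrams_eq_empty [NeZero k] {v : ZMod k → ℤ} {i : ZMod k} (h : v i < 0) :
    diagrams k v = ∅ := by
  rw [Finset.eq_empty_iff_forall_notMem]
  intro Y hY
  have := mem_diagrams.mp hY i
  omega

theorem card_of_mem_diagrams [NeZero k] {v : ZMod k → ℤ} {Y : YoungDiagram} (h : Y ∈ diagrams k v) :
    (Y.card : ℤ) = ∑ i, v i := by
  rw [← sum_colCount k Y, Nat.cast_sum]
  exact Finset.sum_congr rfl fun i _ => mem_diagrams.mp h i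

theorem colour_right (b : ℕ × ℕ) : colour k (b.1 + 1, b.2) = colour k b + 1 := by
  simp [colour]; ring

theorem colour_up (b : ℕ × ℕ) : colour k (b.1, b.2 + 1) = colour k b - 1 := by
  simp [colour]; ring

theorem colour_diag (b : ℕ × ℕ) : colour k (b.1 + 1, b.2 + 1) = colour k b := by
  simp [colour]

/-- The number of addable minus the number of removable nodes of colour `i` in the diagrams with
colour vector `v`. -/
def slack (v : ZMod k → ℤ) (i : ZMod k) : ℤ :=
  (if i = 0 then 1 else 0) - 2 * v i + v (i + 1) + v (i - 1)

/-- The corners of colour `j`, tested against a function on the nodes. -/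
theorem sum_corners_colour {M : Type*} [AddCommGroup M] (Y : YoungDiagram) (j : ZMod k)
    (F : ℕ × ℕ → M) :
    ∑ a ∈ addableOf k Y j, F a - ∑ r ∈ removableOf k Y j, F (r.1 + 1, r.2 + 1) =
      (if j = 0 then F (0, 0) else 0) - ∑ b ∈ Y.cells,
        ((if colour k b = j then F b + F (b.1 + 1, b.2 + 1) else 0) -
          (if colour k b = j - 1 then F (b.1 + 1, b.2) else 0) -
          if colour k b = j + 1 then F (b.1, b.2 + 1) else 0) := by
  have h := sum_corners Y (fun b => if colour k b = j then F b else 0)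
  simp only [colour_right, colour_up, colour_diag, ← eq_sub_iff_add_eq,
    sub_eq_iff_eq_add] at h
  have h0 : colour k (0, 0) = 0 := by simp [colour]
  rw [addableOf, removableOf, Finset.sum_filter, Finset.sum_filter]
  have h1 : (if colour k (0, 0) = j then F (0, 0) else 0) = if j = 0 then F (0, 0) else 0 := by
    rw [h0]; simp [eq_comm]
  rw [h1] at h
  rw [sub_eq_iff_eq_add, h]
  simp only [Finset.sum_add_distrib, Finset.sum_sub_distrib]
  have h2 : ∀ b : ℕ × ℕ, (if colour k b = j then F b + F (b.1 + 1, b.2 + 1) else 0) =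
      (if colour k b = j then F b else 0) + if colour k b = j then F (b.1 + 1, b.2 + 1) else 0 := by
    intro b; split_ifs <;> simp
  simp only [h2, Finset.sum_add_distrib]
  abel

theorem card_corners (Y : YoungDiagram) (i : ZMod k) :
    ((addableOf k Y i).card : ℤ) - (removableOf k Y i).card =
      slack (fun j => (colCount k Y j : ℤ)) i := by
  have h := sum_corners_colour Y i (fun _ => (1 : ℤ))
  simp only [Finset.sum_const, nsmul_eq_mul, mul_one, Finset.sum_sub_distrib,
    ← Finset.sum_filter] at h
  rw [h, slack]
  simp only [colCount]
  ring

theorem card_corners_of_mem [NeZero k] {v : ZMod k → ℤ} {Y : YoungDiagram} (h : Y ∈ diagrams k v)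
    (i : ZMod k) :
    ((addableOf k Y i).card : ℤ) - (removableOf k Y i).card = slack v i := by
  rw [card_corners]
  congr 1
  funext j
  exact mem_diagrams.mp h j

/-- The diagram with a set of addable nodes added. -/
def addNodes (Y : YoungDiagram) (X : Finset (ℕ × ℕ)) : YoungDiagram where
  cells := Y.cells ∪ X.filter fun x => x ∈ addable Y
  isLowerSet := by
    rintro ⟨a, b⟩ ⟨c, d⟩ hle hab
    simp only [Finset.coe_union, Set.mem_union, Finset.mem_coe] at hab ⊢
    rcases hab with hab | hab
    · exact Or.inl (Y.up_left_mem hle.1 hle.2 hab)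
    · by_cases heq : (c, d) = (a, b)
      · rw [heq]; exact Or.inr hab
      · left
        have hm := mem_addable.mp (Finset.mem_filter.mp hab).2
        have h1 : c ≤ a := hle.1
        have h2 : d ≤ b := hle.2
        simp only [Prod.mk.injEq, not_and_or] at heq
        by_cases hc : c = a
        · have hd : d ≤ b - 1 := by omega
          rcases hm.2.2 with h | h
          · simp only at h; omega
          · exact Y.up_left_mem h1 hd h
        · have hd : c ≤ a - 1 := by omega
          rcases hm.2.1 with h | h
          · simp only at h; omega
          · exact Y.up_left_mem hd h2 h

/-- The diagram with a set of removable nodes removed. -/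
def removeNodes (Y : YoungDiagram) (X : Finset (ℕ × ℕ)) : YoungDiagram where
  cells := Y.cells \ X.filter fun x => x ∈ removable Y
  isLowerSet := by
    rintro ⟨a, b⟩ ⟨c, d⟩ hle hab
    simp only [Finset.coe_sdiff, Set.mem_sdiff, Finset.mem_coe] at hab ⊢
    refine ⟨Y.up_left_mem hle.1 hle.2 hab.1, fun hcd => ?_⟩
    by_cases heq : (c, d) = (a, b)
    · exact hab.2 (heq ▸ hcd)
    · have hm := mem_removable.mp (Finset.mem_filter.mp hcd).2
      have h1 : c ≤ a := hle.1
      have h2 : d ≤ b := hle.2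
      simp only [Prod.mk.injEq, not_and_or] at heq
      by_cases hc : c = a
      · exact hm.2.2 (Y.up_left_mem (i2 := a) (j2 := b) (by omega) (by simp only; omega) hab.1)
      · exact hm.2.1 (Y.up_left_mem (i2 := a) (j2 := b) (by simp only; omega) (by omega) hab.1)

theorem cells_addNodes {Y : YoungDiagram} {X : Finset (ℕ × ℕ)} (hX : X ⊆ addable Y) :
    (addNodes Y X).cells = Y.cells ∪ X := by
  exact congrArg (Y.cells ∪ ·) (Finset.filter_true_of_mem hX)

theorem cells_removeNodes {Y : YoungDiagram} {X : Finset (ℕ × ℕ)} (hX : X ⊆ removable Y) :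
    (removeNodes Y X).cells = Y.cells \ X := by
  exact congrArg (Y.cells \ ·) (Finset.filter_true_of_mem hX)

theorem subset_removable_addNodes {Y : YoungDiagram} {X : Finset (ℕ × ℕ)} (hX : X ⊆ addable Y) :
    X ⊆ removable (addNodes Y X) := by
  rintro ⟨a, b⟩ hx
  have h0 := mem_addable.mp (hX hx)
  rw [mem_removable, cells_addNodes hX]
  simp only [Finset.mem_union, not_or]
  refine ⟨Or.inr hx, ⟨fun h => h0.1 (cells_left h), fun h => ?_⟩,
    ⟨fun h => h0.1 (cells_down h), fun h => ?_⟩⟩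
  · rcases (mem_addable.mp (hX h)).2.1 with h' | h'
    · simp at h'
    · exact h0.1 h'
  · rcases (mem_addable.mp (hX h)).2.2 with h' | h'
    · simp at h'
    · exact h0.1 h'

theorem subset_addable_removeNodes {Y : YoungDiagram} {X : Finset (ℕ × ℕ)}
    (hX : X ⊆ removable Y) : X ⊆ addable (removeNodes Y X) := by
  rintro ⟨a, b⟩ hx
  have h0 := mem_removable.mp (hX hx)
  rw [mem_addable, cells_removeNodes hX]
  simp only [Finset.mem_sdiff, not_and, not_not]
  refine ⟨fun _ => hx, ?_, ?_⟩
  · rcases a with _ | a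
    · exact Or.inl rfl
    · refine Or.inr ⟨cells_left h0.1, fun h => ?_⟩
      exact (mem_removable.mp (hX h)).2.1 h0.1
  · rcases b with _ | b
    · exact Or.inl rfl
    · refine Or.inr ⟨cells_down h0.1, fun h => ?_⟩
      exact (mem_removable.mp (hX h)).2.2 h0.1

theorem removeNodes_addNodes {Y : YoungDiagram} {X : Finset (ℕ × ℕ)} (hX : X ⊆ addable Y) :
    removeNodes (addNodes Y X) X = Y := by
  refine YoungDiagram.ext ?_
  rw [cells_removeNodes (subset_removable_addNodes hX), cells_addNodes hX,
    Finset.union_sdiff_cancel_right]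
  rw [Finset.disjoint_right]
  exact fun x hx => (mem_addable.mp (hX hx)).1

theorem addNodes_removeNodes {Y : YoungDiagram} {X : Finset (ℕ × ℕ)} (hX : X ⊆ removable Y) :
    addNodes (removeNodes Y X) X = Y := by
  refine YoungDiagram.ext ?_
  rw [cells_addNodes (subset_addable_removeNodes hX), cells_removeNodes hX,
    Finset.sdiff_union_of_subset]
  exact fun x hx => (mem_removable.mp (hX hx)).1

theorem colCount_addNodes {Y : YoungDiagram} {i : ZMod k} {X : Finset (ℕ × ℕ)}
    (hX : X ⊆ addableOf k Y i) (j : ZMod k) :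
    (colCount k (addNodes Y X) j : ℤ) =
      colCount k Y j + Pi.single (M := fun _ => ℤ) i X.card j := by
  have hXA : X ⊆ addable Y := fun x hx => (mem_addableOf.mp (hX hx)).1
  have hdisj : Disjoint Y.cells X := by
    rw [Finset.disjoint_right]
    exact fun x hx => (mem_addable.mp (hXA hx)).1
  rw [colCount, cells_addNodes hXA, Finset.filter_union, Finset.card_union_of_disjoint
    (Finset.disjoint_filter_filter hdisj), colCount]
  push_cast
  congr 1
  rw [Pi.single_apply]
  split_ifs with h
  · rw [Finset.filter_true_of_mem]
    intro x hx
    rw [h]; exact (mem_addableOf.mp (hX hx)).2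
  · rw [Finset.filter_false_of_mem, Finset.card_empty, Nat.cast_zero]
    intro x hx h'
    exact h (h'.symm.trans (mem_addableOf.mp (hX hx)).2)

/-- Adding `c` nodes of colour `i` to a diagram, or removing them. -/
theorem sum_addNodes [NeZero k] {M : Type*} [AddCommMonoid M] (v : ZMod k → ℤ) (i : ZMod k) (c : ℕ)
    (G : YoungDiagram → Finset (ℕ × ℕ) → M) :
    ∑ Y ∈ diagrams k (v + Pi.single i (c : ℤ)), ∑ X ∈ (removableOf k Y i).powersetCard c, G Y X =
      ∑ Y ∈ diagrams k v, ∑ X ∈ (addableOf k Y i).powersetCard c, G (addNodes Y X) X := by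
  rw [Finset.sum_sigma', Finset.sum_sigma']
  have hadd : ∀ {Y X}, X ∈ (addableOf k Y i).powersetCard c → X ⊆ addable Y := fun h x hx =>
    (mem_addableOf.mp ((Finset.mem_powersetCard.mp h).1 hx)).1
  have hrem : ∀ {Y X}, X ∈ (removableOf k Y i).powersetCard c → X ⊆ removable Y := fun h x hx =>
    (mem_removableOf.mp ((Finset.mem_powersetCard.mp h).1 hx)).1
  refine Finset.sum_bij' (fun p _ => ⟨removeNodes p.1 p.2, p.2⟩)
    (fun p _ => ⟨addNodes p.1 p.2, p.2⟩)
    ?_ ?_ ?_ ?_ ?_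
  · rintro ⟨Y, X⟩ h
    rw [Finset.mem_sigma] at h ⊢
    obtain ⟨hY, hX⟩ := h
    simp only at hY hX ⊢
    have hXs : X ⊆ addableOf k (removeNodes Y X) i := fun x hx =>
      mem_addableOf.mpr ⟨subset_addable_removeNodes (hrem hX) hx,
        (mem_removableOf.mp ((Finset.mem_powersetCard.mp hX).1 hx)).2⟩
    refine ⟨mem_diagrams.mpr fun j => ?_,
      Finset.mem_powersetCard.mpr ⟨hXs, (Finset.mem_powersetCard.mp hX).2⟩⟩
    have h1 := colCount_addNodes hXs j
    rw [addNodes_removeNodes (hrem hX), mem_diagrams.mp hY j,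
      (Finset.mem_powersetCard.mp hX).2] at h1
    exact (add_right_cancel h1).symm
  · rintro ⟨Y, X⟩ h
    rw [Finset.mem_sigma] at h ⊢
    obtain ⟨hY, hX⟩ := h
    simp only at hY hX ⊢
    refine ⟨mem_diagrams.mpr fun j => ?_, Finset.mem_powersetCard.mpr ⟨fun x hx => ?_,
      (Finset.mem_powersetCard.mp hX).2⟩⟩
    · rw [colCount_addNodes (Finset.mem_powersetCard.mp hX).1, mem_diagrams.mp hY,
        (Finset.mem_powersetCard.mp hX).2]
      rfl
    · exact mem_removableOf.mpr ⟨subset_removable_addNodes (hadd hX) hx,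
        (mem_addableOf.mp ((Finset.mem_powersetCard.mp hX).1 hx)).2⟩
  · rintro ⟨Y, X⟩ h
    rw [Finset.mem_sigma] at h
    simp only [addNodes_removeNodes (hrem h.2)]
  · rintro ⟨Y, X⟩ h
    rw [Finset.mem_sigma] at h
    simp only [removeNodes_addNodes (hadd h.2)]
  · rintro ⟨Y, X⟩ h
    rw [Finset.mem_sigma] at h
    simp only [addNodes_removeNodes (hrem h.2)]

/-- Adding one node of colour `i` to a diagram, or removing it. -/
theorem sum_addNode [NeZero k] {M : Type*} [AddCommMonoid M] (v : ZMod k → ℤ) (i : ZMod k)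
    (G : YoungDiagram → ℕ × ℕ → M) :
    ∑ Y ∈ diagrams k (v + Pi.single i 1), ∑ x ∈ removableOf k Y i, G Y x =
      ∑ Y ∈ diagrams k v, ∑ x ∈ addableOf k Y i, G (addNodes Y {x}) x := by
  have h := sum_addNodes v i 1 (fun Y X => ∑ x ∈ X, G Y x)
  simp only [Finset.powersetCard_one, Finset.sum_map, Function.Embedding.coeFn_mk,
    Finset.sum_singleton, Nat.cast_one] at h
  exact h

end Diagrams

end

end ALE

namespace ALE

noncomputable section

/-! ### Reflection symmetry of the sums of hook products -/

section Evaluation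

variable {K : Type*} [Field K] {ε₁ ε₂ : K} {k : ℕ}

/-- The sum of the hook products over the diagrams with a given colour vector. -/
def hookSum [NeZero k] (ε₁ ε₂ : K) (v : ZMod k → ℤ) : K :=
  ∑ Y ∈ diagrams k v, hookWeight k ε₁ ε₂ Y

theorem ct_diag (ε₁ ε₂ : K) (r : ℕ × ℕ) :
    ct ε₁ ε₂ (r.1 + 1, r.2 + 1) = ct ε₁ ε₂ r + (ε₁ + ε₂) := by
  simp [ct]; ring

theorem hookWeight_addNodes (hε : LinearIndependent ℤ ![ε₁, ε₂]) {Y : YoungDiagram}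
    {i : ZMod k} {X : Finset (ℕ × ℕ)} (hX : X ⊆ addableOf k Y i) :
    hookWeight k ε₁ ε₂ (addNodes Y X) * ∏ x ∈ X, ((∏ a ∈ addableOf k (addNodes Y X) i,
        (ct ε₁ ε₂ x + (ε₁ + ε₂) - ct ε₁ ε₂ a)) /
        ∏ r ∈ (removableOf k (addNodes Y X) i).erase x, (ct ε₁ ε₂ x - ct ε₁ ε₂ r)) =
      hookWeight k ε₁ ε₂ Y * ∏ x ∈ X, ((∏ r ∈ removableOf k Y i,
        (ct ε₁ ε₂ r + (ε₁ + ε₂) - ct ε₁ ε₂ x)) /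
        ∏ a ∈ (addableOf k Y i).erase x, (ct ε₁ ε₂ a - ct ε₁ ε₂ x)) :=
  hookWeight_union hε hX (cells_addNodes fun _ hx => (mem_addableOf.mp (hX hx)).1)

theorem prod_sub_comm {ι : Type*} (s : Finset ι) (f g : ι → K) :
    ∏ i ∈ s, (f i - g i) = (-1) ^ s.card * ∏ i ∈ s, (g i - f i) := by
  rw [← Finset.prod_const, ← Finset.prod_mul_distrib]
  exact Finset.prod_congr rfl fun i _ => by ring

theorem prod_erase_split [DecidableEq (ℕ × ℕ)] {A X : Finset (ℕ × ℕ)} (hX : X ⊆ A) {x : ℕ × ℕ}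
    (hx : x ∈ X) (f : ℕ × ℕ → K) :
    ∏ a ∈ A.erase x, f a = (∏ a ∈ A \ X, f a) * ∏ a ∈ X.erase x, f a := by
  rw [← Finset.prod_union]
  · refine Finset.prod_congr ?_ fun _ _ => rfl
    ext y
    simp only [Finset.mem_erase, Finset.mem_union, Finset.mem_sdiff]
    constructor
    · rintro ⟨h1, h2⟩
      by_cases hy : y ∈ X
      · exact Or.inr ⟨h1, hy⟩
      · exact Or.inl ⟨h2, hy⟩
    · rintro (⟨h1, h2⟩ | ⟨h1, h2⟩)
      · exact ⟨fun h => h2 (h ▸ hx), h1⟩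
      · exact ⟨h1, hX h2⟩
  · rw [Finset.disjoint_left]
    intro y h1 h2
    exact (Finset.mem_sdiff.mp h1).2 (Finset.mem_of_mem_erase h2)

theorem prod_erase_ne_zero (hε : LinearIndependent ℤ ![ε₁, ε₂]) (X : Finset (ℕ × ℕ)) (x : ℕ × ℕ) :
    ∏ a ∈ X.erase x, (ct ε₁ ε₂ x - ct ε₁ ε₂ a) ≠ 0 :=
  Finset.prod_ne_zero_iff.mpr fun _ ha => sub_ne_zero.mpr fun h =>
    (Finset.mem_erase.mp ha).1 (ct_injective hε h).symm

/-- The sum of the hook products is invariant under the reflections of the affine Weyl group: the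
pairs of a diagram and a set of `c` addable nodes of colour `i` are counted in two ways, and both
inner sums are equal to `1` by Lagrange interpolation. -/
theorem hookSum_reflect [NeZero k] (hε : LinearIndependent ℤ ![ε₁, ε₂]) (hk : 2 ≤ k)
    (v : ZMod k → ℤ) (i : ZMod k) (c : ℕ) (hc : slack v i = c) :
    hookSum ε₁ ε₂ (v + Pi.single i (c : ℤ)) = hookSum ε₁ ε₂ v := by
  have hinj : ∀ S : Finset (ℕ × ℕ), Set.InjOn (ct ε₁ ε₂) S := fun S => (ct_injective hε).injOn
  have h1ne : (1 : ZMod k) ≠ 0 := by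
    have : Fact (1 < k) := ⟨hk⟩
    exact one_ne_zero
  have hslack : slack (v + Pi.single i (c : ℤ)) i = -c := by
    have e1 : (Pi.single (M := fun _ => ℤ) i (c : ℤ)) (i + 1) = 0 :=
      Pi.single_eq_of_ne (by simpa using h1ne) _
    have e2 : (Pi.single (M := fun _ => ℤ) i (c : ℤ)) (i - 1) = 0 :=
      Pi.single_eq_of_ne (by simpa [sub_eq_iff_eq_add] using h1ne) _
    simp only [slack, Pi.add_apply, Pi.single_eq_same, e1, e2] at hc ⊢
    linarith
  have hL : ∀ Y ∈ diagrams k v, hookWeight k ε₁ ε₂ Y =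
      ∑ X ∈ (addableOf k Y i).powersetCard c, hookWeight k ε₁ ε₂ Y * ∏ x ∈ X,
        ((∏ r ∈ removableOf k Y i, (ct ε₁ ε₂ x - (ct ε₁ ε₂ r + (ε₁ + ε₂)))) /
          ∏ a ∈ addableOf k Y i \ X, (ct ε₁ ε₂ x - ct ε₁ ε₂ a)) := by
    intro Y hY
    have h := card_corners_of_mem hY i
    rw [hc] at h
    rw [← Finset.mul_sum, lagrange_sum_powersetCard (hinj _) (fun r => ct ε₁ ε₂ r + (ε₁ + ε₂))
      (by omega), mul_one]
  have hR : ∀ Y ∈ diagrams k (v + Pi.single i (c : ℤ)), hookWeight k ε₁ ε₂ Y =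
      ∑ X ∈ (removableOf k Y i).powersetCard c, hookWeight k ε₁ ε₂ Y * ∏ x ∈ X,
        ((∏ a ∈ addableOf k Y i, (ct ε₁ ε₂ x - (ct ε₁ ε₂ a - (ε₁ + ε₂)))) /
          ∏ r ∈ removableOf k Y i \ X, (ct ε₁ ε₂ x - ct ε₁ ε₂ r)) := by
    intro Y hY
    have h := card_corners_of_mem hY i
    rw [hslack] at h
    rw [← Finset.mul_sum, lagrange_sum_powersetCard (hinj _) (fun r => ct ε₁ ε₂ r - (ε₁ + ε₂))
      (by omega), mul_one]
  rw [hookSum, hookSum, Finset.sum_congr rfl hL, Finset.sum_congr rfl hR, sum_addNodes]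
  refine Finset.sum_congr rfl fun Y hY => Finset.sum_congr rfl fun X hX => ?_
  obtain ⟨hXs, hXc⟩ := Finset.mem_powersetCard.mp hX
  have hXr : X ⊆ removableOf k (addNodes Y X) i := fun x hx => mem_removableOf.mpr
    ⟨subset_removable_addNodes (fun y hy => (mem_addableOf.mp (hXs hy)).1) hx,
      (mem_addableOf.mp (hXs hx)).2⟩
  have key := hookWeight_addNodes hε hXs
  have hcard := card_corners_of_mem hY i
  rw [hc] at hcard
  set D := ∏ x ∈ X, ∏ a ∈ X.erase x, (ct ε₁ ε₂ x - ct ε₁ ε₂ a) with hD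
  have hD0 : D ≠ 0 := Finset.prod_ne_zero_iff.mpr fun x _ => prod_erase_ne_zero hε X x
  have e1 : ∏ x ∈ X, ((∏ a ∈ addableOf k (addNodes Y X) i,
        (ct ε₁ ε₂ x + (ε₁ + ε₂) - ct ε₁ ε₂ a)) /
        ∏ r ∈ (removableOf k (addNodes Y X) i).erase x, (ct ε₁ ε₂ x - ct ε₁ ε₂ r)) =
      (∏ x ∈ X, ((∏ a ∈ addableOf k (addNodes Y X) i,
        (ct ε₁ ε₂ x - (ct ε₁ ε₂ a - (ε₁ + ε₂)))) /
          ∏ r ∈ removableOf k (addNodes Y X) i \ X, (ct ε₁ ε₂ x - ct ε₁ ε₂ r))) / D := by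
    rw [hD, ← Finset.prod_div_distrib]
    refine Finset.prod_congr rfl fun x hx => ?_
    rw [prod_erase_split hXr hx, div_div]
    congr 1
    exact Finset.prod_congr rfl fun a _ => by ring
  have e2 : ∏ x ∈ X, ((∏ r ∈ removableOf k Y i,
        (ct ε₁ ε₂ r + (ε₁ + ε₂) - ct ε₁ ε₂ x)) /
        ∏ a ∈ (addableOf k Y i).erase x, (ct ε₁ ε₂ a - ct ε₁ ε₂ x)) =
      (∏ x ∈ X, ((∏ r ∈ removableOf k Y i, (ct ε₁ ε₂ x - (ct ε₁ ε₂ r + (ε₁ + ε₂)))) /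
          ∏ a ∈ addableOf k Y i \ X, (ct ε₁ ε₂ x - ct ε₁ ε₂ a))) / D := by
    -- the sign is `(-1) ^ (c - 1)` for each of the `c` nodes of `X`
    have hsign : ∏ x ∈ X, ((-1 : K) ^ (c - 1)) = 1 := by
      rw [Finset.prod_const, hXc, ← pow_mul]
      exact Even.neg_one_pow (by rw [mul_comm]; exact Nat.even_mul_pred_self c)
    rw [← one_mul ((∏ x ∈ X, _) / D), ← hsign, hD, ← Finset.prod_div_distrib,
      ← Finset.prod_mul_distrib]
    refine Finset.prod_congr rfl fun x hx => ?_
    rw [prod_sub_comm (removableOf k Y i), prod_sub_comm ((addableOf k Y i).erase x),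
      prod_erase_split hXs hx, div_div, Finset.card_erase_of_mem (hXs hx), mul_div_mul_comm]
    congr 1
    have hc1 : 1 ≤ c := by
      rw [← hXc]; exact Finset.card_pos.mpr ⟨x, hx⟩
    have : (addableOf k Y i).card - 1 = (removableOf k Y i).card + (c - 1) := by omega
    rw [this, pow_add, div_mul_eq_div_div,
      div_self (pow_ne_zero _ (neg_ne_zero.mpr one_ne_zero)), one_div, ← inv_pow, inv_neg_one]
  rw [e1, e2, mul_div_assoc', mul_div_assoc', div_left_inj' hD0] at key
  exact key

end Evaluation

end

end ALE

namespace ALE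

noncomputable section

/-! ### The recursion for constant colour vectors -/

section Recursion

variable {K : Type*} [Field K] {ε₁ ε₂ : K} {k : ℕ}

/-- The sum of `f` over the addable nodes of colour `i` minus its sum over the removable nodes,
the latter shifted by `ε₁ + ε₂`. -/
def cornerSum (k : ℕ) (ε₁ ε₂ : K) (f : K → K) (Y : YoungDiagram) (i : ZMod k) : K :=
  ∑ a ∈ addableOf k Y i, f (ct ε₁ ε₂ a) - ∑ r ∈ removableOf k Y i, f (ct ε₁ ε₂ r + (ε₁ + ε₂))

theorem sum_cornerSum [NeZero k] (f : K → K) (Y : YoungDiagram) :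
    ∑ i, cornerSum k ε₁ ε₂ f Y i = f 0 - ∑ b ∈ Y.cells,
      (f (ct ε₁ ε₂ b) + f (ct ε₁ ε₂ b + (ε₁ + ε₂)) - f (ct ε₁ ε₂ b + ε₁) -
        f (ct ε₁ ε₂ b + ε₂)) := by
  have h := sum_corners Y (fun b => f (ct ε₁ ε₂ b))
  have e0 : ct ε₁ ε₂ (0, 0) = 0 := by simp [ct]
  have e1 : ∀ b : ℕ × ℕ, ct ε₁ ε₂ (b.1 + 1, b.2) = ct ε₁ ε₂ b + ε₁ := fun b => by
    simp [ct]; ring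
  have e2 : ∀ b : ℕ × ℕ, ct ε₁ ε₂ (b.1, b.2 + 1) = ct ε₁ ε₂ b + ε₂ := fun b => by
    simp [ct]; ring
  simp only [ct_diag, e0, e1, e2, Finset.sum_add_distrib] at h
  have h1 : ∑ i, ∑ a ∈ addableOf k Y i, f (ct ε₁ ε₂ a) = ∑ a ∈ addable Y, f (ct ε₁ ε₂ a) :=
    Finset.sum_fiberwise _ _ _
  have h2 : ∑ i, ∑ a ∈ removableOf k Y i, f (ct ε₁ ε₂ a + (ε₁ + ε₂)) =
      ∑ a ∈ removable Y, f (ct ε₁ ε₂ a + (ε₁ + ε₂)) :=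
    Finset.sum_fiberwise _ _ _
  simp only [cornerSum, Finset.sum_sub_distrib, Finset.sum_add_distrib]
  rw [h1, h2]
  linear_combination h

theorem sum_cornerSum_id [NeZero k] (Y : YoungDiagram) :
    ∑ i, cornerSum k ε₁ ε₂ (fun x => x) Y i = 0 := by
  rw [sum_cornerSum, Finset.sum_eq_zero, sub_zero]
  intro b _; ring

theorem sum_cornerSum_sq [NeZero k] (Y : YoungDiagram) :
    ∑ i, cornerSum k ε₁ ε₂ (fun x => x ^ 2) Y i = -(2 * ε₁ * ε₂ * Y.card) := by
  rw [sum_cornerSum, Finset.sum_congr rfl (g := fun _ => 2 * ε₁ * ε₂) (fun b _ => by ring),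
    Finset.sum_const, nsmul_eq_mul]
  simp; ring

/-- The weight with which a diagram is reached from the diagram with the node `x` removed. -/
def downRes (k : ℕ) (ε₁ ε₂ : K) (Y : YoungDiagram) (i : ZMod k) (x : ℕ × ℕ) : K :=
  (∏ a ∈ addableOf k Y i, (ct ε₁ ε₂ x + (ε₁ + ε₂) - ct ε₁ ε₂ a)) /
    ∏ r ∈ (removableOf k Y i).erase x, (ct ε₁ ε₂ x - ct ε₁ ε₂ r)

/-- The weight with which the node `x` is added to a diagram. -/
def upRes (k : ℕ) (ε₁ ε₂ : K) (Y : YoungDiagram) (i : ZMod k) (x : ℕ × ℕ) : K :=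
  (∏ r ∈ removableOf k Y i, (ct ε₁ ε₂ x - (ct ε₁ ε₂ r + (ε₁ + ε₂)))) /
    ∏ a ∈ (addableOf k Y i).erase x, (ct ε₁ ε₂ x - ct ε₁ ε₂ a)

/-- Summation over the pairs of diagrams which differ by a node of colour `i`. -/
theorem sum_downRes [NeZero k] (hε : LinearIndependent ℤ ![ε₁, ε₂]) (v : ZMod k → ℤ)
    (i : ZMod k) (m : ℕ) (hm : slack v i = m) (g : YoungDiagram → ℕ × ℕ → K) :
    ∑ Y ∈ diagrams k (v + Pi.single i 1), hookWeight k ε₁ ε₂ Y *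
        ∑ x ∈ removableOf k Y i, downRes k ε₁ ε₂ Y i x * g Y x =
      (-1) ^ (m + 1) * ∑ Y ∈ diagrams k v, hookWeight k ε₁ ε₂ Y *
        ∑ x ∈ addableOf k Y i, upRes k ε₁ ε₂ Y i x * g (addNodes Y {x}) x := by
  simp only [Finset.mul_sum]
  rw [sum_addNode v i]
  refine Finset.sum_congr rfl fun Y hY => Finset.sum_congr rfl fun x hx => ?_
  have key := hookWeight_addNodes hε (Finset.singleton_subset_iff.mpr hx)
  rw [Finset.prod_singleton, Finset.prod_singleton] at key
  have hcard := card_corners_of_mem hY i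
  rw [hm] at hcard
  have hA : 1 ≤ (addableOf k Y i).card := Finset.card_pos.mpr ⟨x, hx⟩
  rw [prod_sub_comm (removableOf k Y i), prod_sub_comm ((addableOf k Y i).erase x),
    Finset.card_erase_of_mem hx, mul_div_mul_comm] at key
  have hs : (-1 : K) ^ (removableOf k Y i).card / (-1) ^ ((addableOf k Y i).card - 1) =
      (-1) ^ (m + 1) := by
    rw [div_eq_iff (pow_ne_zero _ (neg_ne_zero.mpr one_ne_zero)), ← pow_add]
    have : m + 1 + ((addableOf k Y i).card - 1) = (removableOf k Y i).card + 2 * m := by omega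
    rw [this, pow_add, pow_mul]
    simp
  rw [hs] at key
  rw [downRes, upRes]
  linear_combination g (addNodes Y {x}) x * key

theorem sum_upRes_one (hε : LinearIndependent ℤ ![ε₁, ε₂]) {Y : YoungDiagram} {i : ZMod k}
    (h : ((addableOf k Y i).card : ℤ) - (removableOf k Y i).card = 1) :
    ∑ x ∈ addableOf k Y i, upRes k ε₁ ε₂ Y i x = 1 :=
  lagrange_sum_zero_order (ct_injective hε).injOn _ (by omega)

theorem sum_upRes_zero (hε : LinearIndependent ℤ ![ε₁, ε₂]) {Y : YoungDiagram} {i : ZMod k}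
    (h : 2 ≤ ((addableOf k Y i).card : ℤ) - (removableOf k Y i).card) :
    ∑ x ∈ addableOf k Y i, upRes k ε₁ ε₂ Y i x = 0 :=
  lagrange_sum_vanish (ct_injective hε).injOn _ (by omega)

theorem sum_upRes_insert (hε : LinearIndependent ℤ ![ε₁, ε₂]) {Y : YoungDiagram} {i : ZMod k}
    (h : ((addableOf k Y i).card : ℤ) - (removableOf k Y i).card = 2) (t : K) :
    ∑ x ∈ addableOf k Y i, (ct ε₁ ε₂ x + t) * upRes k ε₁ ε₂ Y i x = 1 :=
  lagrange_sum_insert (ct_injective hε).injOn _ t (by omega)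

theorem ct_add_injOn (hε : LinearIndependent ℤ ![ε₁, ε₂]) (S : Finset (ℕ × ℕ)) :
    Set.InjOn (fun x => ct ε₁ ε₂ x + (ε₁ + ε₂)) S :=
  fun _ _ _ _ h => ct_injective hε (add_right_cancel h)

theorem sum_downRes_first (hε : LinearIndependent ℤ ![ε₁, ε₂]) {Y : YoungDiagram} {i : ZMod k}
    (h : ((addableOf k Y i).card : ℤ) - (removableOf k Y i).card = 0) :
    ∑ x ∈ removableOf k Y i, downRes k ε₁ ε₂ Y i x = -cornerSum k ε₁ ε₂ (fun x => x) Y i := by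
  have := lagrange_sum_first_order (ct_add_injOn hε (removableOf k Y i)) (ct ε₁ ε₂)
    (A := addableOf k Y i) (by omega)
  simp only [add_sub_add_right_eq_sub] at this
  rw [cornerSum, neg_sub, ← this]
  rfl

theorem sum_downRes_second (hε : LinearIndependent ℤ ![ε₁, ε₂]) {Y : YoungDiagram} {i : ZMod k}
    (h : ((addableOf k Y i).card : ℤ) - (removableOf k Y i).card = 1) :
    2 * ∑ x ∈ removableOf k Y i, downRes k ε₁ ε₂ Y i x =
      cornerSum k ε₁ ε₂ (fun x => x) Y i ^ 2 - cornerSum k ε₁ ε₂ (fun x => x ^ 2) Y i := by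
  have := lagrange_sum_second_order (ct_add_injOn hε (removableOf k Y i)) (ct ε₁ ε₂)
    (A := addableOf k Y i) (by omega)
  simp only [add_sub_add_right_eq_sub] at this
  rw [cornerSum, cornerSum, ← this]
  rfl

theorem sum_downRes_insert (hε : LinearIndependent ℤ ![ε₁, ε₂]) {Y : YoungDiagram} {i : ZMod k}
    (h : ((addableOf k Y i).card : ℤ) - (removableOf k Y i).card = 0) :
    2 * ∑ x ∈ removableOf k Y i, downRes k ε₁ ε₂ Y i x * (ct ε₁ ε₂ x + (ε₁ + ε₂)) =
      cornerSum k ε₁ ε₂ (fun x => x) Y i ^ 2 - cornerSum k ε₁ ε₂ (fun x => x ^ 2) Y i := by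
  classical
  -- an extra root of the numerator, at `0`
  have := lagrange_sum_second_order (ct_add_injOn hε (removableOf k Y i))
    (fun o : Option (ℕ × ℕ) => o.elim 0 (ct ε₁ ε₂))
    (A := (addableOf k Y i).insertNone) (by rw [Finset.card_insertNone]; omega)
  simp only [add_sub_add_right_eq_sub, Finset.prod_insertNone, Finset.sum_insertNone,
    Option.elim] at this
  rw [cornerSum, cornerSum]
  simp only [sub_zero, zero_add, ne_eq, OfNat.ofNat_ne_zero, not_false_eq_true, zero_pow] at this
  rw [← this]
  congr 1
  refine Finset.sum_congr rfl fun x _ => ?_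
  rw [downRes]; ring

/-- The effect of a node of colour `i` on the corners of another colour. -/
theorem cornerSum_addNodes {Y : YoungDiagram} {i j : ZMod k} (hij : i ≠ j) {x : ℕ × ℕ}
    (hx : x ∈ addableOf k Y i) :
    cornerSum k ε₁ ε₂ (fun x => x) (addNodes Y {x}) j = cornerSum k ε₁ ε₂ (fun x => x) Y j +
      ((if i = j - 1 then ct ε₁ ε₂ x + ε₁ else 0) + if i = j + 1 then ct ε₁ ε₂ x + ε₂ else 0) := by
  have hxA : {x} ⊆ addable Y := by
    rw [Finset.singleton_subset_iff]; exact (mem_addableOf.mp hx).1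
  have hxY : x ∉ Y.cells := (mem_addable.mp (mem_addableOf.mp hx).1).1
  have h1 := sum_corners_colour Y j (ct ε₁ ε₂)
  have h2 := sum_corners_colour (addNodes Y {x}) j (ct ε₁ ε₂)
  rw [cells_addNodes hxA, Finset.union_comm, Finset.singleton_union, Finset.sum_insert hxY,
    (mem_addableOf.mp hx).2, if_neg hij] at h2
  have e1 : ct ε₁ ε₂ (x.1 + 1, x.2) = ct ε₁ ε₂ x + ε₁ := by simp [ct]; ring
  have e2 : ct ε₁ ε₂ (x.1, x.2 + 1) = ct ε₁ ε₂ x + ε₂ := by simp [ct]; ring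
  rw [e1, e2] at h2
  simp only [ct_diag] at h1 h2
  simp only [cornerSum]
  rw [h1, h2]
  ring

theorem slack_const [NeZero k] (n : ℤ) (i : ZMod k) :
    slack (fun _ => n) i = if i = 0 then 1 else 0 := by
  simp [slack]; ring

theorem slack_sub_single (hk : 2 ≤ k) (v : ZMod k → ℤ) (i : ZMod k) :
    slack (v - Pi.single i 1) i = slack v i + 2 := by
  have : Fact (1 < k) := ⟨hk⟩
  have e1 : (Pi.single (M := fun _ => ℤ) i 1) (i + 1) = 0 :=
    Pi.single_eq_of_ne (by simp) _
  have e2 : (Pi.single (M := fun _ => ℤ) i 1) (i - 1) = 0 :=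
    Pi.single_eq_of_ne (by simp) _
  simp only [slack, Pi.sub_apply, Pi.single_eq_same, e1, e2]
  ring

theorem sum_adjacent [NeZero k] (hk : 2 ≤ k) (i : ZMod k) :
    ∑ j ∈ Finset.univ.erase i, ((if i = j - 1 then 1 else 0) + if i = j + 1 then 1 else 0 : K) =
      2 := by
  have : Fact (1 < k) := ⟨hk⟩
  have h1 : ∀ j, (i = j - 1) ↔ (j = i + 1) := fun j =>
    ⟨fun h => by rw [h]; ring, fun h => by rw [h]; ring⟩
  have h2 : ∀ j, (i = j + 1) ↔ (j = i - 1) := fun j =>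
    ⟨fun h => by rw [h]; ring, fun h => by rw [h]; ring⟩
  simp only [h1, h2]
  rw [Finset.sum_add_distrib, Finset.sum_ite_eq', Finset.sum_ite_eq', if_pos (by simp),
    if_pos (by simp)]
  norm_num

/-- The contribution of two different colours, one of them not `0`, to the square of the sum of
all corners, over the diagrams with a constant colour vector. -/
theorem sum_cornerSum_mul [NeZero k] (hε : LinearIndependent ℤ ![ε₁, ε₂]) (hk : 2 ≤ k) (n : ℤ)
    {i j : ZMod k} (hi : i ≠ 0) (hij : i ≠ j) :
    ∑ Y ∈ diagrams k (fun _ => n), hookWeight k ε₁ ε₂ Y *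
        (cornerSum k ε₁ ε₂ (fun x => x) Y i * cornerSum k ε₁ ε₂ (fun x => x) Y j) =
      ((if i = j - 1 then 1 else 0) + if i = j + 1 then 1 else 0) *
        hookSum ε₁ ε₂ ((fun _ => n) - Pi.single i 1 : ZMod k → ℤ) := by
  have hs : slack ((fun _ => n) - Pi.single i 1 : ZMod k → ℤ) i = (2 : ℕ) := by
    rw [slack_sub_single hk, slack_const, if_neg hi]; rfl
  have h := sum_downRes hε _ i 2 hs (fun Y _ => cornerSum k ε₁ ε₂ (fun x => x) Y j)
  rw [sub_add_cancel] at h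
  have hl : ∀ Y ∈ diagrams k (fun _ => n), hookWeight k ε₁ ε₂ Y * ∑ x ∈ removableOf k Y i,
      downRes k ε₁ ε₂ Y i x * cornerSum k ε₁ ε₂ (fun x => x) Y j =
      -(hookWeight k ε₁ ε₂ Y *
        (cornerSum k ε₁ ε₂ (fun x => x) Y i * cornerSum k ε₁ ε₂ (fun x => x) Y j)) := by
    intro Y hY
    rw [← Finset.sum_mul, sum_downRes_first hε
      (by rw [card_corners_of_mem hY, slack_const, if_neg hi])]
    ring
  rw [Finset.sum_congr rfl hl, Finset.sum_neg_distrib] at h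
  have hr : ∀ Y ∈ diagrams k ((fun _ => n) - Pi.single i 1 : ZMod k → ℤ),
      hookWeight k ε₁ ε₂ Y * ∑ x ∈ addableOf k Y i, upRes k ε₁ ε₂ Y i x *
        cornerSum k ε₁ ε₂ (fun x => x) (addNodes Y {x}) j = 
      hookWeight k ε₁ ε₂ Y * ((if i = j - 1 then 1 else 0) + if i = j + 1 then 1 else 0) := by
    intro Y hY
    have hc : ((addableOf k Y i).card : ℤ) - (removableOf k Y i).card = 2 := by
      rw [card_corners_of_mem hY, hs]; rfl
    congr 1
    have hx : ∀ x ∈ addableOf k Y i, upRes k ε₁ ε₂ Y i x *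
        cornerSum k ε₁ ε₂ (fun x => x) (addNodes Y {x}) j =
        upRes k ε₁ ε₂ Y i x * cornerSum k ε₁ ε₂ (fun x => x) Y j +
        ((if i = j - 1 then 1 else 0) * ((ct ε₁ ε₂ x + ε₁) * upRes k ε₁ ε₂ Y i x) +
        (if i = j + 1 then 1 else 0) * ((ct ε₁ ε₂ x + ε₂) * upRes k ε₁ ε₂ Y i x)) := by
      intro x hx
      rw [cornerSum_addNodes hij hx]
      split_ifs <;> ring
    rw [Finset.sum_congr rfl hx, Finset.sum_add_distrib, Finset.sum_add_distrib,
      ← Finset.sum_mul, ← Finset.mul_sum, ← Finset.mul_sum, sum_upRes_zero hε hc.ge,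
      sum_upRes_insert hε hc, sum_upRes_insert hε hc]
    ring
  rw [Finset.sum_congr rfl hr, ← Finset.sum_mul] at h
  rw [hookSum]
  linear_combination -h

/-- For `i ≠ 0` the expression in the corner sums is a sum over the removals of a node of colour
`i` (`sum_downRes_insert`). Rewritten as a sum over additions to the diagrams of the smaller colour
vector, where there are two more addable than removable nodes, it collapses. -/
theorem sum_cornerSum_second [NeZero k] (hε : LinearIndependent ℤ ![ε₁, ε₂]) (hk : 2 ≤ k) (n : ℤ)
    {i : ZMod k} (hi : i ≠ 0) :
    ∑ Y ∈ diagrams k (fun _ => n), hookWeight k ε₁ ε₂ Y *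
        (cornerSum k ε₁ ε₂ (fun x => x) Y i ^ 2 - cornerSum k ε₁ ε₂ (fun x => x ^ 2) Y i) =
      -2 * hookSum ε₁ ε₂ ((fun _ => n) - Pi.single i 1 : ZMod k → ℤ) := by
  have hs : slack ((fun _ => n) - Pi.single i 1 : ZMod k → ℤ) i = (2 : ℕ) := by
    rw [slack_sub_single hk, slack_const, if_neg hi]; rfl
  have h := sum_downRes hε _ i 2 hs (fun _ x => ct ε₁ ε₂ x + (ε₁ + ε₂))
  rw [sub_add_cancel] at h
  have hr : ∀ Y ∈ diagrams k ((fun _ => n) - Pi.single i 1 : ZMod k → ℤ),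
      hookWeight k ε₁ ε₂ Y * ∑ x ∈ addableOf k Y i, upRes k ε₁ ε₂ Y i x *
        (ct ε₁ ε₂ x + (ε₁ + ε₂)) = hookWeight k ε₁ ε₂ Y := by
    intro Y hY
    simp only [mul_comm (upRes k ε₁ ε₂ Y i _)]
    rw [sum_upRes_insert hε (by rw [card_corners_of_mem hY, hs]; rfl), mul_one]
  rw [Finset.sum_congr rfl hr] at h
  rw [hookSum, Finset.sum_congr rfl fun Y hY => by
    rw [← sum_downRes_insert hε (by rw [card_corners_of_mem hY, slack_const, if_neg hi]),
      mul_left_comm], ← Finset.mul_sum, h]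
  ring

/-- For colour `0` the smaller colour vector has three more addable than removable nodes, so that
the sum over additions vanishes. -/
theorem sum_cornerSum_second_zero [NeZero k] (hε : LinearIndependent ℤ ![ε₁, ε₂]) (hk : 2 ≤ k)
    (n : ℤ) :
    ∑ Y ∈ diagrams k (fun _ => n), hookWeight k ε₁ ε₂ Y *
        (cornerSum k ε₁ ε₂ (fun x => x) Y 0 ^ 2 - cornerSum k ε₁ ε₂ (fun x => x ^ 2) Y 0) =
      0 := by
  have hs : slack ((fun _ => n) - Pi.single 0 1 : ZMod k → ℤ) 0 = (3 : ℕ) := by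
    rw [slack_sub_single hk, slack_const, if_pos rfl]; rfl
  have h := sum_downRes hε _ 0 3 hs (fun _ _ => 1)
  simp only [mul_one] at h
  rw [sub_add_cancel] at h
  rw [Finset.sum_congr rfl fun Y hY => by
    rw [← sum_downRes_second hε (by rw [card_corners_of_mem hY, slack_const, if_pos rfl]),
      mul_left_comm], ← Finset.mul_sum, h, Finset.sum_eq_zero, mul_zero, mul_zero]
  intro Y hY
  rw [sum_upRes_zero hε (by rw [card_corners_of_mem hY, hs]; norm_num), mul_zero]

/-- The recursion for the constant colour vectors. The sum of all `cornerSum`s of squares is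
`-2 ε₁ ε₂ |Y|`, while the sums of the single colours are given by interpolation. -/
theorem hookSum_const [NeZero k] (hε : LinearIndependent ℤ ![ε₁, ε₂]) (n : ℕ) (σ : K)
    (hσ : ∀ i : ZMod k, i ≠ 0 ∨ k = 1 →
      hookSum ε₁ ε₂ ((fun _ => (n : ℤ)) - Pi.single i 1 : ZMod k → ℤ) = σ) :
    2 * (k * n * ε₁ * ε₂ * hookSum ε₁ ε₂ (fun _ : ZMod k => (n : ℤ))) = 2 * σ := by
  have hcard : ∀ Y ∈ diagrams k (fun _ => (n : ℤ)), (Y.card : K) = k * n := by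
    intro Y hY
    have := card_of_mem_diagrams hY
    simp only [Finset.sum_const, Finset.card_univ, ZMod.card, nsmul_eq_mul] at this
    exact_mod_cast congrArg (Int.cast : ℤ → K) this
  have hsq : -(2 * (k * n * ε₁ * ε₂ * hookSum ε₁ ε₂ (fun _ : ZMod k => (n : ℤ)))) =
      ∑ Y ∈ diagrams k (fun _ => (n : ℤ)), hookWeight k ε₁ ε₂ Y *
        ∑ i, cornerSum k ε₁ ε₂ (fun x => x ^ 2) Y i := by
    rw [hookSum, Finset.mul_sum, Finset.mul_sum, ← Finset.sum_neg_distrib]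
    refine Finset.sum_congr rfl fun Y hY => ?_
    rw [sum_cornerSum_sq, hcard Y hY]; ring
  have hk0 : k ≠ 0 := NeZero.ne k
  by_cases hk1 : k = 1
  -- for `k = 1` the only `cornerSum` of degree one vanishes
  · subst hk1
    have huniv : ∀ f : ZMod 1 → K, ∑ i, f i = f 0 := fun f => Fintype.sum_unique f
    have hs : slack ((fun _ => (n : ℤ)) - Pi.single 0 1 : ZMod 1 → ℤ) 0 = (1 : ℕ) := by
      have : ∀ i : ZMod 1, i = 0 := fun i => Subsingleton.elim _ _
      simp only [slack, this (0 + 1), this (0 - 1), if_pos]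
      push_cast; ring
    have h := sum_downRes hε _ 0 1 hs (fun _ _ => 1)
    simp only [mul_one] at h
    rw [sub_add_cancel] at h
    have h1 : ∀ Y : YoungDiagram, cornerSum 1 ε₁ ε₂ (fun x => x) Y 0 = 0 := by
      intro Y
      rw [← huniv (cornerSum 1 ε₁ ε₂ (fun x => x) Y), sum_cornerSum_id]
    have hl : ∀ Y ∈ diagrams 1 (fun _ => (n : ℤ)), hookWeight 1 ε₁ ε₂ Y *
        ∑ i, cornerSum 1 ε₁ ε₂ (fun x => x ^ 2) Y i = -2 * (hookWeight 1 ε₁ ε₂ Y *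
        ∑ x ∈ removableOf 1 Y 0, downRes 1 ε₁ ε₂ Y 0 x) := by
      intro Y hY
      rw [huniv, mul_left_comm, neg_mul, sum_downRes_second hε, h1]
      · ring
      · rw [card_corners_of_mem hY, slack_const, if_pos rfl]
    rw [Finset.sum_congr rfl hl, ← Finset.mul_sum, h] at hsq
    have hr : ∀ Y ∈ diagrams 1 ((fun _ => (n : ℤ)) - Pi.single 0 1 : ZMod 1 → ℤ),
        hookWeight 1 ε₁ ε₂ Y * ∑ x ∈ addableOf 1 Y 0, upRes 1 ε₁ ε₂ Y 0 x =
        hookWeight 1 ε₁ ε₂ Y := by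
      intro Y hY
      rw [sum_upRes_one hε (by rw [card_corners_of_mem hY, hs]; rfl), mul_one]
    rw [Finset.sum_congr rfl hr] at hsq
    have hσ0 := hσ 0 (Or.inr rfl)
    rw [hookSum] at hσ0
    rw [hσ0] at hsq
    linear_combination -hsq
  · have hk : 2 ≤ k := by omega
    set I : (YoungDiagram → K) → K := fun f =>
      ∑ Y ∈ diagrams k (fun _ => (n : ℤ)), hookWeight k ε₁ ε₂ Y * f Y with hI
    set P := fun i Y => cornerSum k ε₁ ε₂ (fun x => x) Y i with hP
    set Q := fun i Y => cornerSum k ε₁ ε₂ (fun x => x ^ 2) Y i with hQ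
    have hmul : ∀ i j, i ≠ 0 → i ≠ j → I (fun Y => P i Y * P j Y) =
        ((if i = j - 1 then 1 else 0) + if i = j + 1 then 1 else 0) * σ := by
      intro i j hi hij
      rw [← hσ i (Or.inl hi), ← sum_cornerSum_mul hε hk n hi hij]
    have hsymm : ∀ i j, I (fun Y => P i Y * P j Y) = I (fun Y => P j Y * P i Y) := by
      intro i j; simp only [hI, mul_comm (P i _)]
    have hmul' : ∀ i j, i ≠ j → I (fun Y => P i Y * P j Y) =
        ((if i = j - 1 then 1 else 0) + if i = j + 1 then 1 else 0) * σ := by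
      intro i j hij
      by_cases hi : i = 0
      · rw [hsymm, hmul j i (fun h => hij (hi.trans h.symm)) hij.symm]
        congr 1
        rw [add_comm]
        have e1 : (j = i + 1) ↔ (i = j - 1) :=
          ⟨fun h => by rw [h]; ring, fun h => by rw [h]; ring⟩
        have e2 : (j = i - 1) ↔ (i = j + 1) :=
          ⟨fun h => by rw [h]; ring, fun h => by rw [h]; ring⟩
        simp only [e1, e2]
      · exact hmul i j hi hij
    -- the sum of all `P j` is zero, so the squares are minus the sums of the mixed products
    have hPP : ∀ i, I (fun Y => P i Y ^ 2) = -(2 * σ) := by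
      intro i
      have h0 : ∀ Y, P i Y ^ 2 = -∑ j ∈ Finset.univ.erase i, P i Y * P j Y := by
        intro Y
        have := sum_cornerSum_id (k := k) (ε₁ := ε₁) (ε₂ := ε₂) Y
        rw [← Finset.add_sum_erase _ _ (Finset.mem_univ i)] at this
        rw [← Finset.mul_sum]
        simp only [hP]
        linear_combination cornerSum k ε₁ ε₂ (fun x => x) Y i * this
      have h1 : I (fun Y => P i Y ^ 2) =
          -∑ j ∈ Finset.univ.erase i, I (fun Y => P i Y * P j Y) := by
        simp only [hI]
        rw [Finset.sum_comm, ← Finset.sum_neg_distrib]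
        refine Finset.sum_congr rfl fun Y _ => ?_
        rw [h0, mul_neg, Finset.mul_sum]
      rw [h1, Finset.sum_congr rfl fun j hj => hmul' i j (Finset.ne_of_mem_erase hj).symm,
        ← Finset.sum_mul, sum_adjacent hk]
    have hPQ : ∀ i, I (fun Y => P i Y ^ 2 - Q i Y) = if i = 0 then 0 else -2 * σ := by
      intro i
      split_ifs with hi
      · subst hi
        exact sum_cornerSum_second_zero hε hk n
      · rw [← hσ i (Or.inl hi)]
        exact sum_cornerSum_second hε hk n hi
    have hQi : ∀ i, I (Q i) = if i = 0 then -2 * σ else 0 := by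
      intro i
      have : I (fun Y => P i Y ^ 2 - Q i Y) = I (fun Y => P i Y ^ 2) - I (Q i) := by
        simp only [hI, mul_sub, Finset.sum_sub_distrib]
      rw [hPQ, hPP] at this
      split_ifs at this ⊢ <;> linear_combination this
    have hsq' : ∑ Y ∈ diagrams k (fun _ => (n : ℤ)), hookWeight k ε₁ ε₂ Y *
        ∑ i, cornerSum k ε₁ ε₂ (fun x => x ^ 2) Y i = ∑ i, I (Q i) := by
      simp only [hI, Finset.mul_sum]
      rw [Finset.sum_comm]
    rw [hsq', Finset.sum_congr rfl fun i _ => hQi i, Finset.sum_ite_eq', if_pos (Finset.mem_univ _)]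
      at hsq
    linear_combination -hsq

end Recursion

end

end ALE

namespace ALE

noncomputable section

/-! ### The closed form of the sums of hook products -/

section Closed

variable {k : ℕ}

/-- The quadratic form `∑ (v_i - v_{i+1})²` of the affine Dynkin diagram. -/
def affineForm [NeZero k] (v : ZMod k → ℤ) : ℤ := ∑ i, (v i - v (i + 1)) ^ 2

/-- Twice the energy `v₀ - ½ ∑ (v_i - v_{i+1})²` of a colour vector; this is the dimension
of the invariant Hilbert scheme. -/
def twiceEnergy [NeZero k] (v : ZMod k → ℤ) : ℤ := 2 * v 0 - affineForm v

theorem affineForm_add_single [NeZero k] (hk : 2 ≤ k) (v : ZMod k → ℤ) (i : ZMod k) (t : ℤ) :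
    affineForm (v + Pi.single i t) =
      affineForm v + 2 * t * (2 * v i - v (i + 1) - v (i - 1)) + 2 * t ^ 2 := by
  have : Fact (1 < k) := ⟨hk⟩
  have h1 : ∀ j, (v + Pi.single i t : ZMod k → ℤ) j - (v + Pi.single i t : ZMod k → ℤ) (j + 1) =
      (v j - v (j + 1)) + t * ((if j = i then 1 else 0) - if j = i - 1 then 1 else 0) := by
    intro j
    have e : (j + 1 = i) ↔ (j = i - 1) := eq_sub_iff_add_eq.symm
    simp only [Pi.add_apply, Pi.single_apply, e]
    split_ifs <;> ring
  have h2 : ∀ j,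
      ((v j - v (j + 1)) + t * ((if j = i then 1 else 0) - if j = i - 1 then 1 else 0)) ^ 2 =
      (v j - v (j + 1)) ^ 2 + (if j = i then 2 * t * (v j - v (j + 1)) + t ^ 2 else 0) +
        if j = i - 1 then -(2 * t * (v j - v (j + 1))) + t ^ 2 else 0 := by
    intro j
    by_cases hj : j = i
    · have hj' : ¬ j = i - 1 := by rw [hj]; simp [eq_sub_iff_add_eq]
      rw [if_pos hj, if_neg hj', if_pos hj, if_neg hj']; ring
    · rw [if_neg hj, if_neg hj]
      split_ifs <;> ring
  simp only [affineForm, h1, h2]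
  rw [Finset.sum_add_distrib, Finset.sum_add_distrib, Finset.sum_ite_eq', Finset.sum_ite_eq',
    if_pos (Finset.mem_univ _), if_pos (Finset.mem_univ _), sub_add_cancel]
  ring

/-- In particular the energy is invariant under the reflection `t = slack v i`. -/
theorem twiceEnergy_add_single [NeZero k] (hk : 2 ≤ k) (v : ZMod k → ℤ) (i : ZMod k) (t : ℤ) :
    twiceEnergy (v + Pi.single i t) = twiceEnergy v + 2 * t * (slack v i - t) := by
  rw [twiceEnergy, twiceEnergy, affineForm_add_single hk, slack, Pi.add_apply, Pi.single_apply]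
  simp only [eq_comm (a := (0 : ZMod k))]
  split_ifs <;> ring

theorem sum_zmod_eq_range {M : Type*} [AddCommMonoid M] [NeZero k] (f : ZMod k → M) :
    ∑ i, f i = ∑ j ∈ Finset.range k, f (j : ZMod k) := by
  refine Finset.sum_bij' (fun i _ => i.val) (fun j _ => (j : ZMod k)) ?_ ?_ ?_ ?_ ?_
  · intro i _; exact Finset.mem_range.mpr (ZMod.val_lt i)
  · intro j _; exact Finset.mem_univ _
  · intro i _; exact ZMod.natCast_zmod_val i
  · intro j hj; exact ZMod.val_natCast_of_lt (Finset.mem_range.mp hj)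
  · intro i _; rw [ZMod.natCast_zmod_val i]

/-- Both ways round the cycle from `0` to `i`, the increments add up to `v 0 - v i` up to sign,
and an integer is at most its square. -/
theorem two_mul_sub_le_affineForm [NeZero k] (v : ZMod k → ℤ) (i : ZMod k) :
    2 * (v 0 - v i) ≤ affineForm v := by
  set f : ℕ → ℤ := fun j => v (j : ZMod k) with hf
  have hi : f i.val = v i := by simp [hf]
  have h0 : f 0 = v 0 := by simp [hf]
  have hk : f k = v 0 := by simp [hf]
  have hlt := (ZMod.val_lt i).le
  have h1 : affineForm v = ∑ j ∈ Finset.range i.val, (f j - f (j + 1)) ^ 2 +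
      ∑ j ∈ Finset.Ico i.val k, (f j - f (j + 1)) ^ 2 := by
    rw [Finset.sum_range_add_sum_Ico _ hlt, affineForm, sum_zmod_eq_range]
    simp [hf]
  have h2 : v 0 - v i = ∑ j ∈ Finset.range i.val, (f j - f (j + 1)) := by
    rw [Finset.sum_range_sub', h0, hi]
  have h3 : v i - v 0 = ∑ j ∈ Finset.Ico i.val k, (f j - f (j + 1)) := by
    rw [Finset.sum_Ico_eq_sub _ hlt, Finset.sum_range_sub', Finset.sum_range_sub', hi, hk]; ring
  have h4 : v 0 - v i ≤ ∑ j ∈ Finset.range i.val, (f j - f (j + 1)) ^ 2 := by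
    rw [h2]; exact Finset.sum_le_sum fun j _ => Int.le_self_sq _
  have h5 : v 0 - v i ≤ ∑ j ∈ Finset.Ico i.val k, (f j - f (j + 1)) ^ 2 := by
    rw [← neg_sub, h3, ← Finset.sum_neg_distrib]
    exact Finset.sum_le_sum fun j _ => by
      rw [← neg_sq]; exact Int.le_self_sq _
  linarith

theorem nonneg_of_twiceEnergy_nonneg [NeZero k] {v : ZMod k → ℤ} (h : 0 ≤ twiceEnergy v)
    (i : ZMod k) : 0 ≤ v i := by
  have := two_mul_sub_le_affineForm v i
  rw [twiceEnergy] at h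
  linarith

/-- A colour vector without negative slack is constant: the slacks have sum `1`, and the sum of
`i * slack v i` is zero in `ℤ/k`, whence the node with slack `1` is the one of colour `0`. -/
theorem const_of_slack_nonneg [NeZero k] (v : ZMod k → ℤ) (h : ∀ i, 0 ≤ slack v i) (i : ZMod k) :
    v i = v 0 := by
  have shift1 : ∀ {M : Type} [AddCommMonoid M] (f : ZMod k → M), ∑ i, f (i + 1) = ∑ i, f i :=
    fun f => Equiv.sum_comp (Equiv.addRight (1 : ZMod k)) f
  have shift2 : ∀ {M : Type} [AddCommMonoid M] (f : ZMod k → M), ∑ i, f (i - 1) = ∑ i, f i :=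
    fun f => Equiv.sum_comp (Equiv.subRight (1 : ZMod k)) f
  have hsum : ∑ i, slack v i = 1 := by
    simp only [slack, Finset.sum_add_distrib, Finset.sum_sub_distrib]
    rw [shift1 v, shift2 v, ← Finset.mul_sum, Finset.sum_ite_eq', if_pos (Finset.mem_univ _)]
    ring
  obtain ⟨j, -, hj⟩ : ∃ j ∈ Finset.univ, slack v j ≠ 0 :=
    Finset.exists_ne_zero_of_sum_ne_zero (by rw [hsum]; exact one_ne_zero)
  have hj1 : slack v j = 1 ∧ ∀ i, i ≠ j → slack v i = 0 := by
    rw [← Finset.add_sum_erase _ _ (Finset.mem_univ j)] at hsum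
    have h0 : 0 ≤ ∑ i ∈ Finset.univ.erase j, slack v i := Finset.sum_nonneg fun i _ => h i
    have hj0 := h j
    have h2 : ∑ i ∈ Finset.univ.erase j, slack v i = 0 := by omega
    refine ⟨by omega, fun i hi => ?_⟩
    exact (Finset.sum_eq_zero_iff_of_nonneg fun i _ => h i).mp h2 i
      (Finset.mem_erase.mpr ⟨hi, Finset.mem_univ _⟩)
  have hslack : ∀ i, slack v i = if i = j then 1 else 0 := by
    intro i
    split_ifs with hi
    · rw [hi, hj1.1]
    · exact hj1.2 i hi
  have hj0 : j = 0 := by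
    have h1 : ∑ i : ZMod k, i * (slack v i : ZMod k) = j := by
      simp only [hslack]
      push_cast
      simp
    have h2 : ∑ i : ZMod k, i * (slack v i : ZMod k) = 0 := by
      have e : ∀ i : ZMod k, i * (slack v i : ZMod k) = (if i = 0 then i else 0) -
          2 * (i * (v i : ZMod k)) + ((i + 1) * (v (i + 1) : ZMod k) - (v (i + 1) : ZMod k)) +
          ((i - 1) * (v (i - 1) : ZMod k) + (v (i - 1) : ZMod k)) := by
        intro i
        simp only [slack]
        push_cast
        split_ifs <;> ring
      simp only [e, Finset.sum_add_distrib, Finset.sum_sub_distrib]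
      rw [shift1 (fun i => i * (v i : ZMod k)), shift2 (fun i => i * (v i : ZMod k)),
        shift1 (fun i => (v i : ZMod k)), shift2 (fun i => (v i : ZMod k)), ← Finset.mul_sum,
        Finset.sum_ite_eq', if_pos (Finset.mem_univ _)]
      ring
    rw [← h1, h2]
  subst hj0
  have hlap : ∀ i, v i * (v i - v (i + 1)) - v i * (v (i - 1) - v i) = 0 := by
    intro i
    have := hslack i
    rw [slack] at this
    linear_combination -(v i) * this
  have hQ : affineForm v = 0 := by
    have h1 : ∑ i, (v i * (v i - v (i + 1)) - v i * (v (i - 1) - v i)) = 0 :=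
      Finset.sum_eq_zero fun i _ => hlap i
    rw [Finset.sum_sub_distrib, ← shift1 (fun i => v i * (v (i - 1) - v i)),
      ← Finset.sum_sub_distrib] at h1
    rw [affineForm, ← h1]
    refine Finset.sum_congr rfl fun i _ => ?_
    rw [add_sub_cancel_right]; ring
  have h1 := two_mul_sub_le_affineForm v i
  have h2 := two_mul_sub_le_affineForm (-v) i
  have h3 : affineForm (-v) = affineForm v := by
    simp only [affineForm, Pi.neg_apply]
    exact Finset.sum_congr rfl fun i _ => by ring
  rw [h3, hQ] at h2
  rw [hQ] at h1
  simp only [Pi.neg_apply] at h2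
  omega

variable {K : Type*} [Field K] {ε₁ ε₂ : K}

theorem diagrams_zero [NeZero k] : diagrams k (fun _ => 0) = {⊥} := by
  ext Y
  rw [Finset.mem_singleton]
  constructor
  · intro h
    have := card_of_mem_diagrams h
    rw [Finset.sum_const_zero, Nat.cast_eq_zero, YoungDiagram.card, Finset.card_eq_zero] at this
    exact YoungDiagram.ext this
  · rintro rfl
    refine mem_diagrams.mpr fun i => ?_
    simp [colCount]

theorem ne_zero_of_linearIndependent (hε : LinearIndependent ℤ ![ε₁, ε₂]) : ε₁ ≠ 0 ∧ ε₂ ≠ 0 :=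
  ⟨hε.ne_zero 0, hε.ne_zero 1⟩

/-- The closed form of the sums of hook products. The energy is invariant under the reflections,
which reduce the claim to constant colour vectors, where the recursion applies. -/
theorem hookSum_eq [CharZero K] [NeZero k] (hε : LinearIndependent ℤ ![ε₁, ε₂])
    (v : ZMod k → ℤ) (n : ℤ) (hn : 2 * n = twiceEnergy v) :
    hookSum ε₁ ε₂ v = if 0 ≤ n then (1 / (k * ε₁ * ε₂)) ^ n.toNat / (n.toNat.factorial : K)
      else 0 := by
  obtain ⟨h1, h2⟩ := ne_zero_of_linearIndependent hε
  have hk0 : (k : K) ≠ 0 := Nat.cast_ne_zero.mpr (NeZero.ne k)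
  suffices H : ∀ (N : ℕ) (v : ZMod k → ℤ) (n : ℤ), ∑ i, v i < N → 2 * n = twiceEnergy v →
      hookSum ε₁ ε₂ v = if 0 ≤ n then (1 / (k * ε₁ * ε₂)) ^ n.toNat / (n.toNat.factorial : K)
        else 0 from H ((∑ i, v i).toNat + 1) v n (by omega) hn
  clear hn n v
  -- induction on the sum of the entries of the colour vector
  intro N
  induction N with
  | zero =>
    intro v n hv hn
    obtain ⟨i, -, hi⟩ : ∃ i ∈ Finset.univ, v i < 0 :=
      Finset.exists_lt_of_sum_lt (g := fun _ => 0) (by simpa using hv)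
    rw [hookSum, diagrams_eq_empty hi, Finset.sum_empty, if_neg]
    intro hn0
    have := nonneg_of_twiceEnergy_nonneg (v := v) (by omega) i
    omega
  | succ N ih =>
    intro v n hv hn
    by_cases hs : ∃ i, slack v i < 0
    -- a colour with negative slack can be reflected to lower the sum of the entries
    · obtain ⟨i, hi⟩ := hs
      have hk : 2 ≤ k := by
        by_contra hk
        have hk1 : k = 1 := by have := NeZero.ne k; omega
        subst hk1
        have : ∀ j : ZMod 1, j = 0 := fun j => Subsingleton.elim _ _
        rw [slack, this (i + 1), this (i - 1), this i, if_pos rfl] at hi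
        omega
      set v' : ZMod k → ℤ := v + Pi.single i (slack v i) with hv'
      have hslack : slack v' i = -slack v i := by
        have : Fact (1 < k) := ⟨hk⟩
        have e1 : (Pi.single (M := fun _ => ℤ) i (slack v i)) (i + 1) = 0 :=
          Pi.single_eq_of_ne (by simp) _
        have e2 : (Pi.single (M := fun _ => ℤ) i (slack v i)) (i - 1) = 0 :=
          Pi.single_eq_of_ne (by simp) _
        rw [hv', slack, Pi.add_apply, Pi.add_apply, Pi.add_apply, e1, e2, Pi.single_eq_same]
        simp only [slack]; ring
      have hc : slack v' i = ((-slack v i).toNat : ℤ) := by omega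
      have href := hookSum_reflect hε hk v' i _ hc
      rw [show v' + Pi.single i (((-slack v i).toNat : ℕ) : ℤ) = v by
        rw [hv', add_assoc, ← Pi.single_add, ← hc, hslack]; simp] at href
      rw [href]
      refine ih v' n ?_ ?_
      · rw [hv']
        simp only [Pi.add_apply, Finset.sum_add_distrib, Finset.sum_pi_single', Finset.mem_univ,
          if_true]
        push_cast at hv
        omega
      · rw [hn, hv', twiceEnergy_add_single hk]; ring
    -- otherwise the colour vector is constant
    · push Not at hs
      have hconst := const_of_slack_nonneg v hs
      obtain ⟨m, rfl⟩ : ∃ m : ℤ, v = fun _ => m := ⟨v 0, funext hconst⟩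
      have hnm : n = m := by
        rw [twiceEnergy, affineForm] at hn
        simp at hn; omega
      subst hnm
      by_cases hneg : n < 0
      · rw [hookSum, diagrams_eq_empty (i := 0) hneg, Finset.sum_empty, if_neg (by omega)]
      rw [if_pos (by omega)]
      obtain ⟨m, rfl⟩ := Int.eq_ofNat_of_zero_le (not_lt.mp hneg)
      rw [Int.toNat_natCast]
      rcases m with _ | m
      · rw [hookSum, Nat.cast_zero, diagrams_zero]
        simp [hookWeight]
      · have hσ : ∀ i : ZMod k, i ≠ 0 ∨ k = 1 →
            hookSum ε₁ ε₂ ((fun _ => ((m + 1 : ℕ) : ℤ)) - Pi.single i 1 : ZMod k → ℤ) =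
              (1 / (k * ε₁ * ε₂)) ^ m / (m.factorial : K) := by
          intro i hi
          rw [ih _ m]
          · rw [if_pos (by omega), Int.toNat_natCast]
          · simp only [Pi.sub_apply, Finset.sum_sub_distrib, Finset.sum_pi_single', Finset.mem_univ,
              if_true]
            push_cast at hv ⊢
            omega
          · by_cases hk : 2 ≤ k
            · rw [sub_eq_add_neg, ← Pi.single_neg, twiceEnergy_add_single hk, slack_const, if_neg
                (hi.resolve_right (by omega)), twiceEnergy, affineForm]
              simp; ring
            · have hk1 : k = 1 := by have := NeZero.ne k; omega
              subst hk1
              have : ∀ j : ZMod 1, j = i := fun j => Subsingleton.elim _ _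
              rw [twiceEnergy, affineForm]
              simp only [this, Pi.sub_apply, Pi.single_eq_same]
              simp
        have hrec := hookSum_const hε (m + 1) _ hσ
        have hm : ((m : K) + 1) ≠ 0 := by exact_mod_cast Nat.succ_ne_zero m
        have hf : (m.factorial : K) ≠ 0 := Nat.cast_ne_zero.mpr m.factorial_ne_zero
        have hrec' := mul_left_cancel₀ two_ne_zero hrec
        rw [Nat.factorial_succ]
        push_cast at hrec' ⊢
        rw [eq_div_iff (mul_ne_zero hm hf)]
        rw [eq_div_iff hf] at hrec'
        rw [pow_succ, ← hrec']
        field_simp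

end Closed

end

end ALE

namespace ALE

noncomputable section

/-! ### Cores -/

section Cores

variable {k : ℕ}

/-- The dimension of the `ℤ_k`-invariant part of a virtual representation. -/
def invDim (k : ℕ) : CharRing →+ ℤ :=
  (Finsupp.liftAddHom fun w : ℤ × ℤ =>
    if (k : ℤ) ∣ w.1 - w.2 then AddMonoidHom.id ℤ else 0).comp
    AddMonoidAlgebra.coeffAddEquiv.toAddMonoidHom

theorem invDim_lmon (w : ℤ × ℤ) : invDim k (lmon w) = if (k : ℤ) ∣ w.1 - w.2 then 1 else 0 := by
  have : AddMonoidAlgebra.coeffAddEquiv (lmon w) = Finsupp.single w (1 : ℤ) := rfl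
  simp only [invDim, AddMonoidHom.comp_apply, AddEquiv.toAddMonoidHom_eq_coe, AddMonoidHom.coe_coe,
    this, Finsupp.liftAddHom_apply_single]
  split_ifs <;> simp

theorem invDim_hookChar (Y : YoungDiagram) :
    invDim k (hookChar Y) = 2 * (Y.cells.filter fun s => k ∣ hook Y s).card := by
  rw [hookChar, map_sum, Finset.card_filter, Nat.cast_sum, Finset.mul_sum]
  refine Finset.sum_congr rfl fun s _ => ?_
  rw [map_add, invDim_lmon, invDim_lmon]
  have h1 : ((leg Y s : ℤ) + 1, -(arm Y s : ℤ)).1 - ((leg Y s : ℤ) + 1, -(arm Y s : ℤ)).2 =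
      (hook Y s : ℤ) := by simp [hook]; ring
  have h2 : (-(leg Y s : ℤ), (arm Y s : ℤ) + 1).1 - (-(leg Y s : ℤ), (arm Y s : ℤ) + 1).2 =
      -(hook Y s : ℤ) := by simp [hook]; ring
  simp only [h1, h2, dvd_neg, Int.natCast_dvd_natCast]
  split_ifs <;> simp

theorem sum_cells_colour [NeZero k] (Y : YoungDiagram) (g : ZMod k → ℤ) :
    ∑ b ∈ Y.cells, g (colour k b) = ∑ i, (colCount k Y i : ℤ) * g i := by
  rw [← Finset.sum_fiberwise Y.cells (colour k)]
  refine Finset.sum_congr rfl fun i _ => ?_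
  rw [Finset.sum_congr rfl fun b hb => by rw [(Finset.mem_filter.mp hb).2], Finset.sum_const,
    nsmul_eq_mul]
  rfl

/-- The number of nodes whose hook length is divisible by `k`. -/
theorem two_mul_card_hook [NeZero k] (Y : YoungDiagram) :
    2 * ((Y.cells.filter fun s => k ∣ hook Y s).card : ℤ) =
      twiceEnergy fun i => (colCount k Y i : ℤ) := by
  set v : ZMod k → ℤ := fun i => (colCount k Y i : ℤ) with hv
  have hcol : ∀ (b c : ℕ × ℕ) (d : ℤ × ℤ), invDim k (lmon (wt b - wt c + d)) =
      if colour k b + ((d.1 - d.2 : ℤ) : ZMod k) = colour k c then 1 else 0 := by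
    intro b c d
    rw [invDim_lmon]
    have : (k : ℤ) ∣ (wt b - wt c + d).1 - (wt b - wt c + d).2 ↔
        colour k b + ((d.1 - d.2 : ℤ) : ZMod k) = colour k c := by
      rw [← ZMod.intCast_zmod_eq_zero_iff_dvd, ← sub_eq_zero (a := colour k b + _)]
      simp only [colour, wt, Prod.fst_sub, Prod.snd_sub, Prod.fst_add, Prod.snd_add]
      push_cast
      constructor <;> intro h <;> rw [← h] <;> ring
    simp only [this]
  have hpair : ∀ d : ℤ × ℤ, invDim k (lmon d * (vchar Y.cells * vdual Y.cells)) =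
      ∑ i, v i * v (i + ((d.1 - d.2 : ℤ) : ZMod k)) := by
    intro d
    rw [vchar, vdual, Finset.sum_mul_sum, Finset.mul_sum, map_sum]
    have h1 : ∀ b ∈ Y.cells, invDim k (lmon d * ∑ c ∈ Y.cells, lmon (wt b) * lmon (-wt c)) =
        v (colour k b + ((d.1 - d.2 : ℤ) : ZMod k)) := by
      intro b _
      rw [Finset.mul_sum, map_sum, hv]
      simp only [colCount]
      rw [Finset.card_filter, Nat.cast_sum]
      refine Finset.sum_congr rfl fun c _ => ?_
      rw [← lmon_add, ← lmon_add, ← sub_eq_add_neg, add_comm, hcol]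
      simp only [eq_comm]
      split_ifs <;> simp
    rw [Finset.sum_congr rfl h1,
      sum_cells_colour Y (fun i => v (i + ((d.1 - d.2 : ℤ) : ZMod k)))]
  have hV : invDim k (lmon (1, 1) * vchar Y.cells) = v 0 := by
    rw [vchar, Finset.mul_sum, map_sum, hv]
    simp only [colCount]
    rw [Finset.card_filter, Nat.cast_sum]
    refine Finset.sum_congr rfl fun c _ => ?_
    have := hcol c (0, 0) (1, 1)
    rw [show wt c - wt (0, 0) + (1, 1) = (1, 1) + wt c by simp [wt, add_comm], lmon_add] at this
    rw [this, show colour k (0, 0) = 0 by simp [colour]]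
    by_cases h : colour k c = 0 <;> simp [h]
  have hW : invDim k (vdual Y.cells) = v 0 := by
    rw [vdual, map_sum, hv]
    simp only [colCount]
    rw [Finset.card_filter, Nat.cast_sum]
    refine Finset.sum_congr rfl fun c _ => ?_
    have := hcol (0, 0) c 0
    rw [show wt (0, 0) - wt c + 0 = - wt c by simp [wt]] at this
    rw [this, show colour k (0, 0) = 0 by simp [colour]]
    by_cases h : colour k c = 0 <;> simp [h, eq_comm]
  rw [← invDim_hookChar, hookChar_eq]
  have hexp : vdual Y.cells + lmon (1, 1) * vchar Y.cells -
      (1 - lmon (1, 0)) * (1 - lmon (0, 1)) * vchar Y.cells * vdual Y.cells =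
      vdual Y.cells + lmon (1, 1) * vchar Y.cells -
      (lmon 0 * (vchar Y.cells * vdual Y.cells) - lmon (1, 0) * (vchar Y.cells * vdual Y.cells) -
        lmon (0, 1) * (vchar Y.cells * vdual Y.cells) +
        lmon (1, 1) * (vchar Y.cells * vdual Y.cells)) := by
    have e3 : lmon (1, 1) = lmon (1, 0) * lmon (0, 1) := by rw [← lmon_add]; simp
    rw [e3, lmon_zero]; ring
  rw [hexp, map_sub, map_add, hV, hW, map_add, map_sub, map_sub, hpair, hpair, hpair, hpair,
    twiceEnergy, affineForm]
  have s1 : ∑ i, v i * v (i + -1) = ∑ i, v i * v (i + 1) := by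
    rw [← Equiv.sum_comp (Equiv.addRight (1 : ZMod k)) (fun i => v i * v (i + -1))]
    refine Finset.sum_congr rfl fun i _ => ?_
    simp [mul_comm]
  have s2 : ∑ i, v (i + 1) * v (i + 1) = ∑ i, v i * v i :=
    Equiv.sum_comp (Equiv.addRight (1 : ZMod k)) (fun i => v i * v i)
  have s3 : ∑ i, (v i - v (i + 1)) ^ 2 =
      ∑ i, v i * v i - 2 * ∑ i, v i * v (i + 1) + ∑ i, v (i + 1) * v (i + 1) := by
    rw [Finset.mul_sum, ← Finset.sum_sub_distrib, ← Finset.sum_add_distrib]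
    exact Finset.sum_congr rfl fun i _ => by ring
  rw [s3, s2]
  simp only [Prod.fst_zero, Prod.snd_zero, sub_zero, Int.cast_zero, add_zero, Int.cast_one,
    zero_sub, Int.cast_neg, sub_self]
  rw [s1]
  ring

/-- Every integer is of the form `r_i - i - 1` or `j - c_j` for the row lengths `r_i` and the
column lengths `c_j`: the steps of the boundary path of the diagram. -/
theorem boundary_step (Y : YoungDiagram) (z : ℤ) :
    (∃ i : ℕ, (Y.rowLen i : ℤ) - i - 1 = z) ∨ ∃ j : ℕ, (j : ℤ) - Y.colLen j = z := by
  have hex : ∃ i : ℕ, (Y.rowLen i : ℤ) - i - 1 ≤ z := by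
    refine ⟨((Y.rowLen 0 : ℤ) - z).toNat, ?_⟩
    have := Y.rowLen_anti 0 ((Y.rowLen 0 : ℤ) - z).toNat (Nat.zero_le _)
    omega
  classical
  have h1 := Nat.find_spec hex
  have h2 := fun m => @Nat.find_min _ _ hex m
  set i := Nat.find hex
  by_cases h : (Y.rowLen i : ℤ) - i - 1 = z
  · exact Or.inl ⟨i, h⟩
  right
  refine ⟨(z + i).toNat, ?_⟩
  have hj : ((z + i).toNat : ℤ) = z + i := Int.toNat_of_nonneg (by omega)
  have hcol : Y.colLen (z + i).toNat = i := by
    apply le_antisymm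
    · by_contra hlt
      rw [not_le, ← YoungDiagram.mem_iff_lt_colLen, YoungDiagram.mem_iff_lt_rowLen] at hlt
      omega
    · by_contra hlt
      have hi : 0 < i := by omega
      have := h2 (i - 1) (by omega)
      have hm : (i - 1, (z + i).toNat) ∉ Y := by
        rw [YoungDiagram.mem_iff_lt_colLen]; omega
      rw [YoungDiagram.mem_iff_lt_rowLen] at hm
      omega
  rw [hcol, hj]; ring

theorem hook_eq {Y : YoungDiagram} {i j : ℕ} (h : (i, j) ∈ Y.cells) :
    (hook Y (i, j) : ℤ) = ((Y.rowLen i : ℤ) - i - 1) - (j - Y.colLen j) := by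
  have h1 : j < Y.rowLen i := YoungDiagram.mem_iff_lt_rowLen.mp h
  have h2 : i < Y.colLen j := YoungDiagram.mem_iff_lt_colLen.mp h
  simp only [hook, arm, leg]
  omega

/-- Walk along the boundary of `Y`, whose steps are numbered by the integers. The hook length is the
distance between the boundary steps at the ends of the arm and of the leg. The step `k` away from
the end of the arm ends another arm, giving a hook of length `k m` in the column of the node, or another
leg, giving a hook of length `k` in its row. -/
theorem exists_hook_eq (Y : YoungDiagram) (hk : 1 ≤ k) (m : ℕ) :
    ∀ i j, (i, j) ∈ Y.cells → hook Y (i, j) = k * (m + 1) → ∃ s ∈ Y.cells, hook Y s = k := by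
  induction m with
  | zero => exact fun i j h hh => ⟨(i, j), h, by simpa using hh⟩
  | succ m ih =>
    intro i j h hh
    have h1 := hook_eq h
    have hkm : (0 : ℤ) < k * (m + 1) := by positivity
    rw [hh] at h1
    push_cast at h1
    have hmem : ∀ i' j' : ℕ, (j' : ℤ) - Y.colLen j' < (Y.rowLen i' : ℤ) - i' - 1 →
        (i', j') ∈ Y.cells := by
      intro i' j' hlt
      by_contra hn
      have g1 : ¬ j' < Y.rowLen i' := fun h => hn (YoungDiagram.mem_iff_lt_rowLen.mpr h)
      have g2 : ¬ i' < Y.colLen j' := fun h => hn (YoungDiagram.mem_iff_lt_colLen.mpr h)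
      omega
    rcases boundary_step Y ((Y.rowLen i : ℤ) - i - 1 - k) with ⟨i', hi'⟩ | ⟨j', hj'⟩
    · have hlt : (j : ℤ) - Y.colLen j < (Y.rowLen i' : ℤ) - i' - 1 := by linarith
      refine ih i' j (hmem i' j hlt) ?_
      have := hook_eq (hmem i' j hlt)
      zify
      linarith
    · have hlt : (j' : ℤ) - Y.colLen j' < (Y.rowLen i : ℤ) - i - 1 := by
        have : (1 : ℤ) ≤ k := by exact_mod_cast hk
        linarith
      refine ⟨(i, j'), hmem i j' hlt, ?_⟩
      have := hook_eq (hmem i j' hlt)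
      omega

/-- The `k`-cores are the diagrams of energy zero. -/
theorem isCore_iff [NeZero k] (Y : YoungDiagram) :
    IsCore k Y ↔ twiceEnergy (fun i => (colCount k Y i : ℤ)) = 0 := by
  have hk : 1 ≤ k := Nat.one_le_iff_ne_zero.mpr (NeZero.ne k)
  rw [← two_mul_card_hook, mul_eq_zero, or_iff_right two_ne_zero, Nat.cast_eq_zero,
    Finset.card_eq_zero, Finset.filter_eq_empty_iff]
  constructor
  · rintro h ⟨i, j⟩ hs ⟨m, hm⟩
    rcases m with _ | m
    · simp [hook] at hm
    · obtain ⟨s', h1, h2⟩ := exists_hook_eq Y hk m i j hs hm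
      exact h s' h1 h2
  · intro h s hs hh
    exact h hs (hh ▸ dvd_rfl)

/-- A colour vector indexed by `ℤ/k` instead of `{0, …, k-1}`, with integer entries. -/
def toZ [NeZero k] (v : Fin k → ℕ) (i : ZMod k) : ℤ := v ⟨i.val, ZMod.val_lt i⟩

theorem toZ_natCast [NeZero k] (v : Fin k → ℕ) (i : Fin k) :
    toZ v ((i : ℕ) : ZMod k) = v i := by
  simp only [toZ, ZMod.val_natCast_of_lt i.2]

theorem colourCount_eq (Y : YoungDiagram) (i : Fin k) :
    colourCount k Y i = colCount k Y ((i : ℕ) : ZMod k) := by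
  rw [colourCount, colCount]
  congr 1
  refine Finset.filter_congr fun s _ => ?_
  rw [← ZMod.intCast_eq_intCast_iff, colour]
  push_cast
  rfl

theorem colCount_eq_toZ [NeZero k] (Y : YoungDiagram) (i : ZMod k) :
    (colCount k Y i : ℤ) = toZ (colourCount k Y) i := by
  rw [toZ, colourCount_eq, ZMod.natCast_zmod_val]

theorem toZ_injective [NeZero k] : Function.Injective (toZ : (Fin k → ℕ) → ZMod k → ℤ) := by
  intro v w h
  funext i
  have := congrFun h ((i : ℕ) : ZMod k)
  rw [toZ_natCast, toZ_natCast] at this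
  exact_mod_cast this

theorem colourCount_eq_iff [NeZero k] (Y : YoungDiagram) (v : Fin k → ℕ) :
    colourCount k Y = v ↔ Y ∈ diagrams k (toZ v) := by
  simp only [mem_diagrams, colCount_eq_toZ]
  rw [← funext_iff, toZ_injective.eq_iff]

theorem setOf_colourCount_eq [NeZero k] (v : Fin k → ℕ) :
    {Y : YoungDiagram | colourCount k Y = v} = diagrams k (toZ v) := by
  ext Y
  exact colourCount_eq_iff Y v

theorem youngSum_eq_hookSum {K : Type*} [Field K] (ε₁ ε₂ : K) [NeZero k] (v : Fin k → ℕ) :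
    youngSum k ε₁ ε₂ v = hookSum ε₁ ε₂ (toZ v) := by
  rw [youngSum, setOf_colourCount_eq, finsum_mem_coe_finset, hookSum]

theorem sum_toZ [NeZero k] (v : Fin k → ℕ) : ∑ i, toZ v i = ∑ i, (v i : ℤ) := by
  rw [sum_zmod_eq_range, ← Fin.sum_univ_eq_sum_range (fun j => toZ v (j : ZMod k))]
  exact Finset.sum_congr rfl fun i _ => toZ_natCast v i

end Cores

end

end ALE

namespace ALE

noncomputable section

/-! ### Torus fixed ideals of the plane -/

section Monomials

/-- Exponent vectors of monomials in two variables, as pairs. -/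
def expEquiv : (Fin 2 →₀ ℕ) ≃ ℕ × ℕ := Finsupp.equivFunOnFinite.trans (finTwoArrowEquiv ℕ)

/-- The monomials as a basis of the polynomial ring, indexed by pairs. -/
def monBasis : Module.Basis (ℕ × ℕ) ℂ PlaneRing :=
  (MvPolynomial.basisMonomials (Fin 2) ℂ).reindex expEquiv

/-- The monomial `x ^ a * y ^ b` for `p = (a, b)`. -/
def mon (p : ℕ × ℕ) : PlaneRing := monBasis p

/-- The coefficient of the monomial `mon p`. -/
def cf (p : ℕ × ℕ) : PlaneRing →ₗ[ℂ] ℂ := monBasis.coord p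

theorem mon_eq (p : ℕ × ℕ) : mon p = MvPolynomial.X 0 ^ p.1 * MvPolynomial.X 1 ^ p.2 := by
  have h : mon p = MvPolynomial.monomial (expEquiv.symm p) 1 := by
    simp [mon, monBasis]
  rw [h, MvPolynomial.monomial_eq]
  simp [Finsupp.prod_fintype, expEquiv, Fin.prod_univ_two]

theorem mon_add (p q : ℕ × ℕ) : mon (p + q) = mon p * mon q := by
  simp only [mon_eq, Prod.fst_add, Prod.snd_add]
  ring

theorem cf_mon (p q : ℕ × ℕ) : cf p (mon q) = if q = p then 1 else 0 := by
  rw [cf, mon, Module.Basis.coord_apply, Module.Basis.repr_self, Finsupp.single_apply]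

theorem ext_cf {f g : PlaneRing} (h : ∀ p, cf p f = cf p g) : f = g :=
  monBasis.ext_elem h

theorem ext_mon {M : Type*} [AddCommMonoid M] [Module ℂ M] {F G : PlaneRing →ₗ[ℂ] M}
    (h : ∀ p, F (mon p) = G (mon p)) : F = G :=
  monBasis.ext h

theorem sum_cf_mon (f : PlaneRing) : ∃ s : Finset (ℕ × ℕ),
    (∀ p ∈ s, cf p f ≠ 0) ∧ f = ∑ p ∈ s, cf p f • mon p := by
  refine ⟨(monBasis.repr f).support, fun p hp => by
    rwa [Finsupp.mem_support_iff] at hp, ?_⟩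
  exact (monBasis.linearCombination_repr f).symm

end Monomials

section Torus

variable {α β : ℤ × ℤ}

/-- The torus weight `z₁ α + z₂ β` of the Laurent monomial with exponents `z`. -/
def latWt (α β : ℤ × ℤ) : ℤ × ℤ →+ ℤ × ℤ where
  toFun z := z.1 • α + z.2 • β
  map_zero' := by simp
  map_add' := by intro x y; simp [add_smul]; abel

theorem latWt_apply (z : ℤ × ℤ) : latWt α β z = z.1 • α + z.2 • β := rfl

theorem latWt_injective (hdet : α.1 * β.2 - α.2 * β.1 ≠ 0) :
    Function.Injective (latWt α β) := by
  rw [injective_iff_map_eq_zero]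
  rintro ⟨a, b⟩ h
  have h1 : a * α.1 + b * β.1 = 0 := by simpa [latWt_apply] using congrArg Prod.fst h
  have h2 : a * α.2 + b * β.2 = 0 := by simpa [latWt_apply] using congrArg Prod.snd h
  have ha : a * (α.1 * β.2 - α.2 * β.1) = 0 := by linear_combination β.2 * h1 - β.1 * h2
  have hb : b * (α.1 * β.2 - α.2 * β.1) = 0 := by linear_combination α.1 * h2 - α.2 * h1
  simp only [Prod.mk_eq_zero]
  exact ⟨(mul_eq_zero.mp ha).resolve_right hdet, (mul_eq_zero.mp hb).resolve_right hdet⟩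

/-- The value of a character, as a complex number. -/
def charVal (w : ℤ × ℤ) (t : Torus) : ℂ := ((torusChar w t : ℂˣ) : ℂ)

theorem charVal_ne_zero (w : ℤ × ℤ) (t : Torus) : charVal w t ≠ 0 := Units.ne_zero _

theorem charVal_add (w w' : ℤ × ℤ) (t : Torus) :
    charVal (w + w') t = charVal w t * charVal w' t := by
  rw [charVal, charVal, charVal, ← Units.val_mul]
  congr 1
  simp only [torusChar, Prod.fst_add, Prod.snd_add, zpow_add]
  exact mul_mul_mul_comm _ _ _ _

theorem charVal_zero (t : Torus) : charVal 0 t = 1 := by simp [charVal, torusChar]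

theorem charVal_nsmul (n : ℕ) (w : ℤ × ℤ) (t : Torus) :
    charVal (n • w) t = charVal w t ^ n := by
  induction n with
  | zero => simp [charVal_zero]
  | succ n ih => rw [succ_nsmul, charVal_add, ih, pow_succ]

/-- A torus element on which different characters take different values. -/
def genericElt : Torus := (Units.mk0 2 two_ne_zero, Units.mk0 3 three_ne_zero)

theorem charVal_genericElt_injective : Function.Injective fun w => charVal w genericElt := by
  have key : ∀ w : ℤ × ℤ, charVal w genericElt = 1 → w = 0 := by
    rintro ⟨a, b⟩ h
    have h' : (2 : ℂ) ^ a * 3 ^ b = 1 := by simpa [charVal, torusChar, genericElt] using h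
    have hq : (2 : ℚ) ^ a * 3 ^ b = 1 := by
      have : (((2 : ℚ) ^ a * 3 ^ b : ℚ) : ℂ) = ((1 : ℚ) : ℂ) := by push_cast; exact h'
      exact Rat.cast_injective this
    have p2 : padicValRat 2 (3 : ℚ) = 0 := by
      have : padicValRat 2 ((3 : ℕ) : ℚ) = 0 := by
        rw [padicValRat.of_nat, padicValNat.eq_zero_of_not_dvd (by norm_num)]; rfl
      exact_mod_cast this
    have p3 : padicValRat 3 (2 : ℚ) = 0 := by
      have : padicValRat 3 ((2 : ℕ) : ℚ) = 0 := by
        rw [padicValRat.of_nat, padicValNat.eq_zero_of_not_dvd (by norm_num)]; rfl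
      exact_mod_cast this
    have s2 : padicValRat 2 (2 : ℚ) = 1 := by
      simpa using padicValRat.self (p := 2) (by norm_num)
    have s3 : padicValRat 3 (3 : ℚ) = 1 := by
      simpa using padicValRat.self (p := 3) (by norm_num)
    have e2 := congrArg (padicValRat 2) hq
    have e3 := congrArg (padicValRat 3) hq
    rw [padicValRat.mul (zpow_ne_zero _ (by norm_num)) (zpow_ne_zero _ (by norm_num)),
      padicValRat.zpow, padicValRat.zpow, padicValRat.one] at e2 e3
    rw [s2, p2] at e2
    rw [s3, p3] at e3
    simp only [Prod.mk_eq_zero]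
    constructor <;> linarith
  intro w w' h
  have h1 : charVal (w - w') genericElt = 1 := by
    have := charVal_add (w - w') w' genericElt
    rw [sub_add_cancel] at this
    refine mul_right_cancel₀ (charVal_ne_zero w' genericElt) ?_
    rw [← this, one_mul]
    exact h
  exact sub_eq_zero.mp (key _ h1)

theorem torusSubst_mon (t : Torus) (p : ℕ × ℕ) :
    torusSubst α β t (mon p) = charVal (latWt α β (wt p)) t • mon p := by
  have hw : latWt α β (wt p) = p.1 • α + p.2 • β := by simp [latWt_apply, wt]
  rw [hw, charVal_add, charVal_nsmul, charVal_nsmul, mon_eq, torusSubst, map_mul, map_pow, map_pow,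
    MvPolynomial.aeval_X, MvPolynomial.aeval_X, MvPolynomial.smul_eq_C_mul]
  simp only [Matrix.cons_val_zero, Matrix.cons_val_one, mul_pow, map_mul, map_pow, charVal]
  ring

theorem cf_torusSubst (t : Torus) (p : ℕ × ℕ) (f : PlaneRing) :
    cf p (torusSubst α β t f) = charVal (latWt α β (wt p)) t * cf p f := by
  have : (cf p).comp (torusSubst α β t).toLinearMap =
      charVal (latWt α β (wt p)) t • cf p := by
    refine ext_mon fun q => ?_
    simp only [LinearMap.comp_apply, AlgHom.toLinearMap_apply, torusSubst_mon, map_smul, cf_mon,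
      LinearMap.smul_apply, smul_eq_mul]
    split_ifs with h
    · rw [h]
    · simp
  exact LinearMap.congr_fun this f

/-- A torus fixed ideal contains the monomials of its elements, since these are separated by the
eigenvalues of a generic torus element. -/
theorem FixedIdeal.mon_mem (hdet : α.1 * β.2 - α.2 * β.1 ≠ 0) (I : FixedIdeal α β)
    {f : PlaneRing} (hf : f ∈ I.ideal) {p : ℕ × ℕ} (hp : cf p f ≠ 0) : mon p ∈ I.ideal := by
  set c : ℕ × ℕ → ℂ := fun p => charVal (latWt α β (wt p)) genericElt with hc
  have hinj : Function.Injective c :=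
    charVal_genericElt_injective.comp ((latWt_injective hdet).comp wt_injective)
  have key : ∀ s : Finset (ℕ × ℕ), ∃ g ∈ I.ideal,
      ∀ q, cf q g = (∏ r ∈ s, (c q - c r)) * cf q f := by
    intro s
    induction s using Finset.induction_on with
    | empty => exact ⟨f, hf, fun q => by simp⟩
    | insert r s hr ih =>
      obtain ⟨g, hg, hq⟩ := ih
      refine ⟨torusSubst α β genericElt g - c r • g,
        I.ideal.sub_mem (I.fixed _ g hg) (Submodule.smul_of_tower_mem I.ideal (c r) hg), ?_⟩
      intro q
      rw [map_sub, map_smul, cf_torusSubst, hq, Finset.prod_insert hr, smul_eq_mul]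
      ring
  obtain ⟨s, hs, hsum⟩ := sum_cf_mon f
  have hsupp : ∀ q, cf q f ≠ 0 → q ∈ s := by
    intro q hq
    by_contra hn
    apply hq
    rw [hsum, map_sum]
    refine Finset.sum_eq_zero fun r hr => ?_
    rw [map_smul, cf_mon, if_neg, smul_zero]
    rintro rfl
    exact hn hr
  obtain ⟨g, hg, hq⟩ := key (s.erase p)
  set d := (∏ r ∈ s.erase p, (c p - c r)) * cf p f with hd
  have hd0 : d ≠ 0 := by
    refine mul_ne_zero (Finset.prod_ne_zero_iff.mpr fun r hr => ?_) hp
    exact sub_ne_zero.mpr fun h => (Finset.ne_of_mem_erase hr) (hinj h).symm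
  have hgd : g = d • mon p := by
    refine ext_cf fun q => ?_
    rw [map_smul, cf_mon, hq]
    split_ifs with h
    · rw [← h, hd, smul_eq_mul, mul_one]
    · rw [smul_zero]
      by_cases hqf : cf q f = 0
      · rw [hqf, mul_zero]
      · rw [Finset.prod_eq_zero (Finset.mem_erase.mpr ⟨Ne.symm h, hsupp q hqf⟩) (sub_self _),
          zero_mul]
  have : mon p = d⁻¹ • g := by rw [hgd, smul_smul, inv_mul_cancel₀ hd0, one_smul]
  rw [this]
  exact Submodule.smul_of_tower_mem I.ideal _ hg

theorem mem_youngIdeal {Y : YoungDiagram} {f : PlaneRing} :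
    f ∈ youngIdeal Y ↔ ∀ p ∈ Y.cells, cf p f = 0 := by
  constructor
  · intro hf p hp
    have hset : {f | ∃ a b : ℕ, (a, b) ∉ Y.cells ∧
        f = (MvPolynomial.X 0 ^ a * MvPolynomial.X 1 ^ b : PlaneRing)} =
        (fun s => MvPolynomial.monomial s (1 : ℂ)) '' (expEquiv.symm '' {q | q ∉ Y.cells}) := by
      ext g
      have hmon : ∀ q, mon q = MvPolynomial.monomial (expEquiv.symm q) 1 := fun q => by
        simp [mon, monBasis]
      constructor
      · rintro ⟨a, b, hab, rfl⟩
        exact ⟨_, ⟨(a, b), hab, rfl⟩, (hmon (a, b)).symm.trans (mon_eq (a, b))⟩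
      · rintro ⟨_, ⟨q, hq, rfl⟩, rfl⟩
        exact ⟨q.1, q.2, hq, by rw [← mon_eq, hmon]⟩
    rw [youngIdeal, hset, MvPolynomial.mem_ideal_span_monomial_image] at hf
    by_contra h
    have hcf : cf p f = MvPolynomial.coeff (expEquiv.symm p) f := by
      simp only [cf, monBasis, Module.Basis.coord_apply, Module.Basis.repr_reindex_apply]
      rfl
    rw [hcf] at h
    obtain ⟨_, ⟨q, hq, rfl⟩, hle⟩ := hf _ (MvPolynomial.mem_support_iff.mpr h)
    refine hq (Y.isLowerSet ?_ hp)
    refine ⟨?_, ?_⟩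
    · simpa [expEquiv] using hle 0
    · simpa [expEquiv] using hle 1
  · intro h
    obtain ⟨s, hs, hsum⟩ := sum_cf_mon f
    rw [hsum]
    refine Submodule.sum_mem _ fun p hp => Submodule.smul_of_tower_mem _ _ ?_
    refine Ideal.subset_span ⟨p.1, p.2, fun hY => hs p hp (h p hY), mon_eq p⟩

theorem mon_mem_youngIdeal {Y : YoungDiagram} {p : ℕ × ℕ} :
    mon p ∈ youngIdeal Y ↔ p ∉ Y.cells := by
  rw [mem_youngIdeal]
  constructor
  · intro h hp
    simpa [cf_mon] using h p hp
  · intro h q hq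
    rw [cf_mon, if_neg]
    rintro rfl
    exact h hq

theorem youngIdeal_injective : Function.Injective youngIdeal := by
  intro Y Y' h
  apply YoungDiagram.ext
  ext p
  rw [← not_iff_not, ← mon_mem_youngIdeal, ← mon_mem_youngIdeal, h]

/-- The monomials of the nodes of a diagram form a basis of the quotient by its ideal. -/
def quotBasis (Y : YoungDiagram) :
    Module.Basis {p // p ∈ Y.cells} ℂ (PlaneRing ⧸ youngIdeal Y) :=
  Module.Basis.mk (v := fun p => Ideal.Quotient.mkₐ ℂ (youngIdeal Y) (mon p.1))
    (by
      rw [Fintype.linearIndependent_iff]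
      intro c hc p
      simp only [← map_smul] at hc
      rw [← map_sum, Ideal.Quotient.mkₐ_eq_mk, Ideal.Quotient.eq_zero_iff_mem, mem_youngIdeal] at hc
      have := hc p.1 p.2
      rw [map_sum, Finset.sum_eq_single p] at this
      · simpa [cf_mon] using this
      · intro q _ hqp
        rw [map_smul, cf_mon, if_neg (fun h => hqp (Subtype.ext h)), smul_zero]
      · simp)
    (by
      rintro x -
      obtain ⟨f, rfl⟩ := Ideal.Quotient.mkₐ_surjective ℂ (youngIdeal Y) x
      obtain ⟨s, hs, hsum⟩ := sum_cf_mon f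
      rw [hsum, map_sum]
      refine Submodule.sum_mem _ fun p _ => ?_
      rw [map_smul]
      refine Submodule.smul_mem _ _ ?_
      by_cases hp : p ∈ Y.cells
      · exact Submodule.subset_span ⟨⟨p, hp⟩, rfl⟩
      · have : Ideal.Quotient.mkₐ ℂ (youngIdeal Y) (mon p) = 0 := by
          rw [Ideal.Quotient.mkₐ_eq_mk, Ideal.Quotient.eq_zero_iff_mem]
          exact mon_mem_youngIdeal.mpr hp
        rw [this]
        exact Submodule.zero_mem _)

theorem quotBasis_apply (Y : YoungDiagram) (p : {p // p ∈ Y.cells}) :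
    quotBasis Y p = Ideal.Quotient.mkₐ ℂ (youngIdeal Y) (mon p.1) := by
  simp [quotBasis]

/-- The monomial ideal of a Young diagram as a torus fixed ideal. -/
abbrev youngFixed (α β : ℤ × ℤ) (Y : YoungDiagram) : FixedIdeal α β where
  ideal := youngIdeal Y
  finite := Module.Finite.of_basis (quotBasis Y)
  fixed := by
    intro t f hf
    rw [mem_youngIdeal] at hf ⊢
    intro p hp
    rw [cf_torusSubst, hf p hp, mul_zero]

theorem FixedIdeal.ideal_injective :
    Function.Injective (FixedIdeal.ideal : FixedIdeal α β → Ideal PlaneRing) := by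
  rintro ⟨I, _, _⟩ ⟨J, _, _⟩ h
  cases h
  rfl

/-- Every torus fixed ideal is the monomial ideal of a Young diagram. -/
theorem youngFixed_bijective (hdet : α.1 * β.2 - α.2 * β.1 ≠ 0) :
    Function.Bijective (youngFixed α β) := by
  refine ⟨fun Y Y' h => youngIdeal_injective (congrArg FixedIdeal.ideal h), fun I => ?_⟩
  have hli : LinearIndependent ℂ fun p : {p : ℕ × ℕ // mon p ∉ I.ideal} =>
      Ideal.Quotient.mkₐ ℂ I.ideal (mon p.1) := by
    rw [linearIndependent_iff']
    intro s c hc p hp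
    simp only [← map_smul] at hc
    rw [← map_sum, Ideal.Quotient.mkₐ_eq_mk, Ideal.Quotient.eq_zero_iff_mem] at hc
    by_contra hcp
    refine p.2 (I.mon_mem hdet hc ?_)
    rw [map_sum, Finset.sum_eq_single p]
    · simpa [cf_mon] using hcp
    · intro q _ hqp
      rw [map_smul, cf_mon, if_neg (fun h => hqp (Subtype.ext h)), smul_zero]
    · exact fun h => absurd hp h
  have := I.finite
  have hfin : {p : ℕ × ℕ | mon p ∉ I.ideal}.Finite := Set.finite_coe_iff.mp hli.finite
  let Y : YoungDiagram :=
    { cells := hfin.toFinset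
      isLowerSet := by
        intro p q hqp hp
        simp only [Set.Finite.coe_toFinset, Set.mem_ofPred_eq] at hp ⊢
        intro hq
        apply hp
        have : p = q + (p - q) := (add_tsub_cancel_of_le hqp).symm
        rw [this, mon_add]
        exact Ideal.mul_mem_right _ _ hq }
  refine ⟨Y, FixedIdeal.ideal_injective (Ideal.ext fun f => ?_)⟩
  change f ∈ youngIdeal Y ↔ _
  rw [mem_youngIdeal]
  have hY : ∀ p, p ∈ Y.cells ↔ mon p ∉ I.ideal := fun p => by simp [Y]
  constructor
  · intro h
    obtain ⟨s, hs, hsum⟩ := sum_cf_mon f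
    rw [hsum]
    refine Submodule.sum_mem _ fun p hp => Submodule.smul_of_tower_mem _ _ ?_
    by_contra hn
    exact hs p hp (h p ((hY p).mpr hn))
  · intro hf p hp
    by_contra hn
    exact (hY p).mp hp (I.mon_mem hdet hf hn)

theorem colength_youngFixed (Y : YoungDiagram) : (youngFixed α β Y).colength = Y.card := by
  rw [FixedIdeal.colength]
  change Module.finrank ℂ (PlaneRing ⧸ youngIdeal Y) = _
  rw [Module.finrank_eq_card_basis (quotBasis Y), Fintype.card_coe]

end Torus

end

end ALE

namespace ALE

noncomputable section

/-! ### Weight spaces of the tangent space, combinatorially -/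

section TangentCombinatorics

/-- Whether a point of the lattice lies in the diagram. -/
def MemZ (Y : YoungDiagram) (z : ℤ × ℤ) : Prop :=
  0 ≤ z.1 ∧ 0 ≤ z.2 ∧ z.2 < Y.rowLen z.1.toNat

theorem memZ_iff {Y : YoungDiagram} {z : ℤ × ℤ} :
    MemZ Y z ↔ ∃ q ∈ Y.cells, wt q = z := by
  constructor
  · rintro ⟨h1, h2, h3⟩
    refine ⟨(z.1.toNat, z.2.toNat), ?_, ?_⟩
    · refine YoungDiagram.mem_iff_lt_rowLen.mpr ?_
      omega
    · ext <;> simp [wt, h1, h2]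
  · rintro ⟨q, hq, rfl⟩
    have : q.2 < Y.rowLen q.1 := YoungDiagram.mem_iff_lt_rowLen.mp hq
    simp only [MemZ, wt]
    refine ⟨by positivity, by positivity, ?_⟩
    simpa using this

/-- Homomorphisms from the ideal of the diagram `Y` to its quotient which shift the degree of
monomials by `-w`: the homomorphism sends `mon p` to `c p` times the monomial with exponent
`p - w`. -/
def shiftHom (Y : YoungDiagram) (w : ℤ × ℤ) : Submodule ℂ (ℕ × ℕ → ℂ) where
  carrier := {c | (∀ p, c p ≠ 0 → p ∉ Y.cells ∧ MemZ Y (wt p - w)) ∧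
    ∀ p e, (e = (1, 0) ∨ e = (0, 1)) → p ∉ Y.cells → MemZ Y (wt (p + e) - w) → c (p + e) = c p}
  zero_mem' := ⟨fun p h => absurd rfl h, fun p e _ _ _ => rfl⟩
  add_mem' := by
    rintro c d ⟨h1, h2⟩ ⟨h3, h4⟩
    refine ⟨fun p hp => ?_, fun p e he hp hm => ?_⟩
    · by_cases hc : c p = 0
      · refine h3 p fun hd => hp ?_
        simp [hc, hd]
      · exact h1 p hc
    · simp [h2 p e he hp hm, h4 p e he hp hm]
  smul_mem' := by
    rintro a c ⟨h1, h2⟩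
    refine ⟨fun p hp => h1 p fun h => hp ?_, fun p e he hp hm => ?_⟩
    · simp [h]
    · simp [h2 p e he hp hm]

/-- The nodes whose hook contributes the weight `w` by its first summand. -/
def hookFst (Y : YoungDiagram) (w : ℤ × ℤ) : Finset (ℕ × ℕ) :=
  Y.cells.filter fun s => ((leg Y s : ℤ) + 1, -(arm Y s : ℤ)) = w

/-- The nodes whose hook contributes the weight `w` by its second summand. -/
def hookSnd (Y : YoungDiagram) (w : ℤ × ℤ) : Finset (ℕ × ℕ) :=
  Y.cells.filter fun s => (-(leg Y s : ℤ), (arm Y s : ℤ) + 1) = w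

variable {Y : YoungDiagram} {P : ℕ} {Q : ℤ}

theorem not_mem_cells_iff {a b : ℕ} : (a, b) ∉ Y.cells ↔ Y.rowLen a ≤ b := by
  rw [YoungDiagram.mem_cells, YoungDiagram.mem_iff_lt_rowLen, not_lt]

/-- A node `(i, b)` has leg length `P` and arm length `-Q` iff it lies `-Q` steps from the end of
its row and `P` steps from the end of its column. -/
theorem mem_hookFst {i b : ℕ} : (i, b) ∈ hookFst Y ((P : ℤ) + 1, Q) ↔
    (b : ℤ) = Y.rowLen i - 1 + Q ∧ b < Y.rowLen (i + P) ∧ Y.rowLen (i + P + 1) ≤ b := by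
  rw [hookFst, Finset.mem_filter, YoungDiagram.mem_cells]
  have hc : ∀ a, a < Y.colLen b ↔ b < Y.rowLen a := fun a => by
    rw [← YoungDiagram.mem_iff_lt_colLen, YoungDiagram.mem_iff_lt_rowLen]
  have h1 := hc (i + P)
  have h2 := hc (i + P + 1)
  have h3 := hc i
  have h4 := Y.rowLen_anti i (i + P) (by omega)
  rw [YoungDiagram.mem_iff_lt_rowLen]
  simp only [leg, arm, Prod.mk.injEq]
  omega

/-- An element of `shiftHom` is constant along the rows of its support. -/
theorem shiftHom_row {c : ℕ × ℕ → ℂ} {w : ℤ × ℤ} (hc : c ∈ shiftHom Y w) {a b : ℕ} (n : ℕ)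
    (hb : (a, b) ∉ Y.cells) (hm : MemZ Y (wt (a, b) - w)) (hn : MemZ Y (wt (a, b + n) - w)) :
    c (a, b + n) = c (a, b) := by
  induction n with
  | zero => rfl
  | succ n ih =>
    have hm' : MemZ Y (wt (a, b + n) - w) := by
      simp only [MemZ, wt, Prod.fst_sub, Prod.snd_sub] at hm hn ⊢
      push_cast at hn ⊢
      omega
    rw [← ih hm']
    refine hc.2 (a, b + n) (0, 1) (Or.inr rfl) ?_ hn
    rw [not_mem_cells_iff] at hb ⊢
    omega

/-- Evaluation at the ends of the rows determines an element of `shiftHom`. -/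
theorem shiftHom_eq_zero {c : ℕ × ℕ → ℂ} (hc : c ∈ shiftHom Y ((P : ℤ) + 1, Q))
    (h0 : ∀ s ∈ hookFst Y ((P : ℤ) + 1, Q), c (s.1 + P + 1, s.2) = 0) : c = 0 := by
  -- each row is constant, and equal either to its value at the end or to the previous row
  have key : ∀ i b, c (i + P + 1, b) = 0 := by
    intro i
    induction i with
    | zero =>
      intro b
      by_contra hne
      obtain ⟨h1, h2⟩ := hc.1 _ hne
      have h1' := not_mem_cells_iff.mp h1
      have h2' := h2
      simp only [MemZ, wt, Prod.fst_sub, Prod.snd_sub] at h2'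
      push_cast at h2'
      have e0 : ((0 : ℕ) + (P : ℤ) + 1 - (P + 1)).toNat = 0 := by omega
      push_cast at e0
      rw [e0] at h2'
      obtain ⟨n, hn⟩ : ∃ n : ℕ, (n : ℤ) = Y.rowLen 0 - 1 + Q - b :=
        ⟨(Y.rowLen 0 - 1 + Q - b : ℤ).toNat, Int.toNat_of_nonneg (by omega)⟩
      have hend : MemZ Y (wt (0 + P + 1, b + n) - ((P : ℤ) + 1, Q)) := by
        simp only [MemZ, wt, Prod.fst_sub, Prod.snd_sub]
        push_cast
        rw [e0]
        omega
      have hr := shiftHom_row hc n h1 h2 hend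
      rw [← hr] at hne
      by_cases hY : b + n < Y.rowLen (0 + P)
      · refine hne (h0 (0, b + n) (mem_hookFst.mpr ⟨?_, hY, ?_⟩))
        · push_cast; omega
        · omega
      · have := hc.2 (0 + P, b + n) (1, 0) (Or.inl rfl) (not_mem_cells_iff.mpr (by omega)) hend
        apply hne
        change c ((0 + P, b + n) + (1, 0)) = 0
        rw [this]
        by_contra hn0
        have := (hc.1 _ hn0).2.1
        simp only [wt, Prod.fst_sub] at this
        push_cast at this
        omega
    | succ i ih =>
      intro b
      by_contra hne
      obtain ⟨h1, h2⟩ := hc.1 _ hne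
      have h1' := not_mem_cells_iff.mp h1
      have h2' := h2
      simp only [MemZ, wt, Prod.fst_sub, Prod.snd_sub] at h2'
      push_cast at h2'
      have e0 : ((i : ℤ) + 1 + (P : ℤ) + 1 - (P + 1)).toNat = i + 1 := by omega
      rw [e0] at h2'
      obtain ⟨n, hn⟩ : ∃ n : ℕ, (n : ℤ) = Y.rowLen (i + 1) - 1 + Q - b :=
        ⟨(Y.rowLen (i + 1) - 1 + Q - b : ℤ).toNat, Int.toNat_of_nonneg (by omega)⟩
      have hend : MemZ Y (wt (i + 1 + P + 1, b + n) - ((P : ℤ) + 1, Q)) := by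
        simp only [MemZ, wt, Prod.fst_sub, Prod.snd_sub]
        push_cast
        rw [e0]
        omega
      have hr := shiftHom_row hc n h1 h2 hend
      rw [← hr] at hne
      by_cases hY : b + n < Y.rowLen (i + 1 + P)
      · refine hne (h0 (i + 1, b + n) (mem_hookFst.mpr ⟨?_, hY, ?_⟩))
        · push_cast; omega
        · omega
      · have := hc.2 (i + 1 + P, b + n) (1, 0) (Or.inl rfl)
          (not_mem_cells_iff.mpr (by omega)) hend
        apply hne
        change c ((i + 1 + P, b + n) + (1, 0)) = 0
        rw [this, show i + 1 + P = i + P + 1 by ring]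
        exact ih _
  funext ⟨a, b⟩
  by_contra hne
  have hm := (hc.1 _ hne).2.1
  simp only [wt, Prod.fst_sub] at hm
  have : a = (a - P - 1) + P + 1 := by omega
  rw [this] at hne
  exact hne (key _ _)

/-- The common value of an element of `shiftHom` on the row `i + P + 1`, if its value at the end of
each row `s.1 + P + 1` with `s ∈ hookFst` is `g s`: a row whose end does not
come from such a node inherits its value from the row below. -/
def rowValue (Y : YoungDiagram) (P : ℕ) (Q : ℤ) (g : ℕ → ℂ) : ℕ → ℂ
  | 0 => if (Y.rowLen 0 : ℤ) - 1 + Q < Y.rowLen P then g 0 else 0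
  | i + 1 => if (Y.rowLen (i + 1) : ℤ) - 1 + Q < Y.rowLen (i + 1 + P) then g (i + 1)
      else rowValue Y P Q g i

open Classical in
/-- The element of `shiftHom` with prescribed values at the ends of rows. -/
def shiftExt (Y : YoungDiagram) (P : ℕ) (Q : ℤ) (g : ℕ → ℂ) (p : ℕ × ℕ) : ℂ :=
  if p ∉ Y.cells ∧ MemZ Y (wt p - ((P : ℤ) + 1, Q)) then rowValue Y P Q g (p.1 - P - 1) else 0

theorem shiftExt_mem (hQ : Q ≤ 0) (g : ℕ → ℂ) :
    shiftExt Y P Q g ∈ shiftHom Y ((P : ℤ) + 1, Q) := by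
  refine ⟨fun p hp => ?_, ?_⟩
  · rw [shiftExt] at hp
    by_contra h
    exact hp (if_neg h)
  · rintro ⟨a, b⟩ e (rfl | rfl) hp hm
    · have hp' : (a, b) + (1, 0) ∉ Y.cells := fun h => hp (cells_left h)
      rw [shiftExt, shiftExt, if_pos ⟨hp', hm⟩]
      have h1 := not_mem_cells_iff.mp hp
      simp only [MemZ, wt, Prod.fst_sub, Prod.snd_sub, Prod.fst_add, Prod.snd_add] at hm
      push_cast at hm
      rcases Nat.lt_trichotomy (a + 1) (P + 1) with hlt | heq | hgt
      · omega
      · have e1 : (((a : ℤ) + 1 - (P + 1))).toNat = 0 := by omega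
        have e2 : ((a, b) + (1, 0)).1 - P - 1 = 0 := by simp only [Prod.fst_add]; omega
        have e3 : a = P := by omega
        subst e3
        rw [e1] at hm
        rw [e2, rowValue, if_neg (by omega), if_neg]
        rintro ⟨-, h, -⟩
        simp only [wt, Prod.fst_sub] at h
        omega
      · obtain ⟨i, rfl⟩ : ∃ i, a = i + P + 1 := ⟨a - P - 1, by omega⟩
        have e1 : (((i + P + 1 : ℕ) : ℤ) + 1 - (P + 1)).toNat = i + 1 := by push_cast; omega
        have e2 : ((i + P + 1, b) + (1, 0)).1 - P - 1 = i + 1 := by simp only [Prod.fst_add]; omega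
        have e3 : (i + P + 1, b).1 - P - 1 = i := by simp only; omega
        have e4 : (((i + P + 1 : ℕ) : ℤ) - (P + 1)).toNat = i := by push_cast; omega
        rw [e1] at hm
        have hanti := Y.rowLen_anti i (i + 1) (by omega)
        rw [e2, e3, rowValue, if_neg, if_pos]
        · refine ⟨hp, ?_⟩
          simp only [MemZ, wt, Prod.fst_sub, Prod.snd_sub]
          rw [e4]
          push_cast
          omega
        · rw [show i + 1 + P = i + P + 1 by ring]
          omega
    · have hp' : (a, b) + (0, 1) ∉ Y.cells := fun h => hp (cells_down h)
      rw [shiftExt, shiftExt, if_pos ⟨hp', hm⟩]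
      simp only [MemZ, wt, Prod.fst_sub, Prod.snd_sub, Prod.fst_add, Prod.snd_add] at hm
      push_cast at hm
      rw [add_zero] at hm
      rw [if_pos]
      · simp
      · refine ⟨hp, ?_⟩
        simp only [MemZ, wt, Prod.fst_sub, Prod.snd_sub]
        omega

theorem shiftExt_hookFst {g : ℕ → ℂ} {s : ℕ × ℕ} (hs : s ∈ hookFst Y ((P : ℤ) + 1, Q)) :
    shiftExt Y P Q g (s.1 + P + 1, s.2) = g s.1 := by
  obtain ⟨i, b⟩ := s
  obtain ⟨h1, h2, h3⟩ := mem_hookFst.mp hs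
  have e1 : (((i + P + 1 : ℕ) : ℤ) - (P + 1)).toNat = i := by push_cast; omega
  have hQ : Q ≤ 0 := by
    have := Y.rowLen_anti i (i + P) (by omega)
    omega
  rw [shiftExt, if_pos]
  · have e2 : i + P + 1 - P - 1 = i := by omega
    rw [e2]
    cases i with
    | zero =>
      rw [rowValue, if_pos]
      rw [zero_add] at h2
      omega
    | succ i => rw [rowValue, if_pos (by omega)]
  · refine ⟨not_mem_cells_iff.mpr h3, ?_⟩
    simp only [MemZ, wt, Prod.fst_sub, Prod.snd_sub]
    rw [e1]
    push_cast
    omega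

theorem nonpos_of_mem_hookFst {s : ℕ × ℕ} {w : ℤ × ℤ} (hs : s ∈ hookFst Y w) : w.2 ≤ 0 := by
  have := (Finset.mem_filter.mp hs).2
  rw [← this]
  simp

open Classical in
theorem finrank_shiftHom_of_pos :
    Module.finrank ℂ (shiftHom Y ((P : ℤ) + 1, Q)) = (hookFst Y ((P : ℤ) + 1, Q)).card := by
  set S := hookFst Y ((P : ℤ) + 1, Q)
  let E : shiftHom Y ((P : ℤ) + 1, Q) →ₗ[ℂ] (S → ℂ) :=
    { toFun := fun c s => c.1 (s.1.1 + P + 1, s.1.2)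
      map_add' := fun _ _ => rfl
      map_smul' := fun _ _ => rfl }
  have hinj : Function.Injective E := by
    rw [← LinearMap.ker_eq_bot, LinearMap.ker_eq_bot']
    rintro ⟨c, hc⟩ h
    refine Subtype.ext (shiftHom_eq_zero hc fun s hs => ?_)
    exact congrFun h ⟨s, hs⟩
  have hsurj : Function.Surjective E := by
    intro g
    rcases S.eq_empty_or_nonempty with hS | ⟨s, hs⟩
    · refine ⟨0, funext fun s => ?_⟩
      exact absurd s.2 (Finset.eq_empty_iff_forall_notMem.mp hS s.1)
    · have hQ : Q ≤ 0 := nonpos_of_mem_hookFst hs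
      refine ⟨⟨shiftExt Y P Q fun i =>
        if h : ∃ b, (i, b) ∈ S then g ⟨_, h.choose_spec⟩ else 0, shiftExt_mem hQ _⟩, ?_⟩
      funext s
      change shiftExt Y P Q _ (s.1.1 + P + 1, s.1.2) = _
      rw [shiftExt_hookFst s.2]
      have hex : ∃ b, (s.1.1, b) ∈ S := ⟨s.1.2, s.2⟩
      rw [dif_pos hex]
      congr 1
      apply Subtype.ext
      refine Prod.ext rfl ?_
      have h1 := (mem_hookFst.mp hex.choose_spec).1
      have h2 := (mem_hookFst.mp s.2).1
      have : (hex.choose : ℤ) = s.1.2 := h1.trans h2.symm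
      exact_mod_cast this
  rw [(LinearEquiv.ofBijective E ⟨hinj, hsurj⟩).finrank_eq, Module.finrank_fintype_fun_eq_card,
    Fintype.card_coe]

theorem mem_transpose {p : ℕ × ℕ} : p ∈ Y.transpose.cells ↔ p.swap ∈ Y.cells := by
  rw [YoungDiagram.mem_cells, YoungDiagram.mem_transpose, YoungDiagram.mem_cells]

theorem memZ_transpose {z : ℤ × ℤ} : MemZ Y.transpose z ↔ MemZ Y z.swap := by
  rw [memZ_iff, memZ_iff]
  constructor
  · rintro ⟨q, hq, rfl⟩
    exact ⟨q.swap, mem_transpose.mp hq, rfl⟩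
  · rintro ⟨q, hq, h⟩
    refine ⟨q.swap, mem_transpose.mpr (by simpa using hq), ?_⟩
    rw [← z.swap_swap, ← h]
    rfl

theorem swap_mem_shiftHom {c : ℕ × ℕ → ℂ} {w : ℤ × ℤ} (hc : c ∈ shiftHom Y w) :
    (fun p => c p.swap) ∈ shiftHom Y.transpose w.swap := by
  refine ⟨fun p hp => ?_, fun p e he hp hm => ?_⟩
  · obtain ⟨h1, h2⟩ := hc.1 _ hp
    refine ⟨fun h => h1 (mem_transpose.mp h), memZ_transpose.mpr ?_⟩
    exact h2
  · refine hc.2 p.swap e.swap ?_ (fun h => hp (mem_transpose.mpr h)) (memZ_transpose.mp hm)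
    rcases he with rfl | rfl
    · exact Or.inr rfl
    · exact Or.inl rfl

/-- Reflection of a diagram along the diagonal. -/
def shiftHomSwap (Y : YoungDiagram) (w : ℤ × ℤ) :
    shiftHom Y w ≃ₗ[ℂ] shiftHom Y.transpose w.swap where
  toFun c := ⟨_, swap_mem_shiftHom c.2⟩
  map_add' _ _ := rfl
  map_smul' _ _ := rfl
  invFun c := ⟨fun p => c.1 p.swap, by
    have := swap_mem_shiftHom c.2
    rwa [YoungDiagram.transpose_transpose, Prod.swap_swap] at this⟩
  left_inv _ := rfl
  right_inv _ := rfl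

theorem card_hookFst_transpose (w : ℤ × ℤ) :
    (hookFst Y.transpose w.swap).card = (hookSnd Y w).card := by
  have hr : ∀ i, Y.transpose.rowLen i = Y.colLen i := fun i => Y.rowLen_transpose i
  have hc : ∀ i, Y.transpose.colLen i = Y.rowLen i := fun i => Y.colLen_transpose i
  refine Finset.card_bij' (fun s _ => s.swap) (fun s _ => s.swap) ?_ ?_
    (fun _ _ => rfl) (fun _ _ => rfl)
  · rintro ⟨i, j⟩ hs
    rw [hookFst, Finset.mem_filter] at hs
    rw [hookSnd, Finset.mem_filter]
    refine ⟨mem_transpose.mp hs.1, ?_⟩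
    rw [← w.swap_swap, ← hs.2]
    simp [leg, arm, hr, hc]
  · rintro ⟨i, j⟩ hs
    rw [hookSnd, Finset.mem_filter] at hs
    rw [hookFst, Finset.mem_filter]
    refine ⟨mem_transpose.mpr hs.1, ?_⟩
    rw [← hs.2]
    simp [leg, arm, hr, hc]

/-- The dimensions of the weight spaces. -/
theorem finrank_shiftHom (Y : YoungDiagram) (w : ℤ × ℤ) :
    Module.finrank ℂ (shiftHom Y w) = (hookFst Y w).card + (hookSnd Y w).card := by
  have fst_empty : ∀ (Y : YoungDiagram) (w : ℤ × ℤ), w.1 ≤ 0 → (hookFst Y w).card = 0 := by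
    intro Y w hw
    rw [Finset.card_eq_zero, hookFst, Finset.filter_eq_empty_iff]
    rintro s - rfl
    simp only at hw
    omega
  have snd_empty : ∀ (Y : YoungDiagram) (w : ℤ × ℤ), w.2 ≤ 0 → (hookSnd Y w).card = 0 := by
    intro Y w hw
    rw [← card_hookFst_transpose, fst_empty _ _ hw]
  have pos : ∀ (Y : YoungDiagram) (w : ℤ × ℤ), 0 < w.1 →
      Module.finrank ℂ (shiftHom Y w) = (hookFst Y w).card := by
    rintro Y ⟨P, Q⟩ hP
    obtain ⟨n, rfl⟩ : ∃ n : ℕ, P = n + 1 := ⟨(P - 1).toNat, by simp only at hP; omega⟩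
    exact finrank_shiftHom_of_pos
  rcases lt_or_ge 0 w.1 with h1 | h1
  · rw [pos Y w h1, hookSnd, Finset.card_eq_zero.mpr (Finset.filter_eq_empty_iff.mpr ?_), add_zero]
    rintro s - rfl
    simp only at h1
    omega
  · rw [fst_empty Y w h1, zero_add]
    rcases lt_or_ge 0 w.2 with h2 | h2
    · rw [(shiftHomSwap Y w).finrank_eq, pos _ _ h2, card_hookFst_transpose]
    · rw [snd_empty Y w h2]
      have : shiftHom Y w = ⊥ := by
        rw [eq_bot_iff]
        rintro c hc
        rw [Submodule.mem_bot]
        funext p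
        by_contra hne
        obtain ⟨h3, h4⟩ := hc.1 p hne
        obtain ⟨q, hq, hqw⟩ := memZ_iff.mp h4
        refine h3 (Y.isLowerSet ?_ hq)
        have e1 := congrArg Prod.fst hqw
        have e2 := congrArg Prod.snd hqw
        simp only [wt, Prod.fst_sub, Prod.snd_sub] at e1 e2
        refine ⟨?_, ?_⟩ <;> omega
      rw [this, finrank_bot]

end TangentCombinatorics

end

end ALE

namespace ALE

noncomputable section

/-! ### The tangent space at a monomial ideal -/

section Tangent

variable {α β : ℤ × ℤ} {Y : YoungDiagram}

theorem youngIdeal_induction {C : youngIdeal Y → Prop} (zero : C 0)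
    (add : ∀ f g, C f → C g → C (f + g))
    (mon : ∀ (p : ℕ × ℕ) (hp : mon p ∈ youngIdeal Y) (a : ℂ), C (a • ⟨mon p, hp⟩))
    (f : youngIdeal Y) : C f := by
  obtain ⟨s, hs, hsum⟩ := sum_cf_mon f.1
  have hp : ∀ p ∈ s, ALE.mon p ∈ youngIdeal Y := fun p hp =>
    mon_mem_youngIdeal.mpr fun hY => hs p hp (mem_youngIdeal.mp f.2 p hY)
  have hf : f = ∑ p ∈ s.attach, cf p.1 f.1 • (⟨ALE.mon p.1, hp p.1 p.2⟩ : youngIdeal Y) := by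
    apply Subtype.ext
    rw [AddSubmonoidClass.coe_finsetSum]
    refine hsum.trans ?_
    rw [← Finset.sum_attach]
    rfl
  rw [hf]
  exact Finset.sum_induction _ C add zero fun p _ => mon _ _ _

/-- The class in the quotient of the monomial with exponent vector `z`, and zero if `z` has a
negative entry. -/
def mkZ (Y : YoungDiagram) (z : ℤ × ℤ) : PlaneRing ⧸ youngIdeal Y :=
  if 0 ≤ z.1 ∧ 0 ≤ z.2 then Ideal.Quotient.mkₐ ℂ (youngIdeal Y) (mon (z.1.toNat, z.2.toNat)) else 0

theorem mkZ_wt (p : ℕ × ℕ) : mkZ Y (wt p) = Ideal.Quotient.mkₐ ℂ (youngIdeal Y) (mon p) := by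
  simp [mkZ, wt]

theorem mkZ_of_not_memZ {z : ℤ × ℤ} (h : ¬ MemZ Y z) : mkZ Y z = 0 := by
  by_cases h0 : 0 ≤ z.1 ∧ 0 ≤ z.2
  · rw [mkZ, if_pos h0, Ideal.Quotient.mkₐ_eq_mk, Ideal.Quotient.eq_zero_iff_mem,
      mon_mem_youngIdeal]
    intro hm
    refine h (memZ_iff.mpr ⟨_, hm, ?_⟩)
    ext <;> simp [wt, h0]
  · rw [mkZ, if_neg h0]

theorem mkZ_ne_zero {z : ℤ × ℤ} (h : MemZ Y z) : mkZ Y z ≠ 0 := by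
  obtain ⟨q, hq, rfl⟩ := memZ_iff.mp h
  rw [mkZ_wt, Ne, Ideal.Quotient.mkₐ_eq_mk, Ideal.Quotient.eq_zero_iff_mem, mon_mem_youngIdeal]
  exact not_not_intro hq

theorem wt_add (p q : ℕ × ℕ) : wt (p + q) = wt p + wt q := by
  ext <;> simp [wt]

theorem mon_smul_mkZ {z : ℤ × ℤ} (h : MemZ Y z) (e : ℕ × ℕ) :
    mon e • mkZ Y z = mkZ Y (z + wt e) := by
  obtain ⟨q, hq, rfl⟩ := memZ_iff.mp h
  rw [← wt_add, mkZ_wt, mkZ_wt, add_comm, mon_add, map_mul]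
  rfl

theorem quotSubst_mk (t : Torus) (p : ℕ × ℕ) :
    (youngFixed α β Y).quotSubst t (Ideal.Quotient.mkₐ ℂ (youngIdeal Y) (mon p)) =
      charVal (latWt α β (wt p)) t • Ideal.Quotient.mkₐ ℂ (youngIdeal Y) (mon p) := by
  rw [← map_smul, ← torusSubst_mon]
  rfl

theorem quotSubst_mkZ (t : Torus) (z : ℤ × ℤ) :
    (youngFixed α β Y).quotSubst t (mkZ Y z) = charVal (latWt α β z) t • mkZ Y z := by
  by_cases h : MemZ Y z
  · obtain ⟨q, hq, rfl⟩ := memZ_iff.mp h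
    rw [mkZ_wt]
    exact quotSubst_mk t q
  · rw [mkZ_of_not_memZ h, smul_zero]
    exact map_zero _

theorem repr_quotSubst (t : Torus) (x : PlaneRing ⧸ youngIdeal Y) (q : {p // p ∈ Y.cells}) :
    (quotBasis Y).repr ((youngFixed α β Y).quotSubst t x) q =
      charVal (latWt α β (wt q.1)) t * (quotBasis Y).repr x q := by
  have : ((quotBasis Y).coord q).comp ((youngFixed α β Y).quotSubst t).toLinearMap =
      charVal (latWt α β (wt q.1)) t • (quotBasis Y).coord q := by
    refine (quotBasis Y).ext fun p => ?_
    rw [LinearMap.comp_apply, LinearMap.smul_apply, AlgHom.toLinearMap_apply]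
    have h := quotSubst_mk (α := α) (β := β) (Y := Y) t p.1
    rw [← quotBasis_apply] at h
    rw [h, map_smul]
    simp only [Module.Basis.coord_apply, Module.Basis.repr_self, smul_eq_mul,
      Finsupp.single_apply]
    split_ifs with hpq
    · rw [hpq]
    · simp
  exact LinearMap.congr_fun this x

theorem mem_tangentWeight {I : FixedIdeal α β} {w : ℤ × ℤ} {φ : I.Tangent} :
    φ ∈ I.tangentWeight w ↔ ∀ (t : Torus) (f : I.ideal),
      φ ⟨torusSubst α β t f, I.fixed t f f.2⟩ = charVal w t • I.quotSubst t (φ f) := by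
  rw [FixedIdeal.tangentWeight, Submodule.mem_iInf]
  rfl

/-- The `ℂ`-linear map which sends `mon p` to `c p` times the monomial with exponent `p - w`. -/
def shiftMap (Y : YoungDiagram) (w : ℤ × ℤ) (c : ℕ × ℕ → ℂ) :
    PlaneRing →ₗ[ℂ] (PlaneRing ⧸ youngIdeal Y) :=
  monBasis.constr ℂ fun p => c p • mkZ Y (wt p - w)

theorem shiftMap_mon (w : ℤ × ℤ) (c : ℕ × ℕ → ℂ) (p : ℕ × ℕ) :
    shiftMap Y w c (mon p) = c p • mkZ Y (wt p - w) :=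
  monBasis.constr_basis ℂ _ p

theorem shiftMap_step {w : ℤ × ℤ} {c : ℕ × ℕ → ℂ} (hc : c ∈ shiftHom Y w) {e : ℕ × ℕ}
    (he : e = (1, 0) ∨ e = (0, 1)) (f : youngIdeal Y) :
    shiftMap Y w c (mon e * f.1) = mon e • shiftMap Y w c f.1 := by
  refine youngIdeal_induction (C := fun f => shiftMap Y w c (mon e * f.1) =
    mon e • shiftMap Y w c f.1) ?_ ?_ ?_ f
  · simp
  · intro f g hf hg
    simp only [Submodule.coe_add, mul_add, map_add, smul_add, hf, hg]
  · intro p hp a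
    change shiftMap Y w c (mon e * (a • mon p)) = mon e • shiftMap Y w c (a • mon p)
    rw [mul_smul_comm, map_smul, map_smul, smul_comm (mon e) a, ← mon_add, shiftMap_mon,
      shiftMap_mon, smul_comm (mon e) (c p), add_comm e p]
    congr 1
    have hp' := mon_mem_youngIdeal.mp hp
    have hz : wt (p + e) - w = wt p - w + wt e := by rw [wt_add]; abel
    by_cases hm : MemZ Y (wt (p + e) - w)
    · rw [hc.2 p e he hp' hm]
      by_cases h0 : c p = 0
      · rw [h0, zero_smul, zero_smul]
      · rw [mon_smul_mkZ (hc.1 p h0).2, hz]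
    · rw [mkZ_of_not_memZ hm, smul_zero]
      by_cases h0 : c p = 0
      · rw [h0, zero_smul]
      · rw [mon_smul_mkZ (hc.1 p h0).2, ← hz, mkZ_of_not_memZ hm, smul_zero]

theorem shiftMap_smul {w : ℤ × ℤ} {c : ℕ × ℕ → ℂ} (hc : c ∈ shiftHom Y w) (r : PlaneRing)
    (f : youngIdeal Y) : shiftMap Y w c (r * f.1) = r • shiftMap Y w c f.1 := by
  induction r using MvPolynomial.induction_on generalizing f with
  | C a =>
    rw [← MvPolynomial.smul_eq_C_mul, map_smul, ← MvPolynomial.algebraMap_eq, algebraMap_smul]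
  | add r s hr hs => rw [add_mul, map_add, hr, hs, add_smul]
  | mul_X r i hr =>
    have hX : ∃ e, (e = (1, 0) ∨ e = (0, 1)) ∧ (MvPolynomial.X i : PlaneRing) = mon e := by
      fin_cases i
      · exact ⟨_, Or.inl rfl, by simp [mon_eq]⟩
      · exact ⟨_, Or.inr rfl, by simp [mon_eq]⟩
    obtain ⟨e, he, hX⟩ := hX
    rw [hX, mul_assoc, hr ⟨mon e * f.1, Ideal.mul_mem_left _ _ f.2⟩, shiftMap_step hc he, mul_smul]

/-- The tangent vectors attached to the elements of `shiftHom`. -/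
def shiftTangent (α β : ℤ × ℤ) (Y : YoungDiagram) (w : ℤ × ℤ) :
    shiftHom Y w →ₗ[ℂ] (youngFixed α β Y).Tangent where
  toFun c :=
    { toFun := fun f => shiftMap Y w c.1 f.1
      map_add' := fun f g => map_add (shiftMap Y w c.1) f.1 g.1
      map_smul' := fun r f => shiftMap_smul c.2 r f }
  map_add' c d := by
    refine LinearMap.ext fun f => ?_
    have : shiftMap Y w (c.1 + d.1) = shiftMap Y w c.1 + shiftMap Y w d.1 :=
      ext_mon fun p => by simp only [LinearMap.add_apply, shiftMap_mon, Pi.add_apply, add_smul]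
    exact LinearMap.congr_fun this f.1
  map_smul' a c := by
    refine LinearMap.ext fun f => ?_
    have : shiftMap Y w (a • c.1) = a • shiftMap Y w c.1 :=
      ext_mon fun p => by
        simp only [LinearMap.smul_apply, shiftMap_mon, Pi.smul_apply, smul_eq_mul, mul_smul]
    exact LinearMap.congr_fun this f.1

theorem shiftTangent_mon (w : ℤ × ℤ) (c : shiftHom Y w) {p : ℕ × ℕ}
    (hp : mon p ∈ youngIdeal Y) :
    shiftTangent α β Y w c ⟨mon p, hp⟩ = c.1 p • mkZ Y (wt p - w) :=
  shiftMap_mon w c.1 p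

theorem shiftTangent_injective (w : ℤ × ℤ) : Function.Injective (shiftTangent α β Y w) := by
  rw [← LinearMap.ker_eq_bot, LinearMap.ker_eq_bot']
  intro c hc
  refine Subtype.ext (funext fun p => ?_)
  by_contra hne
  obtain ⟨h1, h2⟩ := c.2.1 p hne
  have := shiftTangent_mon (α := α) (β := β) w c (mon_mem_youngIdeal.mpr h1)
  rw [hc] at this
  exact (smul_ne_zero hne (mkZ_ne_zero h2)) this.symm

theorem torusSubst_youngIdeal_mon (t : Torus) (p : ℕ × ℕ) (hp : mon p ∈ youngIdeal Y)
    (φ : (youngFixed α β Y).Tangent) (a : ℂ) :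
    φ ⟨torusSubst α β t (a • mon p),
        (youngFixed α β Y).fixed t _ (Submodule.smul_of_tower_mem _ a hp)⟩ =
      a • charVal (latWt α β (wt p)) t • φ ⟨mon p, hp⟩ := by
  rw [← LinearMap.map_smul_of_tower, ← LinearMap.map_smul_of_tower]
  congr 1
  apply Subtype.ext
  change torusSubst α β t (a • mon p) = a • charVal (latWt α β (wt p)) t • mon p
  rw [map_smul, torusSubst_mon]

theorem shiftTangent_mem (w : ℤ × ℤ) (c : shiftHom Y w) :
    shiftTangent α β Y w c ∈ (youngFixed α β Y).tangentWeight (latWt α β w) := by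
  rw [mem_tangentWeight]
  intro t f
  set φ := shiftTangent α β Y w c with hφ
  refine youngIdeal_induction (C := fun f => φ ⟨torusSubst α β t f.1,
    (youngFixed α β Y).fixed t f.1 f.2⟩ =
    charVal (latWt α β w) t • (youngFixed α β Y).quotSubst t (φ f)) ?_ ?_ ?_ f
  · have : (⟨torusSubst α β t (0 : youngIdeal Y).1, (youngFixed α β Y).fixed t _
      (0 : youngIdeal Y).2⟩ : (youngFixed α β Y).ideal) = 0 := Subtype.ext (map_zero _)
    rw [this, map_zero, map_zero, smul_zero]
  · intro f g hf hg
    have : (⟨torusSubst α β t (f + g : youngIdeal Y).1, (youngFixed α β Y).fixed t _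
        (f + g : youngIdeal Y).2⟩ : (youngFixed α β Y).ideal) =
        ⟨torusSubst α β t f.1, (youngFixed α β Y).fixed t f.1 f.2⟩ +
        ⟨torusSubst α β t g.1, (youngFixed α β Y).fixed t g.1 g.2⟩ := Subtype.ext (map_add _ _ _)
    rw [this, map_add, hf, hg]
    have h0 : φ (f + g : youngIdeal Y) = φ f + φ g := map_add φ f g
    rw [h0, map_add, smul_add]
  · intro p hp a
    refine (torusSubst_youngIdeal_mon t p hp φ a).trans ?_
    have h0 : φ (a • ⟨mon p, hp⟩ : youngIdeal Y) = a • φ ⟨mon p, hp⟩ :=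
      LinearMap.map_smul_of_tower φ a _
    have h1 : φ ⟨mon p, hp⟩ = c.1 p • mkZ Y (wt p - w) := shiftTangent_mon w c hp
    rw [h0, h1, map_smul, map_smul]
    have h2 := quotSubst_mkZ (α := α) (β := β) (Y := Y) t (wt p - w)
    refine Eq.trans ?_ (congrArg (fun x => charVal (latWt α β w) t • a • c.1 p • x) h2.symm)
    have h3 : charVal (latWt α β (wt p)) t =
        charVal (latWt α β w) t * charVal (latWt α β (wt p - w)) t := by
      rw [← charVal_add, ← map_add]
      congr 2
      abel
    rw [h3]
    simp only [smul_smul]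
    congr 1
    ring

/-- A tangent vector of weight `w` only involves the shifts of monomials by this weight. -/
theorem latWt_eq_of_repr_ne_zero {W : ℤ × ℤ} {φ : (youngFixed α β Y).Tangent}
    (hφ : φ ∈ (youngFixed α β Y).tangentWeight W) {p : ℕ × ℕ} (hp : mon p ∈ youngIdeal Y)
    {q : {p // p ∈ Y.cells}} (hq : (quotBasis Y).repr (φ ⟨mon p, hp⟩) q ≠ 0) :
    latWt α β (wt p) = W + latWt α β (wt q.1) := by
  have h := mem_tangentWeight.mp hφ genericElt ⟨mon p, hp⟩
  have h1 := torusSubst_youngIdeal_mon genericElt p hp φ 1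
  simp only [one_smul] at h1
  have h2 : charVal (latWt α β (wt p)) genericElt • φ ⟨mon p, hp⟩ =
      charVal W genericElt • (youngFixed α β Y).quotSubst genericElt (φ ⟨mon p, hp⟩) :=
    h1.symm.trans h
  have h3 := congrArg (fun x => (quotBasis Y).repr x q) h2
  have h4 := repr_quotSubst (α := α) (β := β) genericElt (φ ⟨mon p, hp⟩) q
  have h5 : charVal (latWt α β (wt p)) genericElt * (quotBasis Y).repr (φ ⟨mon p, hp⟩) q =
      charVal W genericElt * (charVal (latWt α β (wt q.1)) genericElt *
        (quotBasis Y).repr (φ ⟨mon p, hp⟩) q) := by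
    rw [← h4]
    simpa using h3
  rw [← mul_assoc, ← charVal_add] at h5
  exact charVal_genericElt_injective (mul_right_cancel₀ hq h5)

theorem tangent_eq_of_mon {φ ψ : (youngFixed α β Y).Tangent}
    (h : ∀ p (hp : mon p ∈ youngIdeal Y), φ ⟨mon p, hp⟩ = ψ ⟨mon p, hp⟩) : φ = ψ := by
  refine LinearMap.ext fun f => ?_
  refine youngIdeal_induction (C := fun f => φ f = ψ f) ?_ ?_ ?_ f
  · exact (map_zero φ).trans (map_zero ψ).symm
  · intro f g hf hg
    exact (map_add φ f g).trans ((congrArg₂ _ hf hg).trans (map_add ψ f g).symm)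
  · intro p hp a
    exact (LinearMap.map_smul_of_tower φ a _).trans
      ((congrArg _ (h p hp)).trans (LinearMap.map_smul_of_tower ψ a _).symm)

theorem mem_range_shiftTangent (hdet : α.1 * β.2 - α.2 * β.1 ≠ 0) {w : ℤ × ℤ}
    {φ : (youngFixed α β Y).Tangent}
    (hφ : φ ∈ (youngFixed α β Y).tangentWeight (latWt α β w)) :
    φ ∈ LinearMap.range (shiftTangent α β Y w) := by
  have hex : ∀ p, ∃ a : ℂ, (a ≠ 0 → p ∉ Y.cells ∧ MemZ Y (wt p - w)) ∧
      ∀ hp : mon p ∈ youngIdeal Y, φ ⟨mon p, hp⟩ = a • mkZ Y (wt p - w) := by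
    intro p
    by_cases hp : mon p ∈ youngIdeal Y
    · have hqw : ∀ q : {p // p ∈ Y.cells}, (quotBasis Y).repr (φ ⟨mon p, hp⟩) q ≠ 0 →
          wt q.1 = wt p - w := by
        intro q hq
        have := latWt_eq_of_repr_ne_zero hφ hp hq
        rw [← map_add] at this
        rw [latWt_injective hdet this]
        abel
      by_cases hm : MemZ Y (wt p - w)
      · obtain ⟨q, hq, hqz⟩ := memZ_iff.mp hm
        refine ⟨(quotBasis Y).repr (φ ⟨mon p, hp⟩) ⟨q, hq⟩,
          fun _ => ⟨mon_mem_youngIdeal.mp hp, hm⟩, fun _ => ?_⟩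
        have hsum := ((quotBasis Y).sum_repr (φ ⟨mon p, hp⟩)).symm
        rw [Finset.sum_eq_single ⟨q, hq⟩, quotBasis_apply] at hsum
        · rw [← hqz, mkZ_wt]
          exact hsum
        · intro q' _ hne
          by_cases h0 : (quotBasis Y).repr (φ ⟨mon p, hp⟩) q' = 0
          · rw [h0, zero_smul]
          · exact absurd (Subtype.ext (wt_injective ((hqw q' h0).trans hqz.symm))) hne
        · simp
      · refine ⟨0, fun h => absurd rfl h, fun _ => ?_⟩
        rw [zero_smul]
        refine (quotBasis Y).ext_elem fun q => ?_
        rw [map_zero, Finsupp.zero_apply]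
        by_contra h0
        exact hm (memZ_iff.mpr ⟨q.1, q.2, hqw q h0⟩)
    · exact ⟨0, fun h => absurd rfl h, fun hp' => absurd hp' hp⟩
  choose c hc1 hc2 using hex
  have hc : c ∈ shiftHom Y w := by
    refine ⟨hc1, fun p e he hp hm => ?_⟩
    have hpe : p + e ∉ Y.cells := fun h => hp (Y.isLowerSet (le_add_right le_rfl) h)
    have h1 := hc2 p (mon_mem_youngIdeal.mpr hp)
    have h2 := hc2 (p + e) (mon_mem_youngIdeal.mpr hpe)
    have h3 : φ ⟨mon (p + e), mon_mem_youngIdeal.mpr hpe⟩ =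
        mon e • φ ⟨mon p, mon_mem_youngIdeal.mpr hp⟩ := by
      rw [← map_smul]
      congr 1
      apply Subtype.ext
      change mon (p + e) = mon e * mon p
      rw [add_comm, mon_add]
    have h4 : c (p + e) • mkZ Y (wt (p + e) - w) = c p • mkZ Y (wt (p + e) - w) := by
      refine h2.symm.trans (h3.trans ((congrArg (fun x => mon e • x) h1).trans ?_))
      change mon e • (c p • mkZ Y (wt p - w)) = _
      rw [smul_comm (mon e) (c p)]
      by_cases h0 : c p = 0
      · rw [h0, zero_smul, zero_smul]
      · rw [mon_smul_mkZ (hc1 p h0).2, wt_add]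
        congr 2
        abel
    exact smul_left_injective ℂ (mkZ_ne_zero hm) h4
  refine ⟨⟨c, hc⟩, tangent_eq_of_mon fun p hp => ?_⟩
  exact (shiftTangent_mon w ⟨c, hc⟩ hp).trans (hc2 p hp).symm

theorem range_shiftTangent (hdet : α.1 * β.2 - α.2 * β.1 ≠ 0) (w : ℤ × ℤ) :
    LinearMap.range (shiftTangent α β Y w) =
      (youngFixed α β Y).tangentWeight (latWt α β w) := by
  refine le_antisymm ?_ fun φ hφ => mem_range_shiftTangent hdet hφ
  rintro _ ⟨c, rfl⟩
  exact shiftTangent_mem w c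

theorem tangentWeight_eq_bot {W : ℤ × ℤ} (hW : W ∉ Set.range (latWt α β)) :
    (youngFixed α β Y).tangentWeight W = ⊥ := by
  rw [eq_bot_iff]
  intro φ hφ
  rw [Submodule.mem_bot]
  refine tangent_eq_of_mon fun p hp => ?_
  change φ ⟨mon p, hp⟩ = 0
  refine (quotBasis Y).ext_elem fun q => ?_
  rw [map_zero, Finsupp.zero_apply]
  by_contra h0
  refine hW ⟨wt p - wt q.1, ?_⟩
  rw [map_sub, latWt_eq_of_repr_ne_zero hφ hp h0]
  abel

/-- The character of the tangent space at the monomial ideal of a Young diagram is the sum of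
`t₁ ^ (L+1) t₂ ^ (-A) + t₁ ^ (-L) t₂ ^ (A+1)` over the nodes. -/
theorem finrank_tangentWeight (hdet : α.1 * β.2 - α.2 * β.1 ≠ 0) (Y : YoungDiagram) (W : ℤ × ℤ) :
    Module.finrank ℂ ((youngFixed α β Y).tangentWeight W) =
      (Y.cells.filter fun s => latWt α β ((leg Y s : ℤ) + 1, -(arm Y s : ℤ)) = W).card +
      (Y.cells.filter fun s => latWt α β (-(leg Y s : ℤ), (arm Y s : ℤ) + 1) = W).card := by
  by_cases hW : W ∈ Set.range (latWt α β)
  · obtain ⟨w, rfl⟩ := hW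
    rw [← range_shiftTangent hdet, LinearMap.finrank_range_of_inj (shiftTangent_injective w),
      finrank_shiftHom]
    simp only [(latWt_injective hdet).eq_iff]
    rfl
  · rw [tangentWeight_eq_bot hW, finrank_bot, Finset.filter_false_of_mem,
      Finset.filter_false_of_mem]
    · rfl
    · exact fun s _ h => hW ⟨_, h⟩
    · exact fun s _ h => hW ⟨_, h⟩

end Tangent

end

end ALE

namespace ALE

noncomputable section

/-! ### Euler classes and equivariant integrals -/

section Euler

variable {α β : ℤ × ℤ} {K : Type*} [Field K] {ε₁ ε₂ : K}

theorem prod_wval_pow_card (S : Finset (ℕ × ℕ)) (g : ℕ × ℕ → ℤ × ℤ) (T : Finset (ℤ × ℤ))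
    (hT : ∀ s ∈ S, g s ∈ T) (x : ℤ × ℤ → K) :
    ∏ W ∈ T, x W ^ (S.filter fun s => g s = W).card = ∏ s ∈ S, x (g s) := by
  rw [← Finset.prod_fiberwise_of_maps_to hT]
  refine Finset.prod_congr rfl fun W _ => ?_
  rw [Finset.prod_congr rfl fun s hs => by rw [(Finset.mem_filter.mp hs).2], Finset.prod_const]

theorem euler_eq_prod {I : FixedIdeal α β} {V : Submodule ℂ I.Tangent} (S : Finset (ℕ × ℕ))
    (g₁ g₂ : ℕ × ℕ → ℤ × ℤ)
    (h : ∀ W, Module.finrank ℂ (I.tangentWeight W ⊓ V : Submodule ℂ I.Tangent) =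
      (S.filter fun s => g₁ s = W).card + (S.filter fun s => g₂ s = W).card) :
    I.euler ε₁ ε₂ V = ∏ s ∈ S, (wval ε₁ ε₂ (g₁ s) * wval ε₁ ε₂ (g₂ s)) := by
  set T := S.image g₁ ∪ S.image g₂ with hT
  have h1 : ∀ s ∈ S, g₁ s ∈ T := fun s hs =>
    Finset.mem_union_left _ (Finset.mem_image_of_mem _ hs)
  have h2 : ∀ s ∈ S, g₂ s ∈ T := fun s hs =>
    Finset.mem_union_right _ (Finset.mem_image_of_mem _ hs)
  rw [FixedIdeal.euler, finprod_eq_prod_of_mulSupport_subset (s := T)]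
  · rw [Finset.prod_mul_distrib, ← prod_wval_pow_card S g₁ T h1 (wval ε₁ ε₂),
      ← prod_wval_pow_card S g₂ T h2 (wval ε₁ ε₂), ← Finset.prod_mul_distrib]
    refine Finset.prod_congr rfl fun W _ => ?_
    rw [h, pow_add]
    rfl
  · intro W hW
    by_contra hn
    refine hW ?_
    change _ ^ Module.finrank ℂ (I.tangentWeight W ⊓ V : Submodule ℂ I.Tangent) = _
    rw [h, Finset.filter_false_of_mem, Finset.filter_false_of_mem]
    · simp
    · exact fun s hs he => hn (he ▸ h2 s hs)
    · exact fun s hs he => hn (he ▸ h1 s hs)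

theorem wval_latWt (z : ℤ × ℤ) : wval ε₁ ε₂ (latWt α β z) =
    (z.1 : K) * wval ε₁ ε₂ α + (z.2 : K) * wval ε₁ ε₂ β := by
  simp only [wval, latWt_apply, Prod.fst_add, Prod.snd_add, Prod.smul_fst, Prod.smul_snd,
    smul_eq_mul]
  push_cast
  ring

theorem inv_euler_top (hdet : α.1 * β.2 - α.2 * β.1 ≠ 0) (Y : YoungDiagram) :
    ((youngFixed α β Y).euler ε₁ ε₂ ⊤)⁻¹ = hookWeight 1 (wval ε₁ ε₂ α) (wval ε₁ ε₂ β) Y := by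
  rw [euler_eq_prod Y.cells (fun s => latWt α β ((leg Y s : ℤ) + 1, -(arm Y s : ℤ)))
    (fun s => latWt α β (-(leg Y s : ℤ), (arm Y s : ℤ) + 1)), hookWeight, ← Finset.prod_inv_distrib,
    Finset.filter_true_of_mem fun s _ => one_dvd _]
  · refine Finset.prod_congr rfl fun s _ => ?_
    rw [wval_latWt, wval_latWt]
    push_cast
    congr 2
    ring
  · intro W
    rw [inf_top_eq, finrank_tangentWeight hdet]

end Euler

section Cyclic

variable {k : ℕ}

theorem charVal_cyclicGen (w : ℤ × ℤ) :
    charVal w (cyclicGen k) = ((rootOfUnity k : ℂˣ) : ℂ) ^ (w.1 - w.2) := by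
  rw [charVal, torusChar, cyclicGen, inv_zpow', ← zpow_add, ← sub_eq_add_neg,
    Units.val_zpow_eq_zpow_val]

theorem isPrimitiveRoot_rootOfUnity (hk : k ≠ 0) :
    IsPrimitiveRoot ((rootOfUnity k : ℂˣ) : ℂ) k := Complex.isPrimitiveRoot_exp k hk

theorem charVal_cyclicGen_eq_one (hk : k ≠ 0) (w : ℤ × ℤ) :
    charVal w (cyclicGen k) = 1 ↔ (k : ℤ) ∣ w.1 - w.2 := by
  rw [charVal_cyclicGen, (isPrimitiveRoot_rootOfUnity hk).zpow_eq_one_iff_dvd]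

theorem latWt_std (z : ℤ × ℤ) : latWt (1, 0) (0, 1) z = z := by
  ext <;> simp [latWt_apply]

/-- The generator of `ℤ_k` acts on the weight space of `W` by `ω ^ (W₁ - W₂)`. -/
theorem tangentWeight_inf_invTangent (hk : k ≠ 0) (Y : YoungDiagram) (W : ℤ × ℤ) :
    (youngFixed (1, 0) (0, 1) Y).tangentWeight W ⊓ invTangent k (youngFixed (1, 0) (0, 1) Y) =
      if (k : ℤ) ∣ W.1 - W.2 then (youngFixed (1, 0) (0, 1) Y).tangentWeight W else ⊥ := by
  split_ifs with h
  · refine inf_eq_left.mpr fun φ hφ f => ?_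
    have := mem_tangentWeight.mp hφ (cyclicGen k) f
    rwa [(charVal_cyclicGen_eq_one hk W).mpr h] at this
  · rw [eq_bot_iff]
    rintro φ ⟨h1, h2⟩
    rw [Submodule.mem_bot]
    refine tangent_eq_of_mon fun p hp => ?_
    change φ ⟨mon p, hp⟩ = 0
    have e1 := mem_tangentWeight.mp h1 (cyclicGen k) ⟨mon p, hp⟩
    have e2 : φ ⟨torusSubst (1, 0) (0, 1) (cyclicGen k) (mon p), _⟩ =
      (1 : ℂ) • (youngFixed (1, 0) (0, 1) Y).quotSubst (cyclicGen k) (φ ⟨mon p, hp⟩) :=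
      h2 ⟨mon p, hp⟩
    rw [one_smul] at e2
    rw [← e2] at e1
    have e3 := torusSubst_youngIdeal_mon (cyclicGen k) p hp φ 1
    simp only [one_smul] at e3
    rw [e3] at e1
    have e4 : (charVal W (cyclicGen k) - 1) •
        charVal (latWt (1, 0) (0, 1) (wt p)) (cyclicGen k) • φ ⟨mon p, hp⟩ = 0 := by
      rw [sub_smul, one_smul, sub_eq_zero]
      exact e1.symm
    refine ((smul_eq_zero.mp ((smul_eq_zero.mp e4).resolve_left ?_))).resolve_left
      (charVal_ne_zero _ _)
    rw [sub_eq_zero]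
    exact fun he => h ((charVal_cyclicGen_eq_one hk W).mp he)

theorem inv_euler_invTangent {K : Type*} [Field K] (ε₁ ε₂ : K) (hk : k ≠ 0) (Y : YoungDiagram) :
    ((youngFixed (1, 0) (0, 1) Y).euler ε₁ ε₂ (invTangent k (youngFixed (1, 0) (0, 1) Y)))⁻¹ =
      hookWeight k ε₁ ε₂ Y := by
  rw [euler_eq_prod (Y.cells.filter fun s => k ∣ hook Y s)
    (fun s => ((leg Y s : ℤ) + 1, -(arm Y s : ℤ)))
    (fun s => (-(leg Y s : ℤ), (arm Y s : ℤ) + 1)), hookWeight, ← Finset.prod_inv_distrib]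
  · refine Finset.prod_congr rfl fun s _ => ?_
    simp only [wval]
    push_cast
    congr 2
    ring
  · intro W
    rw [Finset.filter_filter, Finset.filter_filter]
    have hinf := tangentWeight_inf_invTangent hk Y W
    have h1 : ∀ s, ((leg Y s : ℤ) + 1, -(arm Y s : ℤ)) = W → W.1 - W.2 = hook Y s := by
      rintro s rfl
      simp only [hook]
      push_cast
      ring
    have h2 : ∀ s, (-(leg Y s : ℤ), (arm Y s : ℤ) + 1) = W → W.1 - W.2 = -hook Y s := by
      rintro s rfl
      simp only [hook]
      push_cast
      ring
    by_cases h : (k : ℤ) ∣ W.1 - W.2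
    · rw [if_pos h] at hinf
      rw [hinf, finrank_tangentWeight (α := (1, 0)) (β := (0, 1)) (by norm_num)]
      simp only [latWt_std]
      congr 2
      · refine Finset.filter_congr fun s _ => ⟨fun hs => ⟨?_, hs⟩, fun hs => hs.2⟩
        rw [h1 s hs] at h
        exact_mod_cast h
      · refine Finset.filter_congr fun s _ => ⟨fun hs => ⟨?_, hs⟩, fun hs => hs.2⟩
        rw [h2 s hs, dvd_neg] at h
        exact_mod_cast h
    · rw [if_neg h] at hinf
      rw [hinf, finrank_bot, Finset.filter_false_of_mem, Finset.filter_false_of_mem]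
      · rfl
      · rintro s - ⟨hd, hs⟩
        rw [h2 s hs, dvd_neg] at h
        exact h (by exact_mod_cast hd)
      · rintro s - ⟨hd, hs⟩
        rw [h1 s hs] at h
        exact h (by exact_mod_cast hd)

/-- The dimension of an eigenspace of an endomorphism with an eigenbasis. -/
theorem finrank_ker_diagonal {V ι : Type*} [AddCommGroup V] [Module ℂ V] [Fintype ι]
    (b : Module.Basis ι ℂ V) (T : V →ₗ[ℂ] V) (d : ι → ℂ) (hT : ∀ i, T (b i) = d i • b i) (μ : ℂ)
    [DecidablePred fun i => d i = μ] :
    Module.finrank ℂ (LinearMap.ker (T - μ • LinearMap.id)) =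
      (Finset.univ.filter fun i => d i = μ).card := by
  have hrepr : ∀ x i, b.repr ((T - μ • LinearMap.id : V →ₗ[ℂ] V) x) i = (d i - μ) * b.repr x i := by
    intro x i
    have : (b.coord i).comp (T - μ • LinearMap.id) = (d i - μ) • b.coord i := by
      refine b.ext fun j => ?_
      classical
      simp only [LinearMap.comp_apply, LinearMap.sub_apply, LinearMap.smul_apply,
        LinearMap.id_apply, hT, map_sub, map_smul, Module.Basis.coord_apply,
        Module.Basis.repr_self, smul_eq_mul, Finsupp.single_apply]
      split_ifs with hij
      · rw [hij]; ring
      · ring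
    exact LinearMap.congr_fun this x
  have hker : LinearMap.ker (T - μ • LinearMap.id) =
      Submodule.span ℂ (Set.range fun i : {i // d i = μ} => b i.1) := by
    apply le_antisymm
    · intro x hx
      rw [← b.sum_repr x]
      refine Submodule.sum_mem _ fun i _ => ?_
      by_cases hi : d i = μ
      · exact Submodule.smul_mem _ _ (Submodule.subset_span ⟨⟨i, hi⟩, rfl⟩)
      · have := hrepr x i
        rw [LinearMap.mem_ker.mp hx, map_zero, Finsupp.zero_apply] at this
        rw [(mul_eq_zero.mp this.symm).resolve_left (sub_ne_zero.mpr hi), zero_smul]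
        exact Submodule.zero_mem _
    · rw [Submodule.span_le]
      rintro _ ⟨⟨i, hi⟩, rfl⟩
      rw [SetLike.mem_coe, LinearMap.mem_ker, LinearMap.sub_apply, hT, hi]
      simp
  rw [hker]
  exact (finrank_span_eq_card (b.linearIndependent.comp (Subtype.val : {i // d i = μ} → ι)
    Subtype.val_injective)).trans (Fintype.card_subtype _)

theorem repMult_youngFixed (hk : k ≠ 0) (Y : YoungDiagram) (i : Fin k) :
    repMult k (youngFixed (1, 0) (0, 1) Y) i = colourCount k Y i := by
  classical
  have hT : ∀ p, ((youngFixed (1, 0) (0, 1) Y).quotSubst (cyclicGen k)).toLinearMap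
      (quotBasis Y p) = charVal (wt p.1) (cyclicGen k) • quotBasis Y p := by
    intro p
    rw [quotBasis_apply]
    exact (quotSubst_mk _ _).trans (by rw [latWt_std])
  refine (finrank_ker_diagonal (quotBasis Y) _ _ hT _).trans ?_
  have hcol : ∀ p : ℕ × ℕ, charVal (wt p) (cyclicGen k) = ((rootOfUnity k : ℂˣ) : ℂ) ^ (i : ℕ) ↔
      ((p.1 : ℤ) - (p.2 : ℤ)) ≡ ((i : ℕ) : ℤ) [ZMOD (k : ℤ)] := by
    intro p
    have h0 : ((rootOfUnity k : ℂˣ) : ℂ) ≠ 0 := Units.ne_zero _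
    rw [charVal_cyclicGen, ← zpow_natCast, ← div_eq_one_iff_eq (zpow_ne_zero _ h0),
      ← zpow_sub₀ h0, (isPrimitiveRoot_rootOfUnity hk).zpow_eq_one_iff_dvd, Int.modEq_comm,
      Int.modEq_iff_dvd]
    rfl
  simp only [hcol]
  rw [colourCount, ← Finset.card_map ⟨Subtype.val, Subtype.val_injective⟩]
  congr 1
  ext p
  simp [and_comm]

/-- The torus fixed points of the invariant Hilbert scheme. -/
theorem bijOn_invHilbFixed (hk : k ≠ 0) (v : Fin k → ℕ) :
    Set.BijOn (youngFixed (1, 0) (0, 1)) {Y | colourCount k Y = v} (invHilbFixed k v) := by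
  have hb := youngFixed_bijective (α := (1, 0)) (β := (0, 1)) (by norm_num)
  refine ⟨fun Y hY i => ?_, hb.1.injOn, fun I hI => ?_⟩
  · rw [repMult_youngFixed hk]
    exact congrFun hY i
  · obtain ⟨Y, rfl⟩ := hb.2 I
    exact ⟨Y, funext fun i => (repMult_youngFixed hk Y i).symm.trans (hI i), rfl⟩

theorem invHilbIntegral_eq_youngSum {K : Type*} [Field K] (ε₁ ε₂ : K) (hk : k ≠ 0)
    (v : Fin k → ℕ) : invHilbIntegral k ε₁ ε₂ v = youngSum k ε₁ ε₂ v :=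
  (finsum_mem_eq_of_bijOn _ (bijOn_invHilbFixed hk v) fun Y _ =>
    (inv_euler_invTangent ε₁ ε₂ hk Y).symm).symm

end Cyclic

section Resolution

variable {K : Type*} [Field K] {ε₁ ε₂ : K} {k : ℕ}

theorem det_chartWeight (i : Fin k) : (chartWeight₁ k i).1 * (chartWeight₂ k i).2 -
    (chartWeight₁ k i).2 * (chartWeight₂ k i).1 = k := by
  simp only [chartWeight₁, chartWeight₂]
  ring

theorem linearIndependent_wval (hε : LinearIndependent ℤ ![ε₁, ε₂]) {α β : ℤ × ℤ}
    (hdet : α.1 * β.2 - α.2 * β.1 ≠ 0) :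
    LinearIndependent ℤ ![wval ε₁ ε₂ α, wval ε₁ ε₂ β] := by
  rw [LinearIndependent.pair_iff]
  intro s t h
  have h1 : wval ε₁ ε₂ (latWt α β (s, t)) = 0 := by
    rw [wval_latWt, ← h]
    simp
  rw [wval_eq_zero hε] at h1
  have := latWt_injective hdet (h1.trans (map_zero _).symm)
  simpa using this

/-- The equivariant volume of the minimal resolution. -/
theorem sum_inv_chartWeight [CharZero K] (hε : LinearIndependent ℤ ![ε₁, ε₂]) (hk : k ≠ 0) :
    ∑ i : Fin k, 1 / (wval ε₁ ε₂ (chartWeight₁ k i) * wval ε₁ ε₂ (chartWeight₂ k i)) =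
      1 / ((k : K) * ε₁ * ε₂) := by
  set A : ℕ → K := fun i => wval ε₁ ε₂ ((k : ℤ) - i, -(i : ℤ)) with hA
  have hne : ∀ i, A i ≠ 0 := by
    intro i h
    rw [hA] at h
    have := (wval_eq_zero hε).mp h
    simp only [Prod.mk_eq_zero] at this
    omega
  have hs : ε₁ + ε₂ ≠ 0 := by
    intro h
    have := (wval_eq_zero hε (w := (1, 1))).mp (by simpa [wval] using h)
    simp at this
  have hε₁ : ε₁ ≠ 0 := by
    intro h
    have := (wval_eq_zero hε (w := (1, 0))).mp (by simpa [wval] using h)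
    simp at this
  have hε₂ : ε₂ ≠ 0 := by
    intro h
    have := (wval_eq_zero hε (w := (0, 1))).mp (by simpa [wval] using h)
    simp at this
  have hk' : (k : K) ≠ 0 := Nat.cast_ne_zero.mpr hk
  have hterm : ∀ i : Fin k,
      1 / (wval ε₁ ε₂ (chartWeight₁ k i) * wval ε₁ ε₂ (chartWeight₂ k i)) =
      (1 / A i - 1 / A (i + 1)) / (ε₁ + ε₂) := by
    intro i
    have e1 : wval ε₁ ε₂ (chartWeight₁ k i) = A i := rfl
    have e2 : wval ε₁ ε₂ (chartWeight₂ k i) = -A (i + 1) := by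
      simp only [hA, wval, chartWeight₂]
      push_cast
      ring
    have e3 : A i - A (i + 1) = ε₁ + ε₂ := by
      simp only [hA, wval]
      push_cast
      ring
    rw [e1, e2, div_sub_div _ _ (hne _) (hne _), ← e3]
    rw [← e3] at hs
    have := hne i
    have := hne (i + 1)
    field_simp
    ring
  rw [Finset.sum_congr rfl fun i _ => hterm i, ← Finset.sum_div,
    Fin.sum_univ_eq_sum_range (fun i => 1 / A i - 1 / A (i + 1)), Finset.sum_range_sub']
  have e1 : A 0 = k * ε₁ := by simp [hA, wval]
  have e2 : A k = -(k * ε₂) := by simp [hA, wval]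
  rw [e1, e2]
  field_simp
  ring

theorem mem_diagrams_one {Y : YoungDiagram} {m : ℕ} :
    Y ∈ diagrams 1 (fun _ : ZMod 1 => (m : ℤ)) ↔ Y.card = m := by
  rw [mem_diagrams, ← sum_colCount (k := 1) Y]
  constructor
  · intro h
    have := h 0
    rw [Fintype.sum_unique]
    exact_mod_cast this
  · intro h i
    rw [Fintype.sum_unique] at h
    obtain rfl : i = 0 := Subsingleton.elim _ _
    exact congrArg _ h

/-- The Euler characteristic integral of the Hilbert scheme of points of the plane. -/
theorem hookSum_one [CharZero K] (hε : LinearIndependent ℤ ![ε₁, ε₂]) (m : ℕ) :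
    ∑ Y ∈ diagrams 1 (fun _ : ZMod 1 => (m : ℤ)), hookWeight 1 ε₁ ε₂ Y =
      (1 / (ε₁ * ε₂)) ^ m / (m.factorial : K) := by
  have := hookSum_eq hε (fun _ : ZMod 1 => (m : ℤ)) m (by simp [twiceEnergy, affineForm])
  rw [hookSum, if_pos (by positivity)] at this
  simpa using this

/-- The exponential formula for tuples of Young diagrams. -/
theorem finsum_tuples [CharZero K] (a b : Fin k → K) (hab : ∀ i, LinearIndependent ℤ ![a i, b i])
    (n : ℕ) :
    ∑ᶠ y ∈ {y : Fin k → YoungDiagram | ∑ i, (y i).card = n},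
      ∏ i, hookWeight 1 (a i) (b i) (y i) = (∑ i, 1 / (a i * b i)) ^ n / (n.factorial : K) := by
  classical
  set D : ℕ → Finset YoungDiagram := fun m => diagrams 1 (fun _ : ZMod 1 => (m : ℤ)) with hD
  set T : Finset (Fin k → YoungDiagram) := (Finset.piAntidiag Finset.univ n).biUnion
    fun m => Fintype.piFinset fun i => D (m i) with hT
  have hmem : {y : Fin k → YoungDiagram | ∑ i, (y i).card = n} = T := by
    ext y
    simp only [hT, Finset.mem_coe, Finset.mem_biUnion, Finset.mem_piAntidiag,
      Fintype.mem_piFinset, hD, mem_diagrams_one]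
    constructor
    · intro h
      exact ⟨fun i => (y i).card, ⟨h, fun i _ => Finset.mem_univ i⟩, fun _ => rfl⟩
    · rintro ⟨m, ⟨hm, -⟩, hy⟩
      change ∑ i, (y i).card = n
      rw [← hm]
      exact Finset.sum_congr rfl fun i _ => hy i
  rw [hmem, finsum_mem_coe_finset, hT, Finset.sum_biUnion]
  · have hsum : ∀ m ∈ Finset.piAntidiag (Finset.univ : Finset (Fin k)) n,
        ∑ y ∈ Fintype.piFinset (fun i => D (m i)), ∏ i, hookWeight 1 (a i) (b i) (y i) =
        (Nat.multinomial Finset.univ m * ∏ i, (1 / (a i * b i)) ^ m i) / (n.factorial : K) := by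
      intro m hm
      rw [← Finset.prod_univ_sum, Finset.prod_congr rfl fun i _ => hookSum_one (hab i) (m i),
        Finset.prod_div_distrib]
      have hspec := Nat.multinomial_spec Finset.univ m
      rw [(Finset.mem_piAntidiag.mp hm).1] at hspec
      have hprod : (∏ i, ((m i).factorial : K)) ≠ 0 :=
        Finset.prod_ne_zero_iff.mpr fun i _ => Nat.cast_ne_zero.mpr (Nat.factorial_ne_zero _)
      have hn : (n.factorial : K) ≠ 0 := Nat.cast_ne_zero.mpr (Nat.factorial_ne_zero _)
      rw [div_eq_div_iff hprod hn, ← hspec]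
      push_cast
      ring
    rw [Finset.sum_congr rfl hsum, ← Finset.sum_div, Finset.sum_pow_eq_sum_piAntidiag]
  · intro m _ m' _ hne
    rw [Function.onFun, Finset.disjoint_left]
    intro y hy hy'
    apply hne
    funext i
    have h1 := mem_diagrams_one.mp (Fintype.mem_piFinset.mp hy i)
    have h2 := mem_diagrams_one.mp (Fintype.mem_piFinset.mp hy' i)
    rw [← h1, h2]

/-- The equivariant integrals over the Hilbert schemes of the minimal resolution are the
coefficients of the exponential of its equivariant volume. -/
theorem xkHilbIntegral_eq [CharZero K] (hε : LinearIndependent ℤ ![ε₁, ε₂]) (hk : k ≠ 0) (n : ℕ) :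
    xkHilbIntegral k ε₁ ε₂ n = (1 / ((k : K) * ε₁ * ε₂)) ^ n / (n.factorial : K) := by
  have hdet : ∀ i : Fin k, (chartWeight₁ k i).1 * (chartWeight₂ k i).2 -
      (chartWeight₁ k i).2 * (chartWeight₂ k i).1 ≠ 0 := fun i => by
    rw [det_chartWeight]; exact_mod_cast hk
  rw [← sum_inv_chartWeight hε hk,
    ← finsum_tuples _ _ (fun i => linearIndependent_wval hε (hdet i)), xkHilbIntegral]
  refine (finsum_mem_eq_of_bijOn
    (fun (y : Fin k → YoungDiagram) i => youngFixed (chartWeight₁ k i) (chartWeight₂ k i) (y i))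
    ⟨fun y hy => ?_, fun y _ y' _ h => ?_, fun Z hZ => ?_⟩ fun y _ => ?_).symm
  · refine Eq.trans ?_ hy
    exact Finset.sum_congr rfl fun i _ => colength_youngFixed (y i)
  · exact funext fun i => (youngFixed_bijective (hdet i)).1 (congrFun h i)
  · choose y hy using fun i => (youngFixed_bijective (hdet i)).2 (Z i)
    obtain rfl : (fun i => youngFixed _ _ (y i)) = Z := funext hy
    refine ⟨y, ?_, rfl⟩
    refine Eq.trans ?_ hZ
    exact Finset.sum_congr rfl fun i _ => (colength_youngFixed (y i)).symm
  · exact Finset.prod_congr rfl fun i _ => (inv_euler_top (hdet i) (y i)).symm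

end Resolution

end

end ALE

namespace ALE

noncomputable section

/-! ### Formal sums -/

section FormalSums

variable {k : ℕ} {K : Type*} [Field K] {ι κ : Type*}

theorem coeff_formalSum {f : ι → FormalSeries k K} (hf : FormallySummable f) (e : Expo k) :
    (formalSum f).coeff e = ∑ᶠ a, (f a).coeff e := by
  rw [formalSum, dif_pos hf, HahnSeries.SummableFamily.coeff_hsum]
  rfl

/-- Families of multiples of distinct monomials, whose exponents are parametrized monotonically by
a well quasi-order, are summable. -/
theorem formallySummable_single {P : Type*} [PartialOrder P] [WellQuasiOrderedLE P]
    {e : P → Expo k} (he : Monotone e) (hinj : Function.Injective e) {g : ι → P}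
    (hg : Function.Injective g) (c : ι → K) {f : ι → FormalSeries k K}
    (hf : ∀ a, f a = HahnSeries.single (e (g a)) (c a)) : FormallySummable f := by
  have hsupp : ∀ a x, (f a).coeff x ≠ 0 → x = e (g a) := by
    intro a x hx
    rw [hf] at hx
    by_contra hne
    exact hx (HahnSeries.coeff_single_of_ne hne)
  refine ⟨?_, fun x => ?_⟩
  · refine ((Set.isPWO_of_wellQuasiOrderedLE Set.univ).image_of_monotone he).mono ?_
    intro x hx
    obtain ⟨a, ha⟩ := Set.mem_iUnion.mp hx
    exact ⟨g a, Set.mem_univ _, (hsupp a x ha).symm⟩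
  · refine Set.Subsingleton.finite fun a ha b hb => ?_
    exact hg (hinj ((hsupp a x ha).symm.trans (hsupp b x hb)))

theorem formallySummable_of_reindex {f : ι → FormalSeries k K} {f' : κ → FormalSeries k K}
    (hf' : FormallySummable f') {φ : ι → κ} (hφ : Function.Injective φ)
    (h : ∀ a, f a = f' (φ a)) : FormallySummable f := by
  refine ⟨hf'.1.mono (Set.iUnion_subset fun a => ?_), fun x => ?_⟩
  · rw [h]
    exact Set.subset_iUnion (fun b => (f' b).support) (φ a)
  · simp only [h]
    exact (hf'.2 x).preimage hφ.injOn

theorem formalSum_reindex {f : ι → FormalSeries k K} {f' : κ → FormalSeries k K}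
    (hf' : FormallySummable f') {φ : ι → κ} (hφ : Function.Injective φ)
    (h : ∀ a, f a = f' (φ a)) (h0 : ∀ b, b ∉ Set.range φ → f' b = 0) :
    formalSum f = formalSum f' := by
  ext x
  rw [coeff_formalSum (formallySummable_of_reindex hf' hφ h), coeff_formalSum hf']
  simp only [h]
  rw [← finsum_mem_range (f := fun b => (f' b).coeff x) hφ]
  refine finsum_congr fun b => ?_
  classical
  by_cases hb : b ∈ Set.range φ
  · exact finsum_eq_dif _ |>.trans (dif_pos hb)
  · refine (finsum_eq_dif _).trans ((dif_neg hb).trans ?_)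
    rw [h0 b hb, HahnSeries.coeff_zero]

theorem formallySummable_mul {f : ι → FormalSeries k K} {g : κ → FormalSeries k K}
    (hf : FormallySummable f) (hg : FormallySummable g) :
    FormallySummable (fun a : ι × κ => f a.1 * g a.2) ∧
      formalSum f * formalSum g = formalSum (fun a : ι × κ => f a.1 * g a.2) := by
  let s : HahnSeries.SummableFamily (Expo k) K ι :=
    { toFun := f, isPWO_iUnion_support' := hf.1, finite_co_support' := hf.2 }
  let t : HahnSeries.SummableFamily (Expo k) K κ :=
    { toFun := g, isPWO_iUnion_support' := hg.1, finite_co_support' := hg.2 }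
  have hst : FormallySummable (fun a : ι × κ => f a.1 * g a.2) :=
    ⟨(HahnSeries.SummableFamily.mul s t).isPWO_iUnion_support',
      (HahnSeries.SummableFamily.mul s t).finite_co_support'⟩
  refine ⟨hst, ?_⟩
  rw [formalSum, dif_pos hf, formalSum, dif_pos hg, formalSum, dif_pos hst]
  exact (HahnSeries.SummableFamily.hsum_mul s t).symm

theorem mono_pow (e : Expo k) (n : ℕ) : mono K e ^ n = mono K (n • e) := by
  rw [mono, HahnSeries.single_pow, one_pow]
  rfl

theorem mono_mul (e e' : Expo k) : mono K e * mono K e' = mono K (e + e') := by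
  rw [mono, mono, HahnSeries.single_mul_single, one_mul]
  rfl

theorem prod_mono (s : Finset ι) (e : ι → Expo k) :
    ∏ i ∈ s, mono K (e i) = mono K (∑ i ∈ s, e i) := by
  classical
  induction s using Finset.induction_on with
  | empty => rfl
  | insert a s ha ih => rw [Finset.prod_insert ha, Finset.sum_insert ha, ih, mono_mul]

theorem const_mul_mono (c : K) (e : Expo k) : const c * mono K e = HahnSeries.single e c := by
  rw [const, mono, HahnSeries.single_mul_single, zero_add, mul_one]

end FormalSums

section EvalSeries

variable {k : ℕ} {K : Type*} [Field K] {a : Expo k}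

theorem nsmul_le_nsmul_iff_of_pos (ha : 0 < a) (m n : ℕ) : m • a ≤ n • a ↔ m ≤ n :=
  (nsmul_left_strictMono ha).le_iff_le

theorem evalTerm_eq (f : PowerSeries K) (n : ℕ) :
    const (PowerSeries.coeff n f) * mono K a ^ n =
      HahnSeries.single (n • a) (PowerSeries.coeff n f) := by
  rw [mono_pow, const_mul_mono]

theorem formallySummable_evalSeries (ha : 0 < a) (f : PowerSeries K) :
    FormallySummable fun n : ℕ => const (PowerSeries.coeff n f) * mono K a ^ n :=
  formallySummable_single (e := fun n : ℕ => n • a) (nsmul_left_strictMono ha).monotone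
    (nsmul_left_strictMono ha).injective Function.injective_id _ (evalTerm_eq f)

/-- Evaluation at a monomial as a ring homomorphism. -/
def evalHom (K : Type*) [Field K] (ha : 0 < a) : PowerSeries K →+* FormalSeries k K :=
  (HahnSeries.embDomainRingHom (multiplesHom (Expo k) a)
    (nsmul_left_strictMono ha).injective (nsmul_le_nsmul_iff_of_pos ha)).comp
    (HahnSeries.toPowerSeries.symm : PowerSeries K ≃+* HahnSeries ℕ K).toRingHom

theorem evalSeries_eq (ha : 0 < a) (f : PowerSeries K) : evalSeries f a = evalHom K ha f := by
  ext x
  rw [evalSeries, coeff_formalSum (formallySummable_evalSeries ha f)]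
  simp only [evalTerm_eq]
  by_cases hx : ∃ m : ℕ, m • a = x
  · obtain ⟨m, rfl⟩ := hx
    rw [finsum_eq_single _ m]
    · rw [HahnSeries.coeff_single_same]
      exact (HahnSeries.embDomain_coeff (f := ⟨⟨fun n : ℕ => n • a,
        (nsmul_left_strictMono ha).injective⟩, nsmul_le_nsmul_iff_of_pos ha _ _⟩)
        (x := HahnSeries.toPowerSeries.symm f) (a := m)).symm
    · intro n hn
      refine HahnSeries.coeff_single_of_ne fun h => hn ?_
      exact ((nsmul_left_strictMono ha).injective h).symm
  · rw [finsum_eq_zero_of_forall_eq_zero]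
    · symm
      refine HahnSeries.embDomain_of_notMem_range fun h => hx ?_
      obtain ⟨m, hm⟩ := h
      exact ⟨m, hm⟩
    · intro n
      exact HahnSeries.coeff_single_of_ne fun h => hx ⟨n, h.symm⟩

theorem evalSeries_eulerFunction_mul_inv (ha : 0 < a) :
    evalSeries (eulerFunction K) a * evalSeries ((eulerFunction K)⁻¹) a = 1 := by
  rw [evalSeries_eq ha, evalSeries_eq ha, ← map_mul, PowerSeries.mul_inv_cancel, map_one]
  simp [eulerFunction, ← PowerSeries.coeff_zero_eq_constantCoeff_apply]

end EvalSeries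

end

end ALE

namespace ALE

noncomputable section

/-! ### The Cartan matrix and the energy of a colour vector -/

section Lattice

theorem sum_cartan_mul {R : Type*} [CommRing R] (N : ℕ) (x : ℕ → R) (h0 : x 0 = 0)
    (hN : x (N + 1) = 0) (i : Fin N) :
    ∑ j : Fin N, ((CartanMatrix.A N i j : ℤ) : R) * x (j + 1) =
      2 * x (i + 1) - x i - x (i + 2) := by
  have hentry : ∀ j : Fin N, ((CartanMatrix.A N i j : ℤ) : R) * x (j + 1) =
      (if (j : ℕ) = i then 2 * x (j + 1) else 0) - (if (j : ℕ) = i + 1 then x (j + 1) else 0) -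
        (if (j : ℕ) + 1 = i then x (j + 1) else 0) := by
    intro j
    simp only [CartanMatrix.A, Matrix.of_apply, Fin.ext_iff]
    split_ifs <;> first | omega | (push_cast; ring)
  rw [Finset.sum_congr rfl fun j _ => hentry j,
    Fin.sum_univ_eq_sum_range (fun j => (if j = i then 2 * x (j + 1) else 0) -
      (if j = i + 1 then x (j + 1) else 0) - (if j + 1 = i then x (j + 1) else 0)),
    Finset.sum_sub_distrib, Finset.sum_sub_distrib, Finset.sum_ite_eq', Finset.sum_ite_eq',
    if_pos (Finset.mem_range.mpr i.2)]
  have h1 : (if (i : ℕ) + 1 ∈ Finset.range N then x (i + 1 + 1) else 0) = x (i + 2) := by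
    split_ifs with h
    · rfl
    · rw [Finset.mem_range] at h
      rw [show (i : ℕ) + 2 = N + 1 by have := i.2; omega, hN]
  have h2 : ∑ j ∈ Finset.range N, (if j + 1 = (i : ℕ) then x (j + 1) else 0) = x i := by
    rcases Nat.eq_zero_or_pos (i : ℕ) with hi | hi
    · rw [hi, h0]
      exact Finset.sum_eq_zero fun j _ => if_neg (by omega)
    · rw [Finset.sum_eq_single ((i : ℕ) - 1)]
      · rw [if_pos (by omega), show (i : ℕ) - 1 + 1 = i by omega]
      · exact fun j _ hj => if_neg (by omega)
      · intro h
        exact absurd (Finset.mem_range.mpr (by have := i.2; omega)) h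
  rw [h1, h2]
  ring

/-- Summation by parts for the quadratic form of the Cartan matrix. -/
theorem sum_mul_second_difference {R : Type*} [CommRing R] (N : ℕ) (x : ℕ → R) :
    ∑ i ∈ Finset.range N, x (i + 1) * (2 * x (i + 1) - x i - x (i + 2)) =
      ∑ j ∈ Finset.range (N + 1), (x j - x (j + 1)) ^ 2 - x 0 ^ 2 + x 0 * x 1 -
        x (N + 1) ^ 2 + x N * x (N + 1) := by
  induction N with
  | zero => simp; ring
  | succ N ih =>
    rw [Finset.sum_range_succ, ih, Finset.sum_range_succ _ (N + 1)]
    ring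

theorem quadForm_cartan {R : Type*} [CommRing R] (N : ℕ) (x : ℕ → R) (h0 : x 0 = 0)
    (hN : x (N + 1) = 0) :
    ∑ i : Fin N, x (i + 1) * ∑ j : Fin N, ((CartanMatrix.A N i j : ℤ) : R) * x (j + 1) =
      ∑ j ∈ Finset.range (N + 1), (x j - x (j + 1)) ^ 2 := by
  rw [Finset.sum_congr rfl fun i _ => by rw [sum_cartan_mul N x h0 hN i],
    Fin.sum_univ_eq_sum_range (fun i => x (i + 1) * (2 * x (i + 1) - x i - x (i + 2))),
    sum_mul_second_difference, h0, hN]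
  ring

/-- The extension by zero of a vector indexed by `{1, …, N}`. -/
def extendZero {R : Type*} [Zero R] {N : ℕ} (m : Fin N → R) : ℕ → R
  | 0 => 0
  | j + 1 => if h : j < N then m ⟨j, h⟩ else 0

theorem extendZero_succ {R : Type*} [Zero R] {N : ℕ} (m : Fin N → R) (j : Fin N) :
    extendZero m (j + 1) = m j := by
  simp [extendZero]

theorem extendZero_last {R : Type*} [Zero R] {N : ℕ} (m : Fin N → R) :
    extendZero m (N + 1) = 0 := by
  simp [extendZero]

/-- The Cartan matrix is positive definite, hence invertible. -/
theorem isUnit_det_cartan (k : ℕ) : IsUnit (cartan k).det := by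
  rw [isUnit_iff_ne_zero]
  intro hdet
  obtain ⟨m, hm, hCm⟩ := Matrix.exists_mulVec_eq_zero_iff.mpr hdet
  have hq := quadForm_cartan (k - 1) (extendZero m) rfl (extendZero_last m)
  have hrow : ∀ i : Fin (k - 1),
      ∑ j : Fin (k - 1), ((CartanMatrix.A (k - 1) i j : ℤ) : ℚ) * extendZero m (j + 1) = 0 := by
    intro i
    simp only [extendZero_succ]
    exact congrFun hCm i
  rw [Finset.sum_eq_zero fun i _ => by rw [hrow, mul_zero], eq_comm,
    Finset.sum_eq_zero_iff_of_nonneg fun j _ => sq_nonneg _] at hq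
  have hzero : ∀ j, j ≤ k - 1 → extendZero m j = 0 := by
    intro j
    induction j with
    | zero => exact fun _ => rfl
    | succ j ih =>
      intro hj
      have := hq j (Finset.mem_range.mpr (by omega))
      rw [sq_eq_zero_iff, ih (by omega), zero_sub, neg_eq_zero] at this
      exact this
  exact hm (funext fun j => by rw [← extendZero_succ m j, hzero _ j.2, Pi.zero_apply])

theorem cartan_mulVec_cast (k : ℕ) (m : Fin (k - 1) → ℤ) :
    (cartan k).mulVec (fun j => (m j : ℚ)) =
      fun i => (((CartanMatrix.A (k - 1)).mulVec m i : ℤ) : ℚ) := by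
  funext i
  simp only [Matrix.mulVec, dotProduct, cartan, Matrix.map_apply]
  push_cast
  rfl

theorem inv_cartan_mulVec (k : ℕ) (m : Fin (k - 1) → ℤ) :
    (cartan k)⁻¹.mulVec (fun i => (((CartanMatrix.A (k - 1)).mulVec m i : ℤ) : ℚ)) =
      fun j => (m j : ℚ) := by
  rw [← cartan_mulVec_cast, Matrix.mulVec_mulVec, Matrix.nonsing_inv_mul _ (isUnit_det_cartan k),
    Matrix.one_mulVec]

theorem cartanA_mulVec_injective (k : ℕ) :
    Function.Injective (CartanMatrix.A (k - 1)).mulVec := by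
  intro m m' h
  have := inv_cartan_mulVec k m
  rw [h, inv_cartan_mulVec] at this
  funext j
  exact_mod_cast (congrFun this j).symm

theorem transpose_cartan (k : ℕ) : (cartan k).transpose = cartan k := by
  rw [cartan, ← Matrix.transpose_map, CartanMatrix.A_transpose]

theorem sum_mul_inv_cartan (k : ℕ) (m : Fin (k - 1) → ℤ) (j : Fin (k - 1)) :
    ∑ i, (((CartanMatrix.A (k - 1)).mulVec m i : ℤ) : ℚ) * (cartan k)⁻¹ i j = m j := by
  have h := congrFun (inv_cartan_mulVec k m) j
  rw [← h, Matrix.mulVec, dotProduct]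
  refine Finset.sum_congr rfl fun i _ => ?_
  rw [mul_comm]
  congr 1
  rw [← Matrix.transpose_apply (cartan k)⁻¹, Matrix.transpose_nonsing_inv, transpose_cartan]

variable {k : ℕ} [NeZero k]

/-- The energy `v₀ - ½ ∑ (v_i - v_{i+1})²` of a colour vector. -/
def energy (z : ZMod k → ℤ) : ℤ := z 0 - ∑ i, z i * (z i - z (i + 1))

theorem two_mul_energy (z : ZMod k → ℤ) : 2 * energy z = twiceEnergy z := by
  have h : ∑ i, z (i + 1) ^ 2 = ∑ i, z i ^ 2 :=
    Equiv.sum_comp (Equiv.addRight (1 : ZMod k)) (fun i => z i ^ 2)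
  have h1 : ∑ i, (z i - z (i + 1)) ^ 2 =
      2 * ∑ i, z i * (z i - z (i + 1)) + ∑ i, z (i + 1) ^ 2 - ∑ i, z i ^ 2 := by
    rw [Finset.mul_sum, ← Finset.sum_add_distrib, ← Finset.sum_sub_distrib]
    exact Finset.sum_congr rfl fun i _ => by ring
  rw [twiceEnergy, affineForm, h1, h, energy]
  ring

theorem energy_const_add (c : ℤ) (y : ZMod k → ℤ) :
    energy (fun i => c + y i) = c + energy y := by
  have h : ∑ i, (y i - y (i + 1)) = 0 := by
    rw [Finset.sum_sub_distrib, sub_eq_zero]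
    exact (Equiv.sum_comp (Equiv.addRight (1 : ZMod k)) y).symm
  have h1 : ∑ i, (c + y i) * (c + y i - (c + y (i + 1))) =
      c * ∑ i, (y i - y (i + 1)) + ∑ i, y i * (y i - y (i + 1)) := by
    rw [Finset.mul_sum, ← Finset.sum_add_distrib]
    exact Finset.sum_congr rfl fun i _ => by ring
  simp only [energy]
  rw [h1, h]
  ring

/-- The coordinates `v_j - v_0`, `j = 1, …, k-1`. -/
def diffVec (v : Fin k → ℕ) (j : Fin (k - 1)) : ℤ := (v (nodeIndex j) : ℤ) - v 0

/-- The first Chern number attached to a colour vector. -/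
def chernOf (v : Fin k → ℕ) : chernSet k :=
  ⟨(CartanMatrix.A (k - 1)).mulVec (diffVec v), diffVec v, rfl⟩

theorem toZ_zero (v : Fin k → ℕ) : toZ v 0 = v 0 := by
  have := toZ_natCast v (0 : Fin k)
  simpa using this

theorem toZ_nodeIndex (v : Fin k → ℕ) (j : Fin (k - 1)) :
    toZ v (((j : ℕ) + 1 : ℕ) : ZMod k) = v (nodeIndex j) := toZ_natCast v (nodeIndex j)

theorem halfNorm_chernOf (v : Fin k → ℕ) :
    halfNorm k (chernOf v).1 = (v 0 : ℚ) - (energy (toZ v) : ℚ) := by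
  set x : ℕ → ℚ := fun j => (toZ v (j : ZMod k) : ℚ) - toZ v 0 with hx
  have hk : k - 1 + 1 = k := Nat.sub_add_cancel (NeZero.one_le)
  have hxm : ∀ j : Fin (k - 1), x (j + 1) = diffVec v j := by
    intro j
    rw [hx, diffVec, ← toZ_nodeIndex, ← toZ_zero]
    push_cast
    rfl
  have hq := quadForm_cartan (k - 1) x (by simp [hx]) (by simp [hx, hk])
  rw [hk] at hq
  have haff : ∑ j ∈ Finset.range k, (x j - x (j + 1)) ^ 2 = (affineForm (toZ v) : ℚ) := by
    rw [affineForm, sum_zmod_eq_range]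
    push_cast
    refine Finset.sum_congr rfl fun j _ => ?_
    simp only [hx]
    push_cast
    ring
  rw [haff] at hq
  have he := two_mul_energy (toZ v)
  rw [twiceEnergy, toZ_zero] at he
  have he' : (2 : ℚ) * energy (toZ v) = 2 * v 0 - affineForm (toZ v) := by exact_mod_cast he
  have hdot : halfNorm k (chernOf v).1 = (1 / 2) * ∑ i : Fin (k - 1), x (i + 1) *
      ∑ j : Fin (k - 1), ((CartanMatrix.A (k - 1) i j : ℤ) : ℚ) * x (j + 1) := by
    rw [halfNorm, chernOf, inv_cartan_mulVec, dotProduct]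
    congr 1
    refine Finset.sum_congr rfl fun i _ => ?_
    rw [mul_comm, hxm]
    congr 1
    simp only [Matrix.mulVec, dotProduct, hxm]
    push_cast
    rfl
  rw [hdot, hq]
  linarith

theorem eq_of_chernOf_eq {v v' : Fin k → ℕ} (h : chernOf v = chernOf v')
    (he : energy (toZ v) = energy (toZ v')) : v = v' := by
  have hd := cartanA_mulVec_injective k (congrArg Subtype.val h)
  have h0 : v 0 = v' 0 := by
    have h1 := halfNorm_chernOf v
    rw [h, halfNorm_chernOf v', he, sub_left_inj] at h1
    exact_mod_cast h1.symm
  funext i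
  by_cases hi : i = 0
  · rw [hi, h0]
  · have hi' : (i : ℕ) ≠ 0 := fun h => hi (Fin.ext (by simp [h]))
    have hlt : (i : ℕ) - 1 < k - 1 := by have := i.2; omega
    have hnode : i = nodeIndex ⟨(i : ℕ) - 1, hlt⟩ :=
      Fin.ext (by simp only [nodeIndex]; omega)
    have := congrFun hd ⟨(i : ℕ) - 1, hlt⟩
    rw [diffVec, diffVec, ← hnode, h0, sub_left_inj] at this
    exact_mod_cast this

theorem exists_chernOf_eq (u : chernSet k) (n : ℕ) :
    ∃ v : Fin k → ℕ, chernOf v = u ∧ energy (toZ v) = n := by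
  obtain ⟨u, m, rfl⟩ := u
  set y : ZMod k → ℤ := fun i => extendZero m i.val with hy
  set z : ZMod k → ℤ := fun i => (n - energy y) + y i with hz
  have hen : energy z = n := by rw [hz, energy_const_add]; ring
  have hnn : ∀ i, 0 ≤ z i := by
    refine nonneg_of_twiceEnergy_nonneg ?_
    rw [← two_mul_energy, hen]
    positivity
  obtain ⟨v, hv⟩ : ∃ v : Fin k → ℕ, toZ v = z := by
    refine ⟨fun i => (z ((i : ℕ) : ZMod k)).toNat, funext fun i => ?_⟩
    rw [toZ, ZMod.natCast_zmod_val, Int.toNat_of_nonneg (hnn i)]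
  refine ⟨v, ?_, by rw [hv, hen]⟩
  apply Subtype.ext
  change (CartanMatrix.A (k - 1)).mulVec (diffVec v) = _
  congr 1
  funext j
  rw [diffVec, ← toZ_nodeIndex, ← toZ_zero, hv]
  have hj : (j : ℕ) + 1 < k := by have := j.2; omega
  simp only [hz, hy, ZMod.val_natCast_of_lt hj, ZMod.val_zero, extendZero_succ]
  simp [extendZero]

/-- The colour vectors of nonnegative energy are parametrized by pairs of a first Chern number and
an instanton number, the latter being the energy. -/
theorem exists_parametrization : ∃ φ : chernSet k × ℕ → Fin k → ℕ, Function.Injective φ ∧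
    (∀ p, chernOf (φ p) = p.1) ∧ (∀ p, energy (toZ (φ p)) = p.2) ∧
    ∀ v, 0 ≤ energy (toZ v) → φ (chernOf v, (energy (toZ v)).toNat) = v := by
  choose φ h1 h2 using fun p : chernSet k × ℕ => exists_chernOf_eq p.1 p.2
  refine ⟨φ, fun p p' h => ?_, h1, h2, fun v hv => ?_⟩
  · refine Prod.ext ?_ ?_
    · rw [← h1 p, ← h1 p', h]
    · have := (h2 p).symm.trans ((congrArg (fun v => energy (toZ v)) h).trans (h2 p'))
      exact_mod_cast this
  · refine eq_of_chernOf_eq (h1 _) ?_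
    rw [h2, Int.toNat_of_nonneg hv]

end Lattice

/-! ### Exponents -/

section Exponents

variable {k : ℕ}

/-- The exponent of the monomial `q̃ ^ |v| * ∏ q_i ^ (v_i)`. -/
def stackExp (v : Fin k → ℕ) : Expo k := ∑ i, (v i : ℚ) • (qtExp k + qiExp k i)

theorem qtExp_add_qiExp_nonneg (i : Fin k) : 0 ≤ qtExp k + qiExp k i :=
  add_nonneg (Pi.single_nonneg.mpr zero_le_one) (Pi.single_nonneg.mpr zero_le_one)

theorem stackExp_monotone : Monotone (stackExp : (Fin k → ℕ) → Expo k) := by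
  intro v w h
  refine Finset.sum_le_sum fun i _ => ?_
  exact smul_le_smul_of_nonneg_right (by exact_mod_cast h i) (qtExp_add_qiExp_nonneg i)

theorem stackExp_some (v : Fin k → ℕ) (i : Fin k) : stackExp v (some i) = v i := by
  rw [stackExp, Finset.sum_apply, Finset.sum_eq_single i]
  · simp [qtExp, qiExp]
  · intro j _ hj
    simp [qtExp, qiExp, hj.symm]
  · simp

theorem stackExp_injective : Function.Injective (stackExp : (Fin k → ℕ) → Expo k) := by
  intro v w h
  funext i
  have := congrFun h (some i)
  rw [stackExp_some, stackExp_some] at this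
  exact_mod_cast this

theorem qExp_eq : qExp k = ∑ i, (qtExp k + qiExp k i) := by
  rw [Finset.sum_add_distrib, Finset.sum_const, Finset.card_univ, Fintype.card_fin, qExp,
    Nat.cast_smul_eq_nsmul]

theorem stackExp_const (n : ℕ) : stackExp (fun _ : Fin k => n) = n • qExp k := by
  rw [stackExp, ← Finset.smul_sum, ← qExp_eq, Nat.cast_smul_eq_nsmul]

theorem qExp_pos [NeZero k] : 0 < qExp k := by
  rw [qExp_eq]
  refine lt_of_le_of_ne (Finset.sum_nonneg fun i _ => qtExp_add_qiExp_nonneg i) fun h => ?_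
  rw [← qExp_eq, ← one_nsmul (qExp k), ← stackExp_const] at h
  have := congrFun h (some 0)
  rw [stackExp_some] at this
  simp at this

theorem stackMono_eq (K : Type*) [Field K] (v : Fin k → ℕ) :
    stackMono K (∑ i, v i) v = mono K (stackExp v) := by
  rw [stackMono, mono_pow]
  simp only [mono_pow]
  rw [prod_mono, mono_mul, stackExp]
  congr 1
  simp only [smul_add, Finset.sum_add_distrib, Nat.cast_smul_eq_nsmul, Finset.sum_smul]

theorem sum_fin_nodeIndex [NeZero k] {M : Type*} [AddCommMonoid M] (f : Fin k → M) :
    ∑ i, f i = f 0 + ∑ j : Fin (k - 1), f (nodeIndex j) := by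
  obtain ⟨N, rfl⟩ : ∃ N, k = N + 1 := ⟨k - 1, (Nat.sub_add_cancel NeZero.one_le).symm⟩
  rw [Fin.sum_univ_succ]
  rfl

/-- The change of variables between the stacky variables and `q`, `ξ_i`. -/
theorem xkExp_eq [NeZero k] (v : Fin k → ℕ) :
    (v 0 : ℚ) • qExp k + ∑ i, (((chernOf v).1 i : ℤ) : ℚ) • xiExp k i = stackExp v := by
  have h : ∑ i, (((chernOf v).1 i : ℤ) : ℚ) • xiExp k i =
      ∑ j, (diffVec v j : ℚ) • (qtExp k + qiExp k (nodeIndex j)) := by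
    simp only [xiExp, Finset.smul_sum, smul_smul]
    rw [Finset.sum_comm]
    refine Finset.sum_congr rfl fun j _ => ?_
    rw [← Finset.sum_smul]
    congr 1
    exact sum_mul_inv_cartan k (diffVec v) j
  rw [h, stackExp, qExp_eq, sum_fin_nodeIndex, sum_fin_nodeIndex (fun i => (v i : ℚ) • _),
    smul_add, add_assoc, Finset.smul_sum, ← Finset.sum_add_distrib]
  congr 1
  refine Finset.sum_congr rfl fun j _ => ?_
  rw [← add_smul, diffVec]
  push_cast
  congr 1
  ring

end Exponents

end

end ALE

namespace ALE

noncomputable section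

/-! ### The partition functions -/

section PartitionFunctions

variable {k : ℕ} {K : Type*} [Field K]

/-- The family of the multiples of the monomials `q̃ ^ |v| * ∏ q_i ^ (v_i)`. -/
def stackFamily (d : (Fin k → ℕ) → K) (v : Fin k → ℕ) : FormalSeries k K :=
  HahnSeries.single (stackExp v) (d v)

theorem formallySummable_stackFamily (d : (Fin k → ℕ) → K) :
    FormallySummable (stackFamily d) :=
  formallySummable_single stackExp_monotone stackExp_injective Function.injective_id d
    fun _ => rfl

theorem stackFamily_eq_zero {d : (Fin k → ℕ) → K} {v : Fin k → ℕ} (h : d v = 0) :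
    stackFamily d v = 0 := by
  rw [stackFamily, h, HahnSeries.single_eq_zero]

theorem const_mul_stackMono (c : K) (v : Fin k → ℕ) :
    const c * stackMono K (∑ i, v i) v = HahnSeries.single (stackExp v) c := by
  rw [stackMono_eq, const_mul_mono]

theorem stackTerm_eq (ε₁ ε₂ : K) :
    stackTerm k ε₁ ε₂ = stackFamily (invHilbIntegral k ε₁ ε₂) :=
  funext fun v => const_mul_stackMono _ v

variable [NeZero k]

theorem xkMono_chernOf (v : Fin k → ℕ) (n : ℕ) (h : energy (toZ v) = n) :
    xkMono K (qExp k) (xiExp k) ((n : ℚ) + halfNorm k (chernOf v).1) (chernOf v).1 =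
      HahnSeries.single (stackExp v) 1 := by
  rw [xkMono, halfNorm_chernOf, h, ← xkExp_eq]
  simp [mono]

theorem invHilbIntegral_eq [CharZero K] {ε₁ ε₂ : K} (hε : LinearIndependent ℤ ![ε₁, ε₂])
    (v : Fin k → ℕ) : invHilbIntegral k ε₁ ε₂ v =
      if 0 ≤ energy (toZ v) then (1 / ((k : K) * ε₁ * ε₂)) ^ (energy (toZ v)).toNat /
        ((energy (toZ v)).toNat.factorial : K) else 0 := by
  rw [invHilbIntegral_eq_youngSum _ _ (NeZero.ne k), youngSum_eq_hookSum,
    hookSum_eq hε _ _ (two_mul_energy _)]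

/-- The terms of the partition function of the resolution are those terms of the one of the stack
which do not vanish. -/
theorem xkTerm_reindex [CharZero K] {ε₁ ε₂ : K} (hε : LinearIndependent ℤ ![ε₁, ε₂]) :
    FormallySummable (xkTerm k ε₁ ε₂ (qExp k) (xiExp k)) ∧
      stackZ k ε₁ ε₂ = xkZ k ε₁ ε₂ (qExp k) (xiExp k) := by
  obtain ⟨φ, hinj, h1, h2, h3⟩ := exists_parametrization (k := k)
  have hsum := formallySummable_stackFamily (invHilbIntegral k ε₁ ε₂)
  have hterm : ∀ p, xkTerm k ε₁ ε₂ (qExp k) (xiExp k) p =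
      stackFamily (invHilbIntegral k ε₁ ε₂) (φ p) := by
    intro p
    have hm := xkMono_chernOf (K := K) (φ p) p.2 (h2 p)
    rw [h1] at hm
    rw [xkTerm, hm, stackFamily, invHilbIntegral_eq hε, h2, if_pos (by positivity),
      Int.toNat_natCast, xkHilbIntegral_eq hε (NeZero.ne k)]
    exact const_mul_mono _ _
  refine ⟨formallySummable_of_reindex hsum hinj hterm, ?_⟩
  rw [stackZ, xkZ, stackTerm_eq]
  refine (formalSum_reindex hsum hinj hterm fun v hv => stackFamily_eq_zero ?_).symm
  rw [invHilbIntegral_eq hε, if_neg]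
  exact fun h => hv ⟨_, h3 v h⟩

theorem thetaTerm_reindex :
    FormallySummable (thetaTerm K k (qExp k) (xiExp k)) ∧
      formalSum (thetaTerm K k (qExp k) (xiExp k)) =
        formalSum (stackFamily fun v : Fin k → ℕ => if energy (toZ v) = 0 then (1 : K) else 0) := by
  obtain ⟨φ, hinj, h1, h2, h3⟩ := exists_parametrization (k := k)
  have hsum := formallySummable_stackFamily
    fun v : Fin k → ℕ => if energy (toZ v) = 0 then (1 : K) else 0
  have hinj' : Function.Injective fun u => φ (u, 0) := fun u u' h =>
    congrArg Prod.fst (hinj h)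
  have hterm : ∀ u, thetaTerm K k (qExp k) (xiExp k) u =
      stackFamily (fun v : Fin k → ℕ => if energy (toZ v) = 0 then (1 : K) else 0) (φ (u, 0)) := by
    intro u
    have hm := xkMono_chernOf (K := K) (φ (u, 0)) 0 (h2 (u, 0))
    rw [h1, Nat.cast_zero, zero_add] at hm
    rw [thetaTerm, hm, stackFamily, h2, Nat.cast_zero, if_pos rfl]
  refine ⟨formallySummable_of_reindex hsum hinj' hterm, ?_⟩
  refine formalSum_reindex hsum hinj' hterm fun v hv => stackFamily_eq_zero (if_neg fun h => hv ?_)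
  have := h3 v h.ge
  rw [h] at this
  exact ⟨_, this⟩

theorem isCore_iff_energy (Y : YoungDiagram) :
    IsCore k Y ↔ energy (toZ (colourCount k Y)) = 0 := by
  have h : (fun i => (colCount k Y i : ℤ)) = toZ (colourCount k Y) :=
    funext fun i => colCount_eq_toZ Y i
  rw [isCore_iff, h, ← two_mul_energy]
  simp

theorem hookWeight_of_isCore {ε₁ ε₂ : K} {Y : YoungDiagram} (hY : IsCore k Y) :
    hookWeight k ε₁ ε₂ Y = 1 := by
  have h := two_mul_card_hook (k := k) Y
  rw [isCore_iff] at hY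
  rw [hY] at h
  have hc : (Y.cells.filter fun s => k ∣ hook Y s) = ∅ := by
    rw [← Finset.card_eq_zero]
    omega
  rw [hookWeight, hc, Finset.prod_empty]

/-- A colour vector of energy zero is the colour vector of exactly one diagram, because the sum of
the hook products, all of which are one, is one. -/
theorem card_diagrams_of_energy_eq_zero [CharZero K] {ε₁ ε₂ : K}
    (hε : LinearIndependent ℤ ![ε₁, ε₂]) {v : Fin k → ℕ} (hv : energy (toZ v) = 0) :
    (diagrams k (toZ v)).card = 1 := by
  have h := hookSum_eq hε (toZ v) _ (two_mul_energy (toZ v))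
  rw [hv, if_pos le_rfl, hookSum, Finset.sum_congr rfl fun Y hY =>
    hookWeight_of_isCore (ε₁ := ε₁) (ε₂ := ε₂) (k := k) ?_] at h
  · simpa using h
  · rw [isCore_iff_energy, (colourCount_eq_iff Y v).mpr hY, hv]

theorem coreTerm_reindex [CharZero K] {ε₁ ε₂ : K} (hε : LinearIndependent ℤ ![ε₁, ε₂]) :
    FormallySummable (coreTerm K k) ∧ stackCore K k =
      formalSum (stackFamily fun v : Fin k → ℕ => if energy (toZ v) = 0 then (1 : K) else 0) := by
  have hsum := formallySummable_stackFamily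
    fun v : Fin k → ℕ => if energy (toZ v) = 0 then (1 : K) else 0
  have hinj : Function.Injective fun Y : {Y : YoungDiagram // IsCore k Y} => colourCount k Y.1 := by
    intro Y Y' h
    obtain ⟨Z, hZ⟩ := Finset.card_eq_one.mp
      (card_diagrams_of_energy_eq_zero (k := k) hε ((isCore_iff_energy Y.1).mp Y.2))
    have h1 := (colourCount_eq_iff (k := k) Y.1 _).mp rfl
    have h2 := (colourCount_eq_iff (k := k) Y'.1 _).mp h.symm
    rw [hZ, Finset.mem_singleton] at h1 h2
    exact Subtype.ext (h1.trans h2.symm)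
  have hterm : ∀ Y, coreTerm K k Y = stackFamily
      (fun v : Fin k → ℕ => if energy (toZ v) = 0 then (1 : K) else 0) (colourCount k Y.1) := by
    intro Y
    have hcard : Y.1.card = ∑ i, colourCount k Y.1 i := by
      have := sum_toZ (colourCount k Y.1)
      simp only [← colCount_eq_toZ, ← Nat.cast_sum, sum_colCount k Y.1] at this
      exact_mod_cast this
    rw [coreTerm, hcard, stackMono_eq, stackFamily, if_pos ((isCore_iff_energy Y.1).mp Y.2)]
    rfl
  refine ⟨formallySummable_of_reindex hsum hinj hterm, ?_⟩
  refine formalSum_reindex hsum hinj hterm fun v hv => stackFamily_eq_zero (if_neg fun h => hv ?_)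
  obtain ⟨Y, hY⟩ := Finset.card_eq_one.mp (card_diagrams_of_energy_eq_zero (k := k) hε h)
  have hYv : colourCount k Y = v :=
    (colourCount_eq_iff Y v).mpr (by rw [hY]; exact Finset.mem_singleton_self Y)
  exact ⟨⟨Y, (isCore_iff_energy Y).mpr (by rw [hYv, h])⟩, hYv⟩

theorem energy_const (n : ℕ) : energy (toZ fun _ : Fin k => n) = n := by
  simp [energy, toZ]

theorem quotTerm_reindex [CharZero K] {ε₁ ε₂ : K} (hε : LinearIndependent ℤ ![ε₁, ε₂]) :
    FormallySummable (quotTerm k ε₁ ε₂) ∧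
      stackQuot k ε₁ ε₂ = evalSeries (expSeries (1 / ((k : K) * ε₁ * ε₂))) (qExp k) := by
  have hsum := formallySummable_evalSeries (qExp_pos (k := k))
    (expSeries (1 / ((k : K) * ε₁ * ε₂)))
  have hconst : ∀ v : {v : Fin k → ℕ // ∀ i j, v i = v j}, v.1 = fun _ => v.1 0 := fun v =>
    funext fun i => v.2 i 0
  have hinj : Function.Injective fun v : {v : Fin k → ℕ // ∀ i j, v i = v j} => v.1 0 := by
    intro v w h
    apply Subtype.ext
    rw [hconst v, hconst w]
    exact funext fun _ => h
  have hterm : ∀ v : {v : Fin k → ℕ // ∀ i j, v i = v j}, quotTerm k ε₁ ε₂ v =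
      const (PowerSeries.coeff (v.1 0) (expSeries (1 / ((k : K) * ε₁ * ε₂)))) *
        mono K (qExp k) ^ (v.1 0) := by
    intro v
    rw [quotTerm, const_mul_stackMono, evalTerm_eq, ← stackExp_const, ← hconst v,
      ← invHilbIntegral_eq_youngSum _ _ (NeZero.ne k), invHilbIntegral_eq hε]
    have he : energy (toZ v.1) = (v.1 0 : ℕ) := by
      rw [hconst v]
      exact energy_const _
    rw [he, if_pos (by positivity), Int.toNat_natCast, expSeries, PowerSeries.coeff_mk]
  refine ⟨formallySummable_of_reindex hsum hinj hterm, ?_⟩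
  exact formalSum_reindex hsum hinj hterm fun n hn =>
    absurd ⟨⟨fun _ => n, fun _ _ => rfl⟩, rfl⟩ hn

theorem xkZ_eq_mul [CharZero K] {ε₁ ε₂ : K} (hε : LinearIndependent ℤ ![ε₁, ε₂]) :
    xkZ k ε₁ ε₂ (qExp k) (xiExp k) = formalSum (thetaTerm K k (qExp k) (xiExp k)) *
      evalSeries (expSeries (1 / ((k : K) * ε₁ * ε₂))) (qExp k) := by
  rw [evalSeries, (formallySummable_mul thetaTerm_reindex.1
    (formallySummable_evalSeries qExp_pos _)).2, xkZ]
  congr 1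
  funext p
  rw [xkTerm, xkHilbIntegral_eq hε (NeZero.ne k), thetaTerm, xkMono, xkMono, expSeries,
    PowerSeries.coeff_mk, mul_left_comm, mono_pow, mono_mul, add_smul, Nat.cast_smul_eq_nsmul]
  congr 2
  abel

theorem levelOneChar_mul (b : Fin (k - 1) → Expo k) :
    evalSeries (eulerFunction K) (qExp k) ^ (k - 1) * levelOneChar K k (qExp k) b =
      formalSum (thetaTerm K k (qExp k) b) := by
  rw [levelOneChar, ← mul_assoc, ← mul_pow, evalSeries_eulerFunction_mul_inv qExp_pos, one_pow,
    one_mul]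

end PartitionFunctions

end

end ALE

theorem mainTheorem2 {K : Type*} [Field K] [CharZero K] (ε₁ ε₂ : K)
    (hε : LinearIndependent ℤ ![ε₁, ε₂]) (k : ℕ) (hk : 2 ≤ k) :
    -- the torus fixed points are the coloured Young diagrams, and localization
    (∀ v : Fin k → ℕ,
      Set.BijOn (fun I : ALE.StdFixedIdeal => I.ideal) (ALE.invHilbFixed k v)
        (ALE.youngIdeal '' {Y : YoungDiagram | ALE.colourCount k Y = v}) ∧
      Set.InjOn ALE.youngIdeal {Y : YoungDiagram | ALE.colourCount k Y = v} ∧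
      {Y : YoungDiagram | ALE.colourCount k Y = v}.Finite ∧
      ALE.invHilbIntegral k ε₁ ε₂ v = ALE.youngSum k ε₁ ε₂ v) ∧
    -- all the formal sums converge
    (ALE.FormallySummable (ALE.stackTerm k ε₁ ε₂) ∧
      ALE.FormallySummable (ALE.coreTerm K k) ∧
      ALE.FormallySummable (ALE.quotTerm k ε₁ ε₂) ∧
      ALE.FormallySummable (ALE.xkTerm k ε₁ ε₂ (ALE.qExp k) (ALE.xiExp k)) ∧
      ALE.FormallySummable (ALE.thetaTerm K k (ALE.qExp k) (ALE.xiExp k))) ∧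
    -- factorization into the core part and the quotient part
    ALE.stackZ k ε₁ ε₂ = ALE.stackCore K k * ALE.stackQuot k ε₁ ε₂ ∧
    ALE.stackCore K k =
      ALE.evalSeries (ALE.eulerFunction K) (ALE.qExp k) ^ (k - 1) *
        ALE.levelOneChar K k (ALE.qExp k) (ALE.xiExp k) ∧
    ALE.stackQuot k ε₁ ε₂ =
      ALE.evalSeries (ALE.expSeries (1 / ((k : K) * ε₁ * ε₂))) (ALE.qExp k) ∧
    -- equality with the partition function on the minimal resolution, and its closed form
    ALE.stackZ k ε₁ ε₂ = ALE.xkZ k ε₁ ε₂ (ALE.qExp k) (ALE.xiExp k) ∧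
    ALE.xkZ k ε₁ ε₂ (ALE.qExp k) (ALE.xiExp k) =
      ALE.evalSeries (ALE.eulerFunction K) (ALE.qExp k) ^ (k - 1) *
        ALE.levelOneChar K k (ALE.qExp k) (ALE.xiExp k) *
        ALE.evalSeries (ALE.expSeries (1 / ((k : K) * ε₁ * ε₂))) (ALE.qExp k) := by
  have : NeZero k := ⟨by omega⟩
  have hk0 : k ≠ 0 := NeZero.ne k
  have hxk := ALE.xkTerm_reindex (k := k) hε
  have hcore := ALE.coreTerm_reindex (k := k) hε
  have htheta := ALE.thetaTerm_reindex (k := k) (K := K)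
  have hquot := ALE.quotTerm_reindex (k := k) hε
  have hcore' : ALE.stackCore K k =
      ALE.formalSum (ALE.thetaTerm K k (ALE.qExp k) (ALE.xiExp k)) := by
    rw [hcore.2, htheta.2]
  refine ⟨fun v => ⟨?_, ALE.youngIdeal_injective.injOn, ?_,
    ALE.invHilbIntegral_eq_youngSum ε₁ ε₂ hk0 v⟩, ⟨?_, hcore.1, hquot.1, hxk.1, htheta.1⟩,
    ?_, ?_, hquot.2, hxk.2, ?_⟩
  · have hb := ALE.bijOn_invHilbFixed hk0 v
    refine ⟨fun I hI => ?_, ALE.FixedIdeal.ideal_injective.injOn, ?_⟩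
    · obtain ⟨Y, hY, rfl⟩ := hb.surjOn hI
      exact ⟨Y, hY, rfl⟩
    · rintro _ ⟨Y, hY, rfl⟩
      exact ⟨_, hb.mapsTo hY, rfl⟩
  · rw [ALE.setOf_colourCount_eq]
    exact Finset.finite_toSet _
  · rw [ALE.stackTerm_eq]
    exact ALE.formallySummable_stackFamily _
  · rw [hxk.2, hcore', hquot.2, ALE.xkZ_eq_mul hε]
  · rw [hcore', ALE.levelOneChar_mul]
  · rw [ALE.xkZ_eq_mul hε, ALE.levelOneChar_mul]
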